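/- Let $\xi(s)=\tfrac12 s(s-1)\pi^{-s/2}\Gamma(s/2)\zeta(s)$ be the Riemann xi-function (an entire function), let $k\ge 1$ be an integer, let $0<c<1$, and put $$v_k(x)=\frac{1}{2\pi i}\int_{c-i\infty}^{c+i\infty}2^k\xi(s)^k x^{s-1}\,ds\qquad(x>0).$$ Then $v_k(x)$ is real and positive for every $x>0$, and $x^{-1}v_k(x)$ is a probability density on $(0,\infty)$. Let $X_k$ be a random variable with this density. For all $\lambda\in\mathbb R$ and $t\in\mathbb C$ the random variable $\sqrt{X_k}\,e^{\lambda(\log X_k)^2+it\log X_k}$ is integrable, and for its expectation the following holds. (i) If $\lambda\ge \tfrac18$, $t\in\mathbb C$ and $$\mathbb E\Big(\sqrt{X_k}\,e^{\lambda(\log X_k)^2+it\log X_k}\Big)=0,$$ then $t$ is real. (ii) If $\lambda=0$, this equation has infinitely many real solutions $t$. -/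

import Mathlib

open MeasureTheory ProbabilityTheory

noncomputable section

namespace SizeBiased

/-- The Riemann xi-function as an entire function, written with the entire part `Λ₀` of the completed
zeta function `Λ(s) = Λ₀(s) - 1/s - 1/(1-s)`.  It is `½ s (s-1) π^(-s/2) Γ(s/2) ζ(s)`, with the
removable singularities of that product filled in; see `xi_eq`. -/
def xi (s : ℂ) : ℂ := (1 + s * (s - 1) * completedRiemannZeta₀ s) / 2

/-- Where no factor has a pole, `xi` is given by the classical formula. -/
theorem xi_eq (s : ℂ) (h1 : s ≠ 1) (hG : ∀ n : ℕ, s ≠ -(2 * (n : ℂ))) :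
    xi s = 1 / 2 * s * (s - 1) * (Real.pi : ℂ) ^ (-s / 2) * Complex.Gamma (s / 2)
      * riemannZeta s := by
  have h0 : s ≠ 0 := by simpa using hG 0
  have hΓ : Complex.Gammaℝ s ≠ 0 := by
    rw [Ne, Complex.Gammaℝ_eq_zero_iff]
    rintro ⟨n, hn⟩
    exact hG n hn
  have h2 : (1 : ℂ) - s ≠ 0 := sub_ne_zero.mpr (Ne.symm h1)
  have key : (Real.pi : ℂ) ^ (-s / 2) * Complex.Gamma (s / 2) * riemannZeta s
      = completedRiemannZeta s := by
    rw [← Complex.Gammaℝ_def, riemannZeta_def_of_ne_zero h0]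
    field_simp
  have e : 1 / 2 * s * (s - 1) * (Real.pi : ℂ) ^ (-s / 2) * Complex.Gamma (s / 2) * riemannZeta s
      = 1 / 2 * s * (s - 1) *
        ((Real.pi : ℂ) ^ (-s / 2) * Complex.Gamma (s / 2) * riemannZeta s) := by ring
  rw [e, key, completedRiemannZeta_eq, xi]
  field_simp
  ring

/-- `v_k(x) = (1 / 2πi) ∫_{(c)} 2^k ξ(s)^k x^(s-1) ds`, the integral running upwards along the
vertical line `s = c + iy`, so that `ds = i dy`. -/
def v (c : ℝ) (k : ℕ) (x : ℝ) : ℂ :=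
  1 / (2 * Real.pi * Complex.I) * ∫ y : ℝ,
    (2 ^ k * xi (c + y * Complex.I) ^ k * (x : ℂ) ^ ((c + y * Complex.I : ℂ) - 1)) * Complex.I

/-- The distribution on `(0, ∞)` with density `x⁻¹ v_k(x)` with respect to Lebesgue measure. -/
def law (c : ℝ) (k : ℕ) : Measure ℝ :=
  (volume.restrict (Set.Ioi 0)).withDensity fun x => ENNReal.ofReal (x⁻¹ * (v c k x).re)

/-- The random variable `√X · exp(λ (log X)² + i t log X)`, for complex `t`. -/
def weight {Ω : Type*} (X : Ω → ℝ) (lam : ℝ) (t : ℂ) (ω : Ω) : ℂ :=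
  (√(X ω) : ℂ) *
    Complex.exp ((lam : ℂ) * (Real.log (X ω) : ℂ) ^ 2 + Complex.I * t * (Real.log (X ω) : ℂ))

end SizeBiased

end

/-! Write `Φ` for the even positive function whose Fourier transform is `(2ξ(1/2 + iz))^k`. For `k =
1` it is Riemann's theta kernel `phi`, and in general it is a `k`-fold convolution power of it.
Mellin inversion gives `v_k(x) = x^(-1/2) Φ(log x)`, so `v_k` is real and positive, and the total
mass of the law is `(2ξ(0))^k = 1`. After the substitution `x = e^u` the factor `√X` cancels
`e^(-u/2)`, and the expectation becomes the transform `∫ Φ(u) exp(λu² + itu) du`.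

(i) is de Bruijn's theorem. Since `ζ` has no zeros on `Re s ≥ 1`, the functional equation puts the
zeros of the transform of `Φ` in `(Im z)² ≤ 1/4`. Multiplying the kernel by `cosh(au)` averages the
transform over the shifts `z ± ai`; for a real polynomial this lowers the bound `D` on `(Im z)²` to
`max(D - a², 0)`. Taking `n` factors with `na² = 2λ` makes all zeros real once `1/4 ≤ 2λ`, and
`cosh(au)^n` tends to `exp(λu²)`, so Hurwitz's theorem finishes (`GaussKernel.im_eq_zero`). The
passage from polynomials to the transform (`stripLimit_of_growth`) avoids Hadamard products: split
off the zeros in a large disc as a polynomial; the remaining factor is even and zero-free there, so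
its logarithm vanishes to second order at the origin, and growth below every `exp(ε|z|²)` makes it
negligible on compact sets.

(ii) is Hardy's theorem for `ξ`. Let `A` be the theta function with its growth at both ends removed
(`thetaA`). Its transform is real and equals `-2ξ(1/2 + it)/(t² + 1/4)` on the real axis, and `A(u +
iα)` is recovered from it with weight `e^(αt)`. If the transform had finitely many zeros, its sign
would eventually be constant, and `|A(u + iα)|` would be controlled for all `u` by its value at `u =
0`. As `α → π/4` that value stays bounded, because theta is small at the cusp `1`, while at `u =
(log 2)/2` theta approaches a cusp equivalent to `0` and blows up. -/

noncomputable section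

namespace SizeBiased

open Filter Topology Metric ComplexConjugate

/-! ### Hurwitz's theorem, and polynomials with roots in a strip. -/

section

open Polynomial

/-- **Hurwitz's theorem** for entire functions. -/
theorem ne_zero_of_tendstoLocallyUniformly {F : ℕ → ℂ → ℂ} {f : ℂ → ℂ}
    (hF : ∀ n, Differentiable ℂ (F n)) (hlim : TendstoLocallyUniformly F f atTop)
    (hf : ∃ z, f z ≠ 0) {U : Set ℂ} (hU : IsOpen U) (hne : ∀ n, ∀ z ∈ U, F n z ≠ 0) :
    ∀ z ∈ U, f z ≠ 0 := by
  have hdiff : Differentiable ℂ f := by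
    rw [← differentiableOn_univ]
    exact (tendstoLocallyUniformlyOn_univ.mpr hlim).differentiableOn
      (Eventually.of_forall fun n => (hF n).differentiableOn) isOpen_univ
  intro z₀ hz₀ h0
  have han : AnalyticOnNhd ℂ f Set.univ := fun z _ => hdiff.analyticAt z
  rcases (hdiff.analyticAt z₀).eventually_eq_zero_or_eventually_ne_zero with h | h
  · obtain ⟨z, hz⟩ := hf
    exact hz (han.eqOn_zero_of_preconnected_of_eventuallyEq_zero isPreconnected_univ
      (Set.mem_univ z₀) h (Set.mem_univ z))
  obtain ⟨r₁, hr₁, hU₁⟩ := Metric.isOpen_iff.mp hU z₀ hz₀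
  rw [eventually_nhdsWithin_iff, Metric.eventually_nhds_iff] at h
  obtain ⟨r₂, hr₂, h⟩ := h
  set r := min r₁ r₂ / 2 with hr
  have hmin : 0 < min r₁ r₂ := lt_min hr₁ hr₂
  have hr0 : 0 < r := by positivity
  have hrr₁ : r < r₁ := by have := min_le_left r₁ r₂; linarith
  have hrr₂ : r < r₂ := by have := min_le_right r₁ r₂; linarith
  have hball : closedBall z₀ r ⊆ U := (closedBall_subset_ball hrr₁).trans hU₁
  have hsph : ∀ z ∈ sphere z₀ r, f z ≠ 0 := by
    intro z hz
    refine h (by rw [mem_sphere.mp hz]; exact hrr₂) ?_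
    rintro rfl
    simp at hz
    exact hr0.ne hz
  obtain ⟨w, hw, hwmin⟩ := (isCompact_sphere z₀ r).exists_isMinOn
    (NormedSpace.sphere_nonempty.mpr hr0.le) hdiff.continuous.norm.continuousOn
  set m := ‖f w‖ with hm
  have hm0 : 0 < m := norm_pos_iff.mpr (hsph w hw)
  have hunif := (tendstoLocallyUniformlyOn_iff_forall_isCompact isOpen_univ).mp
    (tendstoLocallyUniformlyOn_univ.mpr hlim) (closedBall z₀ r) (Set.subset_univ _)
    (isCompact_closedBall z₀ r)
  obtain ⟨n, hn⟩ := (Metric.tendstoUniformlyOn_iff.mp hunif (m / 2) (by positivity)).exists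
  -- The maximum principle for the reciprocal carries the lower bound `m / 2` from the circle to the
  -- centre, where uniform closeness to `f z₀ = 0` forces the opposite strict bound.
  have hbd : ‖(F n z₀)⁻¹‖ ≤ (m / 2)⁻¹ := by
    refine Complex.norm_le_of_forall_mem_frontier_norm_le (U := ball z₀ r) isBounded_ball
      (f := fun z => (F n z)⁻¹) ?_ ?_ (subset_closure (mem_ball_self hr0))
    · refine DifferentiableOn.diffContOnCl ?_
      rw [closure_ball _ hr0.ne']
      exact (hF n).differentiableOn.inv fun z hz => hne n z (hball hz)
    · intro z hz
      rw [frontier_ball _ hr0.ne'] at hz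
      have h1 := hn z (sphere_subset_closedBall hz)
      have h2 : m ≤ ‖f z‖ := hwmin hz
      rw [dist_eq_norm] at h1
      have h3 := norm_sub_norm_le (f z) (F n z)
      rw [norm_inv]
      exact inv_anti₀ (by positivity) (by linarith)
  have h1 := hn z₀ (mem_closedBall_self hr0.le)
  rw [h0, dist_zero_left] at h1
  have h2 : 0 < ‖F n z₀‖ := norm_pos_iff.mpr (hne n z₀ hz₀)
  rw [norm_inv, inv_le_inv₀ h2 (by positivity)] at hbd
  linarith

/-- The average of the translates of `f` by `±a i`. -/
def shiftAvg (a : ℝ) (f : ℂ → ℂ) (z : ℂ) : ℂ :=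
  (f (z + a * Complex.I) + f (z - a * Complex.I)) / 2

/-- Locally uniform limits of polynomials with real coefficients, all of whose roots `w` satisfy
`(im w)² ≤ D`. -/
def StripLimit (D : ℝ) (f : ℂ → ℂ) : Prop :=
  ∃ P : ℕ → ℂ[X], (∀ n w, (P n).eval (conj w) = conj ((P n).eval w)) ∧
    (∀ n w, (P n).eval w = 0 → w.im ^ 2 ≤ D) ∧
    TendstoLocallyUniformly (fun n z => (P n).eval z) f atTop

theorem norm_eval_eq_prod (P : ℂ[X]) (w : ℂ) :
    ‖P.eval w‖ = ‖P.leadingCoeff‖ * (P.roots.map fun ρ => ‖w - ρ‖).prod := by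
  have hs : P.Splits := IsAlgClosed.splits P
  conv_lhs => rw [hs.eq_prod_roots]
  rw [eval_mul, eval_C, norm_mul, eval_multiset_prod, Multiset.map_map]
  congr 1
  have h := map_multiset_prod (normHom : ℂ →*₀ ℝ) (P.roots.map (eval w ∘ fun x => X - C x))
  rw [Multiset.map_map] at h
  refine h.trans (congrArg Multiset.prod (Multiset.map_congr rfl fun x _ => ?_))
  simp

theorem multiset_prod_lt_prod {s : Multiset ℂ} {f g : ℂ → ℝ} (hs : s ≠ 0)
    (h0 : ∀ x ∈ s, 0 ≤ f x) (h : ∀ x ∈ s, f x < g x) : (s.map f).prod < (s.map g).prod := by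
  induction s using Multiset.induction with
  | empty => exact absurd rfl hs
  | cons a s ih =>
    simp only [Multiset.map_cons, Multiset.prod_cons]
    have ha := h a (Multiset.mem_cons_self a s)
    have ha0 := h0 a (Multiset.mem_cons_self a s)
    rcases eq_or_ne s 0 with rfl | hs'
    · simpa using ha
    · have := ih hs' (fun x hx => h0 x (Multiset.mem_cons_of_mem hx))
        (fun x hx => h x (Multiset.mem_cons_of_mem hx))
      have hp : 0 ≤ (s.map f).prod := by
        refine Multiset.prod_nonneg fun y hy => ?_
        obtain ⟨x, hx, rfl⟩ := Multiset.mem_map.mp hy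
        exact h0 x (Multiset.mem_cons_of_mem hx)
      exact mul_lt_mul'' ha this ha0 hp

/-- Pairing the evaluation points `w`, `conj w` rather than the roots makes each factor symmetric in
the sign of `ρ.im`, so conjugate roots need not be matched with multiplicities. -/
theorem normSq_mul_conj_pair (w ρ : ℂ) : (‖w - ρ‖ * ‖conj w - ρ‖) ^ 2 =
    ((w.re - ρ.re) ^ 2 + (w.im - ρ.im) ^ 2) * ((w.re - ρ.re) ^ 2 + (w.im + ρ.im) ^ 2) := by
  rw [mul_pow, ← Complex.normSq_eq_norm_sq, ← Complex.normSq_eq_norm_sq, Complex.normSq_apply,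
    Complex.normSq_apply]
  simp
  ring

/-- A zero would force `|P|` to agree at `z + ai` and `z - ai`; but above the bound every single
root contributes strictly more to `|P|²` at the first point than at the second. -/
theorem eval_shiftAvg_ne_zero {P : ℂ[X]} {D a : ℝ} (ha : 0 < a)
    (hP : ∀ w, P.eval (conj w) = conj (P.eval w)) (hroot : ∀ w, P.eval w = 0 → w.im ^ 2 ≤ D)
    {z : ℂ} (hz : 0 < z.im) (hzD : D - a ^ 2 < z.im ^ 2) :
    shiftAvg a (fun w => P.eval w) z ≠ 0 := by
  have hP0 : P ≠ 0 := by
    rintro rfl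
    obtain ⟨y, hy⟩ : ∃ y : ℝ, D < y ^ 2 := ⟨|D| + 1, by nlinarith [le_abs_self D, abs_nonneg D]⟩
    have := hroot ⟨0, y⟩ (by simp)
    simp at this
    linarith
  intro h
  rw [shiftAvg, div_eq_zero_iff] at h
  replace h := h.resolve_right two_ne_zero
  have hnorm : ‖P.eval (z - a * Complex.I)‖ = ‖P.eval (z + a * Complex.I)‖ := by
    rw [eq_neg_of_add_eq_zero_left h, norm_neg]
  have key : ∀ w, ‖P.eval w‖ ^ 2 = ‖P.leadingCoeff‖ ^ 2 *
      (P.roots.map fun ρ => ‖w - ρ‖ * ‖conj w - ρ‖).prod := by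
    intro w
    have : ‖P.eval (conj w)‖ = ‖P.eval w‖ := by rw [hP, Complex.norm_conj]
    rw [Multiset.prod_map_mul]
    calc ‖P.eval w‖ ^ 2 = ‖P.eval w‖ * ‖P.eval (conj w)‖ := by rw [this, sq]
      _ = _ := by rw [norm_eval_eq_prod, norm_eval_eq_prod P (conj w)]; ring
  rcases eq_or_ne P.roots 0 with hr | hr
  · have hc : ∀ w, P.eval w = P.leadingCoeff := by
      intro w
      have hs : P.Splits := IsAlgClosed.splits P
      conv_lhs => rw [hs.eq_prod_roots, hr]
      simp
    rw [hc, hc, ← two_mul] at h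
    simp [hP0] at h
  · have hlt := multiset_prod_lt_prod (f := fun ρ => ‖(z - a * Complex.I) - ρ‖ *
        ‖conj (z - a * Complex.I) - ρ‖)
      (g := fun ρ => ‖(z + a * Complex.I) - ρ‖ * ‖conj (z + a * Complex.I) - ρ‖) hr
      (fun ρ _ => by positivity) (fun ρ hρ => by
        refine lt_of_pow_lt_pow_left₀ 2 (by positivity) ?_
        rw [normSq_mul_conj_pair, normSq_mul_conj_pair]
        have hρD := hroot ρ (isRoot_of_mem_roots hρ)
        simp only [Complex.sub_re, Complex.mul_re, Complex.ofReal_re, Complex.I_re, mul_zero,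
          Complex.ofReal_im, Complex.I_im, mul_one, sub_zero, Complex.sub_im,
          Complex.mul_im, add_zero, Complex.add_re, Complex.add_im, sub_self]
        -- The squared contributions of `ρ` at the two points differ by exactly the product of the
        -- quantities in `h1` and `h2`.
        have h1 : 0 < 4 * a * z.im := by positivity
        have h2 : 0 < 2 * (z.re - ρ.re) ^ 2 + 2 * (z.im ^ 2 + a ^ 2 - ρ.im ^ 2) := by
          nlinarith [sq_nonneg (z.re - ρ.re)]
        nlinarith [mul_pos h1 h2])
    have h1 := key (z - a * Complex.I)
    have h2 := key (z + a * Complex.I)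
    rw [hnorm] at h1
    have hl : 0 < ‖P.leadingCoeff‖ ^ 2 := by
      have := norm_pos_iff.mpr (leadingCoeff_ne_zero.mpr hP0)
      positivity
    exact absurd (h1.symm.trans h2) (mul_lt_mul_of_pos_left hlt hl).ne

theorem shiftAvg_conj {f : ℂ → ℂ} (hf : ∀ w, f (conj w) = conj (f w)) (a : ℝ) (w : ℂ) :
    shiftAvg a f (conj w) = conj (shiftAvg a f w) := by
  have h1 : conj w + a * Complex.I = conj (w - a * Complex.I) := by simp
  have h2 : conj w - a * Complex.I = conj (w + a * Complex.I) := by simp [sub_eq_add_neg]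
  rw [shiftAvg, shiftAvg, h1, h2, hf, hf, map_div₀, map_add, Complex.conj_ofNat,
    add_comm (conj (f (w - a * Complex.I)))]

theorem StripLimit.shiftAvg {D a : ℝ} (ha : 0 < a) {f : ℂ → ℂ} (hf : StripLimit D f) :
    StripLimit (max (D - a ^ 2) 0) (shiftAvg a f) := by
  obtain ⟨P, hconj, hroot, hlim⟩ := hf
  have heval : ∀ n z, (C (1 / 2) * ((P n).comp (X + C (a * Complex.I)) +
      (P n).comp (X - C (a * Complex.I)))).eval z =
      SizeBiased.shiftAvg a (fun w => (P n).eval w) z := by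
    intro n z
    simp [SizeBiased.shiftAvg]
    ring
  refine ⟨fun n => C (1 / 2) * ((P n).comp (X + C (a * Complex.I)) +
    (P n).comp (X - C (a * Complex.I))), fun n w => ?_, fun n w hw => ?_, ?_⟩
  · rw [heval, heval, shiftAvg_conj (hconj n)]
  · rw [heval] at hw
    by_contra! hcon
    obtain ⟨h1, h2⟩ := max_lt_iff.mp hcon
    rcases lt_trichotomy w.im 0 with h | h | h
    · refine eval_shiftAvg_ne_zero ha (hconj n) (hroot n) (z := conj w) (by simpa using h)
        (by simpa using h1) ?_
      rw [shiftAvg_conj (hconj n), hw, map_zero]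
    · simp [h] at h2
    · exact eval_shiftAvg_ne_zero ha (hconj n) (hroot n) h h1 hw
  · simp_rw [heval]
    have h1 := hlim.comp (fun z : ℂ => z + a * Complex.I) (by fun_prop)
    have h2 := hlim.comp (fun z : ℂ => z - a * Complex.I) (by fun_prop)
    have h3 := h1.add h2
    have h4 := (uniformContinuous_const_smul (1 / 2 : ℂ)).comp_tendstoLocallyUniformly h3
    have e : SizeBiased.shiftAvg a f = (fun z => (1 / 2 : ℂ) • z) ∘
        ((f ∘ fun z => z + a * Complex.I) + (f ∘ fun z => z - a * Complex.I)) := by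
      ext z
      simp [SizeBiased.shiftAvg]
      ring
    rw [e]
    refine h4.congr fun n z => ?_
    simp [SizeBiased.shiftAvg]
    ring

theorem StripLimit.im_sq_le {D : ℝ} {f : ℂ → ℂ} (hf : StripLimit D f) (hne : ∃ z, f z ≠ 0)
    {z : ℂ} (hz : f z = 0) : z.im ^ 2 ≤ D := by
  obtain ⟨P, -, hroot, hlim⟩ := hf
  by_contra! hcon
  refine ne_zero_of_tendstoLocallyUniformly (fun n => (P n).differentiable) hlim hne
    (U := {z | D < z.im ^ 2}) ?_ (fun n w hw h => ?_) z hcon hz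
  · exact isOpen_lt continuous_const (by fun_prop)
  · exact absurd (hroot n w h) (not_le.mpr hw)

theorem StripLimit.iterate {D a : ℝ} (ha : 0 < a) {f : ℂ → ℂ} (hf : StripLimit D f)
    (hD : 0 ≤ D) (n : ℕ) :
    StripLimit (max (D - n * a ^ 2) 0) ((SizeBiased.shiftAvg a)^[n] f) := by
  induction n with
  | zero => simpa [hD] using hf
  | succ n ih =>
    rw [Function.iterate_succ_apply']
    convert ih.shiftAvg ha using 1
    push_cast
    rw [← max_sub_sub_right, max_assoc]
    congr 1
    · ring
    · rw [max_eq_right]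
      nlinarith [sq_nonneg a]

/-- Factor by factor, `|z - ρ| ≥ |z| - R ≥ κR ≥ κ|ρ|`. -/
theorem pow_card_mul_prod_le {s : Multiset ℂ} {R κ : ℝ} (hκ : 0 ≤ κ) (hs : ∀ ρ ∈ s, ‖ρ‖ ≤ R)
    {z : ℂ} (hz : (1 + κ) * R ≤ ‖z‖) :
    κ ^ s.card * (s.map fun ρ => ‖0 - ρ‖).prod ≤ (s.map fun ρ => ‖z - ρ‖).prod := by
  induction s using Multiset.induction with
  | empty => simp
  | cons a s ih =>
    simp only [Multiset.map_cons, Multiset.prod_cons, Multiset.card_cons, pow_succ]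
    have ha := hs a (Multiset.mem_cons_self a s)
    have h1 := ih fun ρ hρ => hs ρ (Multiset.mem_cons_of_mem hρ)
    have h2 : κ * ‖0 - a‖ ≤ ‖z - a‖ := by
      have := norm_sub_norm_le z a
      rw [zero_sub, norm_neg]
      nlinarith
    have h3 : 0 ≤ (s.map fun ρ => ‖0 - ρ‖).prod := Multiset.prod_nonneg fun y hy => by
      obtain ⟨x, -, rfl⟩ := Multiset.mem_map.mp hy
      positivity
    calc _ = (κ * ‖0 - a‖) * (κ ^ s.card * (s.map fun ρ => ‖0 - ρ‖).prod) := by ring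
      _ ≤ _ := mul_le_mul h2 h1 (by positivity) (by positivity)

/-- A substitute for Jensen's formula. With `κ = 2` on the circle of radius `3R` it limits the
number of zeros; with `κ = 1` on the circle of radius `2R` it shows that dividing by `P` does not
increase the modulus. -/
theorem pow_natDegree_le_norm_eval {P : ℂ[X]} {R κ : ℝ} (hκ : 0 ≤ κ) (h1 : P.eval 0 = 1)
    (hP : ∀ w, P.eval w = 0 → ‖w‖ ≤ R) {z : ℂ} (hz : (1 + κ) * R ≤ ‖z‖) :
    κ ^ P.natDegree ≤ ‖P.eval z‖ := by
  have h0 := norm_eval_eq_prod P 0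
  have hs : P.Splits := IsAlgClosed.splits P
  have h2 := pow_card_mul_prod_le (s := P.roots) hκ
    (fun ρ hρ => hP ρ (isRoot_of_mem_roots hρ)) hz
  rw [← hs.natDegree_eq_card_roots] at h2
  rw [h1, norm_one] at h0
  calc κ ^ P.natDegree = ‖P.leadingCoeff‖ * (κ ^ P.natDegree *
      (P.roots.map fun ρ => ‖0 - ρ‖).prod) := by rw [mul_left_comm, ← h0, mul_one]
    _ ≤ _ := by
      rw [norm_eval_eq_prod P z]
      gcongr

/-- An entire function not vanishing at the origin is the product of a polynomial carrying its
zeros in a closed disc and an entire function without zeros there. -/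
theorem exists_polynomial_factor {f : ℂ → ℂ} (hf : Differentiable ℂ f) (hf0 : f 0 ≠ 0) {R : ℝ}
    (hR : 0 < R) : ∃ (P : ℂ[X]) (h : ℂ → ℂ), Differentiable ℂ h ∧ (∀ z, f z = P.eval z * h z) ∧
      P.eval 0 = 1 ∧ (∀ w, P.eval w = 0 → ‖w‖ ≤ R) ∧ ∀ z, ‖z‖ ≤ R → h z ≠ 0 := by
  -- The degrees of admissible factors are bounded, so a factor of maximal degree exists; a further
  -- zero `r` of its cofactor in the disc would allow the extra factor `1 - z/r`.
  set S : Set ℕ := {d | ∃ (P : ℂ[X]) (h : ℂ → ℂ), Differentiable ℂ h ∧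
    (∀ z, f z = P.eval z * h z) ∧ P.eval 0 = 1 ∧ (∀ w, P.eval w = 0 → ‖w‖ ≤ R) ∧
    P.natDegree = d} with hS
  obtain ⟨M, hM⟩ := (isCompact_sphere (0 : ℂ) (3 * R)).exists_bound_of_continuousOn
    hf.continuous.continuousOn
  have hfpos : 0 < ‖f 0‖ := norm_pos_iff.mpr hf0
  have hbdd : BddAbove S := by
    obtain ⟨N, hN⟩ := pow_unbounded_of_one_lt (M / ‖f 0‖) (one_lt_two)
    refine ⟨N, ?_⟩
    rintro d ⟨P, h, hh, hfac, hP1, hroot, rfl⟩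
    by_contra! hcon
    have hh0 : h 0 = f 0 := by rw [hfac 0, hP1, one_mul]
    have hbd : ‖h 0‖ ≤ M / 2 ^ P.natDegree := by
      refine Complex.norm_le_of_forall_mem_frontier_norm_le (U := ball 0 (3 * R)) isBounded_ball
        hh.diffContOnCl (fun z hz => ?_) (subset_closure (mem_ball_self (by positivity)))
      rw [frontier_ball _ (by positivity)] at hz
      have h1 := hM z hz
      rw [mem_sphere_zero_iff_norm] at hz
      have h2 : (2 : ℝ) ^ P.natDegree ≤ ‖P.eval z‖ :=
        pow_natDegree_le_norm_eval zero_le_two hP1 hroot (by rw [hz]; linarith)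
      rw [le_div_iff₀ (by positivity)]
      calc ‖h z‖ * 2 ^ P.natDegree ≤ ‖h z‖ * ‖P.eval z‖ := by gcongr
        _ = ‖f z‖ := by rw [hfac z, norm_mul, mul_comm]
        _ ≤ M := h1
    rw [hh0, le_div_iff₀ (by positivity)] at hbd
    rw [div_lt_iff₀ hfpos] at hN
    have : (2 : ℝ) ^ N ≤ 2 ^ P.natDegree := pow_le_pow_right₀ one_le_two hcon.le
    nlinarith
  have hne : S.Nonempty := ⟨0, 1, f, hf, by simp, by simp, by simp, by simp⟩
  obtain ⟨P, h, hh, hfac, hP1, hroot, hdeg⟩ := Nat.sSup_mem hne hbdd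
  refine ⟨P, h, hh, hfac, hP1, hroot, fun r hr hhr => ?_⟩
  have hr0 : r ≠ 0 := by
    rintro rfl
    exact hf0 (by rw [hfac, hhr, mul_zero])
  have hP0 : P ≠ 0 := by
    rintro rfl
    simp at hP1
  have hQ0 : (1 - C r⁻¹ * X : ℂ[X]) ≠ 0 := by
    intro h
    have := congrArg (eval 0) h
    simp at this
  have hQ : (1 - C r⁻¹ * X : ℂ[X]).natDegree = 1 := by
    have : (1 - C r⁻¹ * X : ℂ[X]) = C (-r⁻¹) * X + C 1 := by
      simp [sub_eq_add_neg, add_comm]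
    rw [this]
    exact natDegree_linear (neg_ne_zero.mpr (inv_ne_zero hr0))
  have hmem : P.natDegree + 1 ∈ S := by
    refine ⟨P * (1 - C r⁻¹ * X), fun z => -r * dslope h r z, ?_, fun z => ?_, ?_, ?_, ?_⟩
    · refine Differentiable.const_mul ?_ _
      rw [← differentiableOn_univ] at hh ⊢
      exact (Complex.differentiableOn_dslope univ_mem).mpr hh
    · rw [hfac z]
      have := sub_smul_dslope h r z
      rw [hhr, sub_zero, smul_eq_mul] at this
      simp only [eval_mul, eval_sub, eval_one, eval_C, eval_X]
      rw [← this]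
      field_simp
      ring
    · simp [hP1]
    · intro w hw
      rw [eval_mul, mul_eq_zero] at hw
      rcases hw with hw | hw
      · exact hroot w hw
      · have : w = r := by
          simp only [eval_sub, eval_one, eval_mul, eval_C, eval_X] at hw
          field_simp at hw
          linear_combination -hw
        rwa [this]
    · rw [natDegree_mul hP0 hQ0, hQ]
  have := le_csSup hbdd hmem
  omega

/-- After division by the gcd the two polynomials are coprime, and a root of either would be a zero
of the other or of a cofactor inside the disc; hence both quotients are constant. Uniqueness is what
transfers the symmetries of `f` to its polynomial factor. -/
theorem polynomial_factor_unique {f h₁ h₂ : ℂ → ℂ} {P₁ P₂ : ℂ[X]} {R : ℝ}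
    (hh₁ : Continuous h₁) (hh₂ : Continuous h₂)
    (hf₁ : ∀ z, f z = P₁.eval z * h₁ z) (hf₂ : ∀ z, f z = P₂.eval z * h₂ z)
    (h1₁ : P₁.eval 0 = 1) (h1₂ : P₂.eval 0 = 1)
    (hr₁ : ∀ w, P₁.eval w = 0 → ‖w‖ ≤ R) (hr₂ : ∀ w, P₂.eval w = 0 → ‖w‖ ≤ R)
    (hn₁ : ∀ z, ‖z‖ ≤ R → h₁ z ≠ 0) (hn₂ : ∀ z, ‖z‖ ≤ R → h₂ z ≠ 0) : P₁ = P₂ := by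
  classical
  have hP₁ : P₁ ≠ 0 := by rintro rfl; simp at h1₁
  set G := EuclideanDomain.gcd P₁ P₂ with hG
  obtain ⟨A, hA⟩ : G ∣ P₁ := EuclideanDomain.gcd_dvd_left _ _
  obtain ⟨B, hB⟩ : G ∣ P₂ := EuclideanDomain.gcd_dvd_right _ _
  have hG0 : G ≠ 0 := by
    intro h
    rw [h, zero_mul] at hA
    exact hP₁ hA
  have hcop : IsCoprime A B := by
    refine ⟨EuclideanDomain.gcdA P₁ P₂, EuclideanDomain.gcdB P₁ P₂, mul_left_cancel₀ hG0 ?_⟩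
    have h1 : G = P₁ * EuclideanDomain.gcdA P₁ P₂ + P₂ * EuclideanDomain.gcdB P₁ P₂ :=
      EuclideanDomain.gcd_eq_gcd_ab P₁ P₂
    generalize EuclideanDomain.gcdA P₁ P₂ = u at h1 ⊢
    generalize EuclideanDomain.gcdB P₁ P₂ = v at h1 ⊢
    calc G * (u * A + v * B) = (G * A) * u + (G * B) * v := by ring
      _ = G * 1 := by rw [← hA, ← hB, ← h1, mul_one]
  have hAB : ∀ z, A.eval z * h₁ z = B.eval z * h₂ z := by
    have hden : Dense {z : ℂ | G.eval z ≠ 0} := by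
      have : {z : ℂ | G.eval z ≠ 0} = ((G.roots.toFinset : Set ℂ))ᶜ := by
        ext z
        simp [hG0]
      rw [this]
      exact (G.roots.toFinset.finite_toSet.countable).dense_compl ℂ
    refine fun z => congrFun (Continuous.ext_on hden (f := fun z => A.eval z * h₁ z)
      (g := fun z => B.eval z * h₂ z) (by fun_prop) (by fun_prop) fun w hw => ?_) z
    have : G.eval w * (A.eval w * h₁ w) = G.eval w * (B.eval w * h₂ w) := by
      rw [← mul_assoc, ← eval_mul, ← hA, ← mul_assoc, ← eval_mul, ← hB, ← hf₁, ← hf₂]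
    exact mul_left_cancel₀ hw this
  have hnocommon : ∀ z, A.eval z = 0 → B.eval z = 0 → False := by
    intro z ha hb
    obtain ⟨u, v, huv⟩ := hcop
    have := congrArg (eval z) huv
    simp [ha, hb] at this
  have hconst : ∀ {Q : ℂ[X]}, (∀ z, Q.eval z ≠ 0) → ∃ c, Q = C c := by
    intro Q hQ
    refine ⟨Q.coeff 0, eq_C_of_degree_le_zero ?_⟩
    by_contra! hd
    obtain ⟨z, hz⟩ := Complex.exists_root hd
    exact hQ z hz
  obtain ⟨c, hc⟩ := hconst (Q := A) fun z hz => by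
    have h := hAB z
    rw [hz, zero_mul, eq_comm, mul_eq_zero] at h
    have hz1 : P₁.eval z = 0 := by rw [hA, eval_mul, hz, mul_zero]
    exact hnocommon z hz (h.resolve_right (hn₂ z (hr₁ z hz1)))
  obtain ⟨d, hd⟩ := hconst (Q := B) fun z hz => by
    have h := hAB z
    rw [hz, zero_mul, mul_eq_zero] at h
    have hz1 : P₂.eval z = 0 := by rw [hB, eval_mul, hz, mul_zero]
    exact hnocommon z (h.resolve_right (hn₁ z (hr₂ z hz1))) hz
  rw [hA, hc, eval_mul, eval_C] at h1₁
  rw [hB, hd, eval_mul, eval_C] at h1₂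
  have hg : G.eval 0 ≠ 0 := by
    intro h
    simp [h] at h1₁
  rw [hA, hB, hc, hd, mul_left_cancel₀ hg (h1₁.trans h1₂.symm)]

/-- A bounded, even, zero-free holomorphic function on a disc is close to a constant near the
centre. -/
theorem exists_log_of_even {h : ℂ → ℂ} (hh : Differentiable ℂ h) (heven : ∀ z, h (-z) = h z)
    {R L : ℝ} (hR : 0 < R) (hL : 0 < L) (hne : ∀ z ∈ ball (0 : ℂ) R, h z ≠ 0)
    (hbd : ∀ z ∈ ball (0 : ℂ) R, ‖h z‖ ≤ ‖h 0‖ * Real.exp L) :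
    ∃ g : ℂ → ℂ, ∀ z ∈ ball (0 : ℂ) (R / 2), h z = h 0 * Complex.exp (g z) ∧
      ‖g z‖ ≤ 4 * L * (‖z‖ / R) ^ 2 := by
  have h0 : h 0 ≠ 0 := hne 0 (mem_ball_self hR)
  have hd : DifferentiableOn ℂ (fun z => deriv h z / h z) (ball 0 R) :=
    hh.deriv.differentiableOn.div hh.differentiableOn hne
  obtain ⟨g, hg0, hg⟩ := hd.isExactOn_ball.with_val_at 0 0
  have hexp : ∀ z ∈ ball (0 : ℂ) R, h z = h 0 * Complex.exp (g z) := by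
    intro z hz
    have hder : ∀ w ∈ ball (0 : ℂ) R,
        HasDerivWithinAt (fun w => h w * Complex.exp (-g w)) 0 (ball 0 R) w := by
      intro w hw
      have h1 := (hh w).hasDerivAt.mul (hg w hw).neg.cexp
      refine (h1.congr_deriv ?_).hasDerivWithinAt
      have := hne w hw
      field_simp
      ring
    have hc := (convex_ball (0 : ℂ) R).is_const_of_fderivWithin_eq_zero (𝕜 := ℂ)
      (f := fun w => h w * Complex.exp (-g w))
      (fun w hw => (hder w hw).differentiableWithinAt) (fun w hw => by
        have := (hder w hw).hasFDerivWithinAt.fderivWithin (isOpen_ball.uniqueDiffWithinAt hw)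
        rw [this]
        ext
        simp) hz (mem_ball_self hR)
    simp only [hg0, neg_zero, Complex.exp_zero, mul_one] at hc
    rw [← hc, mul_assoc, ← Complex.exp_add]
    simp
  have hre : ∀ z ∈ ball (0 : ℂ) R, (g z).re ≤ L := by
    intro z hz
    have h1 := hbd z hz
    rw [hexp z hz, norm_mul, Complex.norm_exp] at h1
    exact Real.exp_le_exp.mp (le_of_mul_le_mul_left h1 (norm_pos_iff.mpr h0))
  have hh' : deriv h 0 = 0 := by
    have h1 : deriv (fun z => h (-z)) 0 = -deriv h (-0) := deriv_comp_neg h 0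
    simp_rw [heven] at h1
    rw [neg_zero] at h1
    exact self_eq_neg.mp h1
  have hden : ∀ z ∈ ball (0 : ℂ) R, 2 * (L : ℂ) - g z ≠ 0 := by
    intro z hz h
    have h1 := congrArg Complex.re h
    simp at h1
    linarith [hre z hz]
  have hgd : DifferentiableOn ℂ g (ball 0 R) := fun w hw =>
    (hg w hw).differentiableAt.differentiableWithinAt
  -- Borel–Carathéodory: `Re g ≤ L` puts `g / (2L - g)` in the closed unit disc. Evenness of `h`
  -- gives `g'(0) = 0`, so the Schwarz lemma applies with a double zero and yields a square.
  have hψ : ∀ z ∈ ball (0 : ℂ) R, ‖g z / (2 * L - g z)‖ ≤ (‖z‖ / R) ^ 2 := by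
    intro z hz
    have := Complex.dist_le_mul_div_pow_of_mapsTo_ball_of_isLittleO (n := 1) (R₂ := 1)
      (f := fun z => g z / (2 * L - g z)) (c := (0 : ℂ)) (R₁ := R) (z := z)
      (hgd.div (hgd.const_sub _) hden) (fun w hw => ?_) ?_ hz
    · simpa [hg0] using this
    · simp only [hg0, zero_div, mem_closedBall, dist_zero_right, norm_div]
      refine div_le_one_of_le₀ ?_ (norm_nonneg _)
      have h1 := hre w hw
      rw [← sq_le_sq₀ (by positivity) (by positivity)]
      simp only [Complex.sq_norm, Complex.normSq_apply]
      simp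
      nlinarith
    · have hb : (0 : ℂ) ∈ ball (0 : ℂ) R := mem_ball_self hR
      have h1 : HasDerivAt (fun z => g z / (2 * L - g z)) 0 0 := by
        have := (hg 0 hb).div ((hg 0 hb).const_sub (2 * (L : ℂ))) (hden 0 hb)
        refine this.congr_deriv ?_
        simp [hh']
      have h2 := h1.isLittleO
      simpa [hg0] using h2.norm_right
  refine ⟨g, fun z hz => ?_⟩
  have hzR : z ∈ ball (0 : ℂ) R := ball_subset_ball (by linarith) hz
  refine ⟨hexp z hzR, ?_⟩
  have h1 := hψ z hzR
  have hz' : ‖z‖ < R / 2 := mem_ball_zero_iff.mp hz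
  have hq : ‖z‖ / R ≤ 1 / 2 := by
    rw [div_le_iff₀ hR]
    linarith
  have hq0 : 0 ≤ ‖z‖ / R := by positivity
  rw [norm_div, div_le_iff₀ (norm_pos_iff.mpr (hden z hzR))] at h1
  have h2 : ‖2 * (L : ℂ) - g z‖ ≤ 2 * L + ‖g z‖ := by
    refine (norm_sub_le _ _).trans ?_
    simp [abs_of_pos hL]
  have h3 : (‖z‖ / R) ^ 2 ≤ 1 / 4 := by nlinarith
  have h4 : 0 ≤ (‖z‖ / R) ^ 2 := by positivity
  nlinarith [norm_nonneg (g z)]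

theorem tendstoLocallyUniformly_of_closedBall {F : ℕ → ℂ → ℂ} {f : ℂ → ℂ}
    (h : ∀ r > 0, ∀ δ > 0, ∀ᶠ n in atTop, ∀ z, ‖z‖ ≤ r → ‖f z - F n z‖ < δ) :
    TendstoLocallyUniformly F f atTop := by
  rw [Metric.tendstoLocallyUniformly_iff]
  intro δ hδ x
  refine ⟨ball 0 (‖x‖ + 1), isOpen_ball.mem_nhds (by simp), ?_⟩
  filter_upwards [h (‖x‖ + 1) (by positivity) δ hδ] with n hn y hy
  rw [dist_eq_norm]
  exact hn y (mem_ball_zero_iff.mp hy).le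

/-- An even entire function, real on the real axis and of growth less than order two normal type, is
a locally uniform limit of real polynomials whose roots are among its zeros. -/
theorem stripLimit_of_growth {f : ℂ → ℂ} (hf : Differentiable ℂ f) (hf0 : f 0 ≠ 0)
    (heven : ∀ z, f (-z) = f z) (hconj : ∀ z, f (conj z) = conj (f z)) {D : ℝ}
    (hzero : ∀ z, f z = 0 → z.im ^ 2 ≤ D)
    (hgrowth : ∀ ε > 0, ∃ C, ∀ z, ‖f z‖ ≤ C * Real.exp (ε * ‖z‖ ^ 2)) : StripLimit D f := by
  have hpos : ∀ n : ℕ, (0 : ℝ) < n + 1 := fun n => by positivity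
  choose P h hh hfac hP1 hroot hne using fun n : ℕ => exists_polynomial_factor hf hf0 (hpos n)
  have hh0 : ∀ n, h n 0 = f 0 := fun n => by rw [hfac n 0, hP1, one_mul]
  have hfpos : 0 < ‖f 0‖ := norm_pos_iff.mpr hf0
  have hPconj : ∀ n w, (P n).eval (conj w) = conj ((P n).eval w) := by
    intro n w
    have hev : ∀ z, ((P n).map (starRingEnd ℂ)).eval z = conj ((P n).eval (conj z)) := by
      intro z
      have := eval_map_apply (p := P n) (starRingEnd ℂ) (conj z)
      rwa [Complex.conj_conj] at this
    have := polynomial_factor_unique (f := f) (P₁ := P n) (P₂ := (P n).map (starRingEnd ℂ))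
      (h₁ := h n) (h₂ := fun z => conj (h n (conj z))) (R := n + 1) (hh n).continuous
      (Complex.continuous_conj.comp ((hh n).continuous.comp Complex.continuous_conj)) (hfac n)
      (fun z => by rw [hev, ← map_mul, ← hfac, hconj, Complex.conj_conj]) (hP1 n)
      (by rw [hev]; simp [hP1]) (hroot n) (fun w hw => ?_) (hne n) (fun z hz => ?_)
    · conv_lhs => rw [this]
      rw [hev, Complex.conj_conj]
    · rw [hev, map_eq_zero] at hw
      simpa using hroot n _ hw
    · rw [Ne, map_eq_zero]
      exact hne n _ (by simpa using hz)
  have hPeven : ∀ n w, (P n).eval (-w) = (P n).eval w := by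
    intro n w
    have := polynomial_factor_unique (f := f) (P₁ := P n) (P₂ := (P n).comp (-X))
      (h₁ := h n) (h₂ := fun z => h n (-z)) (R := n + 1) (hh n).continuous
      ((hh n).continuous.comp continuous_neg) (hfac n)
      (fun z => by simp [← hfac, heven]) (hP1 n)
      (by simp [hP1]) (hroot n) (fun w hw => ?_) (hne n) (fun z hz => ?_)
    · conv_rhs => rw [this]
      simp
    · rw [eval_comp, eval_neg, eval_X] at hw
      simpa using hroot n _ hw
    · exact hne n _ (by simpa using hz)
  have hheven : ∀ n z, h n (-z) = h n z := by
    intro n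
    have hden : Dense {z : ℂ | (P n).eval z ≠ 0} := by
      have hP0 : P n ≠ 0 := by
        intro h0
        have := hP1 n
        simp [h0] at this
      have : {z : ℂ | (P n).eval z ≠ 0} = (((P n).roots.toFinset : Set ℂ))ᶜ := by
        ext z
        simp [hP0]
      rw [this]
      exact ((P n).roots.toFinset.finite_toSet.countable).dense_compl ℂ
    refine fun z => congrFun (Continuous.ext_on hden (f := fun z => h n (-z)) (g := fun z => h n z)
      ((hh n).continuous.comp continuous_neg) (hh n).continuous fun w hw => ?_) z
    refine mul_left_cancel₀ hw ?_
    rw [← hfac]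
    conv_lhs => rw [← hPeven]
    rw [← hfac, heven]
  refine ⟨fun n => C (f 0) * P n, fun n w => ?_, fun n w hw => ?_, ?_⟩
  · rw [eval_mul, eval_mul, eval_C, eval_C, map_mul, hPconj, ← hconj, map_zero]
  · rw [eval_mul, eval_C, mul_eq_zero] at hw
    exact hzero w (by rw [hfac n, hw.resolve_left hf0, zero_mul])
  refine tendstoLocallyUniformly_of_closedBall fun r hr δ hδ => ?_
  obtain ⟨M, hM⟩ := (isCompact_closedBall (0 : ℂ) r).exists_bound_of_continuousOn
    hf.continuous.continuousOn
  have hM0 : 0 ≤ M := (norm_nonneg _).trans (hM 0 (mem_closedBall_self hr.le))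
  set η := min 1 (δ / (2 * M + 1)) with hη
  have hη0 : 0 < η := by positivity
  -- Chosen so that the growth part of the bound `4L(r/R)²` below, namely `16 ε r²`, is exactly `η /
  -- 2`, independently of `R`.
  set ε := η / (32 * r ^ 2) with hε
  have hε0 : 0 < ε := by positivity
  obtain ⟨C', hC⟩ := hgrowth ε hε0
  set K := Real.log (C' / ‖f 0‖) with hK
  have hC0 : ‖f 0‖ ≤ C' := by simpa using hC 0
  have hK0 : 0 ≤ K := Real.log_nonneg (by rwa [one_le_div hfpos])
  have hlim : Tendsto (fun n : ℕ => 4 * K * (r / ((n : ℝ) + 1)) ^ 2) atTop (𝓝 0) := by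
    have h1 : Tendsto (fun n : ℕ => r / ((n : ℝ) + 1)) atTop (𝓝 0) := by
      have := (tendsto_one_div_add_atTop_nhds_zero_nat (𝕜 := ℝ)).const_mul r
      simpa [div_eq_mul_inv] using this
    simpa using (h1.pow 2).const_mul (4 * K)
  filter_upwards [hlim.eventually (gt_mem_nhds (show 0 < η / 2 by positivity)),
    eventually_gt_atTop ⌈2 * r⌉₊] with n hn1 hn2 z hz
  have hn : 2 * r < n := Nat.lt_of_ceil_lt hn2
  set R : ℝ := (n : ℝ) + 1 with hR
  have hR0 : 0 < R := hpos n
  -- The growth bound on the circle of radius `2R`, relative to `‖f 0‖`, is `exp L`.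
  set L := K + 4 * ε * R ^ 2 with hL
  have hL0 : 0 < L := by positivity
  obtain ⟨g, hg⟩ := exists_log_of_even (hh n) (hheven n) hR0 hL0
    (fun w hw => hne n w (mem_ball_zero_iff.mp hw).le) (fun w hw => by
      refine Complex.norm_le_of_forall_mem_frontier_norm_le (U := ball 0 (2 * R)) isBounded_ball
        (hh n).diffContOnCl (fun z hz => ?_)
        (subset_closure (ball_subset_ball (by linarith) hw))
      rw [frontier_ball _ (by positivity), mem_sphere_zero_iff_norm] at hz
      have h1 : (1 : ℝ) ≤ ‖(P n).eval z‖ := by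
        have := pow_natDegree_le_norm_eval zero_le_one (hP1 n) (hroot n) (z := z)
          (by rw [hz]; linarith)
        simpa using this
      calc ‖h n z‖ ≤ ‖(P n).eval z‖ * ‖h n z‖ := le_mul_of_one_le_left (norm_nonneg _) h1
        _ = ‖f z‖ := by rw [hfac n z, norm_mul]
        _ ≤ C' * Real.exp (ε * ‖z‖ ^ 2) := hC z
        _ = ‖h n 0‖ * Real.exp L := by
          rw [hh0, hL, Real.exp_add, hK, Real.exp_log (div_pos (hfpos.trans_le hC0) hfpos), hz]
          field_simp
          ring_nf)
  obtain ⟨hg1, hg2⟩ := hg z (mem_ball_zero_iff.mpr (by rw [lt_div_iff₀ two_pos]; linarith))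
  have hgη : ‖g z‖ < η := by
    calc ‖g z‖ ≤ 4 * L * (‖z‖ / R) ^ 2 := hg2
      _ ≤ 4 * L * (r / R) ^ 2 := by gcongr
      _ = 4 * K * (r / R) ^ 2 + 16 * ε * r ^ 2 := by
        rw [hL]
        field_simp
        ring
      _ = 4 * K * (r / R) ^ 2 + η / 2 := by
        rw [hε]
        field_simp
        ring
      _ < η := by linarith
  have heq : (C (f 0) * P n).eval z = f z * Complex.exp (-g z) := by
    rw [eval_mul, eval_C, hfac n z, hg1, hh0, Complex.exp_neg]
    field_simp
  have hexp : ‖Complex.exp (-g z) - 1‖ ≤ 2 * ‖g z‖ := by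
    have := Complex.norm_exp_sub_one_le (x := -g z)
      (by rw [norm_neg]; exact hgη.le.trans (min_le_left _ _))
    rwa [norm_neg] at this
  calc ‖f z - (C (f 0) * P n).eval z‖ = ‖f z‖ * ‖Complex.exp (-g z) - 1‖ := by
        rw [heq, ← norm_mul, ← norm_neg]
        congr 1
        ring
    _ ≤ M * (2 * ‖g z‖) := by
        gcongr
        exact hM z (mem_closedBall_zero_iff.mpr hz)
    _ ≤ (2 * M) * η := by nlinarith
    _ < (2 * M + 1) * η := by linarith
    _ ≤ (2 * M + 1) * (δ / (2 * M + 1)) := by gcongr; exact min_le_right _ _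
    _ = δ := by field_simp

end

/-! ### Fourier transforms of Gaussian-weighted kernels; de Bruijn's theorem. -/

/-- A positive continuous even function which remains integrable after multiplication by any
Gaussian `exp (lam u²)`. -/
structure GaussKernel (Φ : ℝ → ℝ) : Prop where
  cont : Continuous Φ
  pos : ∀ u, 0 < Φ u
  even : ∀ u, Φ (-u) = Φ u
  int : ∀ lam : ℝ, Integrable fun u => Φ u * Real.exp (lam * u ^ 2)

/-- The Fourier transform of `w` at a complex frequency. -/
def fourierC (w : ℝ → ℝ) (z : ℂ) : ℂ :=
  ∫ u : ℝ, (w u : ℂ) * Complex.exp (Complex.I * z * u)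

theorem norm_exp_I_mul_le (z : ℂ) (u : ℝ) :
    ‖Complex.exp (Complex.I * z * u)‖ ≤ Real.exp (‖z‖ * |u|) := by
  rw [Complex.norm_exp]
  refine Real.exp_le_exp.mpr ((Complex.re_le_norm _).trans ?_)
  simp

theorem norm_mul_abs_le (x u : ℝ) {ε : ℝ} (hε : 0 < ε) :
    x * |u| ≤ ε * x ^ 2 + (4 * ε)⁻¹ * u ^ 2 := by
  have h1 : 0 ≤ ε * (x - (2 * ε)⁻¹ * |u|) ^ 2 := by positivity
  have h2 : ε * (x - (2 * ε)⁻¹ * |u|) ^ 2 = ε * x ^ 2 - x * |u| + (4 * ε)⁻¹ * u ^ 2 := by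
    rw [← sq_abs u]
    field_simp
    ring
  linarith

namespace GaussKernel

variable {Φ : ℝ → ℝ}

theorem integrable_mul_exp_abs (h : GaussKernel Φ) (lam x : ℝ) :
    Integrable fun u => Φ u * Real.exp (lam * u ^ 2) * Real.exp (x * |u|) := by
  refine ((h.int (lam + 1)).mul_const (Real.exp (x ^ 2 / 4))).mono' ?_ ?_
  · have := h.cont
    exact (by fun_prop : Continuous _).aestronglyMeasurable
  · refine Eventually.of_forall fun u => ?_
    have := h.pos u
    rw [Real.norm_of_nonneg (by positivity), mul_assoc, mul_assoc, ← Real.exp_add, ← Real.exp_add]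
    have h1 := norm_mul_abs_le x u (ε := 1 / 4) (by norm_num)
    refine mul_le_mul_of_nonneg_left (Real.exp_le_exp.mpr ?_) this.le
    norm_num at h1
    linarith

theorem integrable_of_le (h : GaussKernel Φ) {w : ℝ → ℝ} (hw : Continuous w) {lam : ℝ}
    (hle : ∀ u, |w u| ≤ Φ u * Real.exp (lam * u ^ 2)) (z : ℂ) :
    Integrable fun u : ℝ => (w u : ℂ) * Complex.exp (Complex.I * z * u) := by
  refine (h.integrable_mul_exp_abs lam ‖z‖).mono' ?_ ?_
  · exact (by fun_prop : Continuous _).aestronglyMeasurable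
  · refine Eventually.of_forall fun u => ?_
    rw [norm_mul, Complex.norm_real, Real.norm_eq_abs]
    exact mul_le_mul (hle u) (norm_exp_I_mul_le z u) (norm_nonneg _)
      ((abs_nonneg _).trans (hle u))

theorem differentiable_fourierC (h : GaussKernel Φ) {w : ℝ → ℝ} (hw : Continuous w) {lam : ℝ}
    (hle : ∀ u, |w u| ≤ Φ u * Real.exp (lam * u ^ 2)) : Differentiable ℂ (fourierC w) := by
  intro z₀
  refine (hasDerivAt_integral_of_dominated_loc_of_deriv_le (μ := volume) (𝕜 := ℂ)
    (F := fun z (u : ℝ) => (w u : ℂ) * Complex.exp (Complex.I * z * u))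
    (F' := fun z (u : ℝ) => (w u : ℂ) * (Complex.exp (Complex.I * z * u) * (Complex.I * u)))
    (bound := fun u => Φ u * Real.exp (lam * u ^ 2) * Real.exp ((‖z₀‖ + 2) * |u|))
    (ball_mem_nhds z₀ one_pos) ?_ (h.integrable_of_le hw hle z₀) ?_ ?_
    (h.integrable_mul_exp_abs _ _) ?_).2.differentiableAt
  · exact Eventually.of_forall fun z => (by fun_prop : Continuous _).aestronglyMeasurable
  · exact (by fun_prop : Continuous _).aestronglyMeasurable
  · refine Eventually.of_forall fun u z hz => ?_
    have hz' : ‖z‖ ≤ ‖z₀‖ + 1 := by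
      have h1 := norm_sub_norm_le z z₀
      rw [mem_ball, dist_eq_norm] at hz
      linarith
    rw [norm_mul, norm_mul, norm_mul, Complex.norm_real, Complex.norm_real, Complex.norm_I, one_mul,
      Real.norm_eq_abs, Real.norm_eq_abs]
    have h1 : |u| ≤ Real.exp |u| := (lt_add_one _).le.trans (Real.add_one_le_exp _)
    have h2 : Real.exp ((‖z₀‖ + 2) * |u|) = Real.exp ((‖z₀‖ + 1) * |u|) * Real.exp |u| := by
      rw [← Real.exp_add]
      ring_nf
    rw [h2]
    refine mul_le_mul (hle u) ?_ (by positivity) ((abs_nonneg _).trans (hle u))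
    refine mul_le_mul ((norm_exp_I_mul_le z u).trans ?_) h1 (by positivity) (by positivity)
    gcongr
  · refine Eventually.of_forall fun u z _ => ?_
    have h1 : HasDerivAt (fun z : ℂ => Complex.I * z * u) (Complex.I * u) z := by
      simpa using ((hasDerivAt_id z).const_mul Complex.I).mul_const (u : ℂ)
    exact h1.cexp.const_mul _

theorem cosh_pow_le (a u : ℝ) (n : ℕ) :
    |Real.cosh (a * u) ^ n| ≤ Real.exp (n * a ^ 2 / 2 * u ^ 2) := by
  rw [abs_of_nonneg (by positivity)]
  calc Real.cosh (a * u) ^ n ≤ Real.exp ((a * u) ^ 2 / 2) ^ n := by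
        gcongr
        exact Real.cosh_le_exp_half_sq _
    _ = _ := by
        rw [← Real.exp_nat_mul]
        ring_nf

/-- Replacing `z` by `z ± ai` multiplies the integrand by `e^(∓au)`, and the average of the two is
`cosh (a u)`. -/
theorem iterate_shiftAvg (h : GaussKernel Φ) (a : ℝ) (n : ℕ) :
    (shiftAvg a)^[n] (fourierC Φ) = fourierC fun u => Φ u * Real.cosh (a * u) ^ n := by
  induction n with
  | zero => simp
  | succ n ih =>
    have hc := h.cont
    have hint := h.integrable_of_le (w := fun u => Φ u * Real.cosh (a * u) ^ n)
      (by fun_prop) (lam := n * a ^ 2 / 2) (fun u => by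
        rw [abs_mul, abs_of_pos (h.pos u)]
        exact mul_le_mul_of_nonneg_left (cosh_pow_le a u n) (h.pos u).le)
    rw [Function.iterate_succ_apply', ih]
    ext z
    rw [shiftAvg, fourierC, fourierC, fourierC, ← integral_add (hint _) (hint _), ← integral_div]
    refine integral_congr_ae (Eventually.of_forall fun u => ?_)
    have e1 : Complex.exp (Complex.I * (z + a * Complex.I) * u) =
        Complex.exp (Complex.I * z * u) * Complex.exp (-(a * u)) := by
      rw [← Complex.exp_add]
      congr 1
      linear_combination (a * u : ℂ) * Complex.I_mul_I
    have e2 : Complex.exp (Complex.I * (z - a * Complex.I) * u) =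
        Complex.exp (Complex.I * z * u) * Complex.exp (a * u) := by
      rw [← Complex.exp_add]
      congr 1
      linear_combination -(a * u : ℂ) * Complex.I_mul_I
    simp only [e1, e2]
    push_cast
    rw [pow_succ, Complex.cosh]
    ring

/-- Split `|z||u| ≤ ε|z|² + u²/(4ε)`; the kernel absorbs the Gaussian in `u`. This supplies the
growth hypothesis of `stripLimit_of_growth`. -/
theorem norm_fourierC_le (h : GaussKernel Φ) {ε : ℝ} (hε : 0 < ε) :
    ∃ C, ∀ z, ‖fourierC Φ z‖ ≤ C * Real.exp (ε * ‖z‖ ^ 2) := by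
  refine ⟨∫ u, Φ u * Real.exp ((4 * ε)⁻¹ * u ^ 2), fun z => ?_⟩
  rw [← integral_mul_const]
  refine norm_integral_le_of_norm_le ((h.int _).mul_const _) (Eventually.of_forall fun u => ?_)
  rw [norm_mul, Complex.norm_real, Real.norm_of_nonneg (h.pos u).le, mul_assoc (Φ u), ← Real.exp_add]
  refine mul_le_mul_of_nonneg_left ?_ (h.pos u).le
  refine (norm_exp_I_mul_le z u).trans (Real.exp_le_exp.mpr ?_)
  linarith [norm_mul_abs_le ‖z‖ u hε]

theorem fourierC_neg (h : GaussKernel Φ) (z : ℂ) : fourierC Φ (-z) = fourierC Φ z := by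
  rw [fourierC, fourierC, ← integral_neg_eq_self]
  refine integral_congr_ae (Eventually.of_forall fun u => ?_)
  simp [h.even]

theorem _root_.SizeBiased.fourierC_conj_neg (w : ℝ → ℝ) (z : ℂ) :
    fourierC w (-conj z) = conj (fourierC w z) := by
  rw [fourierC, fourierC, ← integral_conj]
  refine integral_congr_ae (Eventually.of_forall fun u => ?_)
  simp [← Complex.exp_conj]

theorem fourierC_conj (h : GaussKernel Φ) (z : ℂ) : fourierC Φ (conj z) = conj (fourierC Φ z) := by
  rw [← fourierC_conj_neg, h.fourierC_neg]

theorem _root_.SizeBiased.fourierC_zero_ne {w : ℝ → ℝ} (hw : ∀ u, 0 < w u) (hint : Integrable w) :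
    fourierC w 0 ≠ 0 := by
  have h1 : fourierC w 0 = ((∫ u, w u : ℝ) : ℂ) := by
    rw [fourierC, ← integral_complex_ofReal]
    simp
  rw [h1, Complex.ofReal_ne_zero]
  refine ne_of_gt ((integral_pos_iff_support_of_nonneg (fun u => (hw u).le) hint).mpr ?_)
  have : Function.support w = Set.univ := Set.eq_univ_of_forall fun u => (hw u).ne'
  rw [this]
  simp

/-- From `cosh y - 1 = 2 sinh²(y/2)` and `sinh y / y → 1` one gets `m (cosh y_m - 1) → λu²`, and
then `(1 + x_m)^m → exp(lim m x_m)`. -/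
theorem tendsto_cosh_pow {lam : ℝ} (hlam : 0 ≤ lam) (u : ℝ) :
    Tendsto (fun n : ℕ => Real.cosh (√(2 * lam / (n + 1)) * u) ^ (n + 1)) atTop
      (𝓝 (Real.exp (lam * u ^ 2))) := by
  set y : ℕ → ℝ := fun m => √(2 * lam / m) * u with hy
  have hy0 : Tendsto (fun m => y m / 2) atTop (𝓝 0) := by
    have h1 : Tendsto (fun m : ℕ => 2 * lam / (m : ℝ)) atTop (𝓝 0) :=
      tendsto_const_div_atTop_nhds_zero_nat _
    simpa using (((Real.continuous_sqrt.tendsto 0).comp (by simpa using h1)).mul_const u).div_const 2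
  have hs : ContinuousAt (dslope Real.sinh 0) 0 :=
    continuousAt_dslope_same.mpr Real.differentiable_sinh.differentiableAt
  have hs1 : Tendsto (fun m => dslope Real.sinh 0 (y m / 2)) atTop (𝓝 1) := by
    have h1 := hs.tendsto.comp hy0
    rwa [dslope_same, Real.deriv_sinh, Real.cosh_zero] at h1
  have hlim : Tendsto (fun m : ℕ => (m : ℝ) * (Real.cosh (y m) - 1)) atTop
      (𝓝 (lam * u ^ 2)) := by
    have h1 := (hs1.pow 2).const_mul (lam * u ^ 2)
    rw [one_pow, mul_one] at h1
    refine h1.congr' ?_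
    filter_upwards [eventually_gt_atTop 0] with m hm
    have hm' : (0 : ℝ) < m := by exact_mod_cast hm
    have h2 : Real.sinh (y m / 2) = y m / 2 * dslope Real.sinh 0 (y m / 2) := by
      have := sub_smul_dslope Real.sinh 0 (y m / 2)
      simpa using this.symm
    have h3 : Real.cosh (y m) - 1 = 2 * Real.sinh (y m / 2) ^ 2 := by
      have := Real.cosh_two_mul (y m / 2)
      rw [mul_div_cancel₀ _ two_ne_zero, Real.cosh_sq] at this
      linarith
    have h4 : y m ^ 2 = 2 * lam / m * u ^ 2 := by
      rw [hy, mul_pow, Real.sq_sqrt (by positivity)]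
    rw [h3, h2, mul_pow, div_pow, h4]
    field_simp
  have h1 := Real.tendsto_one_add_pow_exp_of_tendsto hlim
  simp_rw [add_sub_cancel] at h1
  have h2 := (tendsto_add_atTop_iff_nat 1).mpr h1
  simpa only [hy, Nat.cast_add, Nat.cast_one] using h2

/-- Dominated convergence: `cosh y ≤ exp(y²/2)` makes `exp(λu²)` a majorant for every `n`, and on a
disc of radius `r` the oscillating factor is at most `e^(r|u|)`. -/
theorem tendsto_fourierC (h : GaussKernel Φ) {lam : ℝ} (hlam : 0 ≤ lam) :
    TendstoLocallyUniformly
      (fun n : ℕ => fourierC fun u => Φ u * Real.cosh (√(2 * lam / (n + 1)) * u) ^ (n + 1))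
      (fourierC fun u => Φ u * Real.exp (lam * u ^ 2)) atTop := by
  have hc := h.cont
  have hle : ∀ (n : ℕ) u, |Φ u * Real.cosh (√(2 * lam / (n + 1)) * u) ^ (n + 1)| ≤
      Φ u * Real.exp (lam * u ^ 2) := fun n u => by
    rw [abs_mul, abs_of_pos (h.pos u)]
    refine mul_le_mul_of_nonneg_left ((cosh_pow_le _ u (n + 1)).trans ?_) (h.pos u).le
    rw [Real.sq_sqrt (by positivity)]
    refine Real.exp_le_exp.mpr (le_of_eq ?_)
    push_cast
    field_simp
  have hle' : ∀ u, |Φ u * Real.exp (lam * u ^ 2)| ≤ Φ u * Real.exp (lam * u ^ 2) := fun u =>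
    (abs_of_pos (mul_pos (h.pos u) (Real.exp_pos _))).le
  rw [Metric.tendstoLocallyUniformly_iff]
  intro δ hδ x
  set r := ‖x‖ + 1
  have hlim : Tendsto (fun n : ℕ => ∫ u, |Φ u * Real.exp (lam * u ^ 2) -
      Φ u * Real.cosh (√(2 * lam / (n + 1)) * u) ^ (n + 1)| * Real.exp (r * |u|)) atTop
      (𝓝 (∫ u : ℝ, (0 : ℝ))) := by
    refine tendsto_integral_of_dominated_convergence
      (fun u => 2 * (Φ u * Real.exp (lam * u ^ 2) * Real.exp (r * |u|)))
      (fun n => (by fun_prop : Continuous _).aestronglyMeasurable)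
      ((h.integrable_mul_exp_abs lam r).const_mul 2) (fun n => Eventually.of_forall fun u => ?_)
      (Eventually.of_forall fun u => ?_)
    · rw [Real.norm_of_nonneg (by positivity), ← mul_assoc]
      gcongr
      refine (abs_sub _ _).trans ?_
      linarith [hle n u, hle' u]
    · have h1 := ((tendsto_cosh_pow hlam u).const_mul (Φ u)).const_sub
        (Φ u * Real.exp (lam * u ^ 2))
      simpa using h1.abs.mul_const (Real.exp (r * |u|))
  rw [integral_zero] at hlim
  refine ⟨ball 0 r, isOpen_ball.mem_nhds (by simp [r]), ?_⟩
  filter_upwards [hlim.eventually (gt_mem_nhds hδ)] with n hn z hz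
  refine lt_of_le_of_lt ?_ hn
  have i1 := h.integrable_of_le (w := fun u => Φ u * Real.exp (lam * u ^ 2)) (by fun_prop) hle' z
  have i2 := h.integrable_of_le
    (w := fun u => Φ u * Real.cosh (√(2 * lam / (n + 1)) * u) ^ (n + 1)) (by fun_prop) (hle n) z
  rw [dist_eq_norm, fourierC, fourierC, ← integral_sub i1 i2]
  refine norm_integral_le_of_norm_le ?_ (Eventually.of_forall fun u => ?_)
  · refine ((h.integrable_mul_exp_abs lam r).const_mul 2).mono'
      (by fun_prop : Continuous _).aestronglyMeasurable (Eventually.of_forall fun u => ?_)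
    rw [Real.norm_of_nonneg (by positivity), ← mul_assoc]
    gcongr
    refine (abs_sub _ _).trans ?_
    linarith [hle n u, hle' u]
  · rw [← sub_mul, norm_mul, ← Complex.ofReal_sub, Complex.norm_real, Real.norm_eq_abs]
    gcongr
    refine (norm_exp_I_mul_le z u).trans ?_
    gcongr
    exact (mem_ball_zero_iff.mp hz).le

/-- **De Bruijn's theorem**: if the zeros of the Fourier transform of `Φ` lie in the strip
`(im z)² ≤ D`, then that of `Φ u * exp (lam u²)` has only real zeros as soon as `D ≤ 2 lam`. -/
theorem im_eq_zero (h : GaussKernel Φ) {D : ℝ} (hD : 0 ≤ D)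
    (hzero : ∀ z, fourierC Φ z = 0 → z.im ^ 2 ≤ D) {lam : ℝ} (hlam : 0 < lam) (hDlam : D ≤ 2 * lam)
    {z : ℂ} (hz : fourierC (fun u => Φ u * Real.exp (lam * u ^ 2)) z = 0) : z.im = 0 := by
  have hc := h.cont
  have hint0 : Integrable Φ := by simpa using h.int 0
  have hcosh : ∀ (n : ℕ) (a : ℝ) u, |Φ u * Real.cosh (a * u) ^ n| ≤
      Φ u * Real.exp (n * a ^ 2 / 2 * u ^ 2) := fun n a u => by
    rw [abs_mul, abs_of_pos (h.pos u)]
    exact mul_le_mul_of_nonneg_left (cosh_pow_le a u n) (h.pos u).le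
  have hstrip : StripLimit D (fourierC Φ) :=
    stripLimit_of_growth (h.differentiable_fourierC hc (lam := 0) fun u => by
      simp [abs_of_pos (h.pos u)]) (fourierC_zero_ne h.pos hint0) h.fourierC_neg h.fourierC_conj
      hzero fun ε hε => h.norm_fourierC_le hε
  by_contra hne
  refine ne_zero_of_tendstoLocallyUniformly (fun n => ?_) (h.tendsto_fourierC hlam.le)
    ⟨0, fourierC_zero_ne (fun u => mul_pos (h.pos u) (Real.exp_pos _)) (h.int lam)⟩
    (U := {z | z.im ≠ 0}) ?_ (fun n w hw h0 => hw ?_) z hne hz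
  · exact h.differentiable_fourierC (by fun_prop) (hcosh (n + 1) _)
  · exact isOpen_ne_fun Complex.continuous_im continuous_const
  -- With this step size the `n + 1` averagings lower `D` by exactly `2 * lam`, so already the
  -- approximants have only real zeros.
  · set a := √(2 * lam / (n + 1)) with ha
    have ha0 : 0 < a := Real.sqrt_pos.mpr (by positivity)
    have ha2 : ((n + 1 : ℕ) : ℝ) * a ^ 2 = 2 * lam := by
      rw [ha, Real.sq_sqrt (by positivity)]
      push_cast
      field_simp
    have h1 := hstrip.iterate ha0 hD (n + 1)
    rw [ha2, max_eq_right (by linarith), h.iterate_shiftAvg] at h1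
    have h2 := h1.im_sq_le ⟨0, fourierC_zero_ne
      (fun u => mul_pos (h.pos u) (pow_pos (Real.cosh_pos _) _)) ?_⟩ h0
    · nlinarith
    · exact (h.int _).mono' (by fun_prop : Continuous _).aestronglyMeasurable
        (Eventually.of_forall (hcosh (n + 1) a))

end GaussKernel

/-! ### Riemann's theta kernel: symmetry, decay and positivity. -/

/-- The horizontal strip on which the theta series in the variable `exp (2 w)` converges. -/
def thetaStrip : Set ℂ := {w | |w.im| < Real.pi / 4}

theorem isOpen_thetaStrip : IsOpen thetaStrip :=
  isOpen_lt (by fun_prop) continuous_const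

theorem neg_mem_thetaStrip {w : ℂ} (hw : w ∈ thetaStrip) : -w ∈ thetaStrip := by
  simpa [thetaStrip] using hw

theorem ofReal_mem_thetaStrip (u : ℝ) : (u : ℂ) ∈ thetaStrip := by
  simp [thetaStrip, Real.pi_pos]

theorem im_I_mul_exp (w : ℂ) :
    (Complex.I * Complex.exp (2 * w)).im = Real.exp (2 * w.re) * Real.cos (2 * w.im) := by
  simp [Complex.exp_re]

theorem im_I_mul_exp_pos {w : ℂ} (hw : w ∈ thetaStrip) :
    0 < (Complex.I * Complex.exp (2 * w)).im := by
  rw [im_I_mul_exp]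
  have := abs_lt.mp (show |w.im| < Real.pi / 4 from hw)
  exact mul_pos (Real.exp_pos _) (Real.cos_pos_of_mem_Ioo ⟨by linarith, by linarith⟩)

/-- The theta series without its constant term, in logarithmic variables. -/
def thetaB (w : ℂ) : ℂ :=
  Complex.exp (w / 2) * (jacobiTheta (Complex.I * Complex.exp (2 * w)) - 1)

/-- The theta series with its growth at both ends removed. -/
def thetaA (w : ℂ) : ℂ := thetaB w - Complex.exp (-w / 2)

/-- Riemann's kernel: the Fourier transform of `2 ξ(1/2 + i t)`. -/
def thetaPhi (w : ℂ) : ℂ := deriv (deriv thetaB) w - thetaB w / 4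

theorem differentiableOn_thetaB : DifferentiableOn ℂ thetaB thetaStrip := by
  intro w hw
  have h1 := differentiableAt_jacobiTheta (im_I_mul_exp_pos hw)
  have h2 : DifferentiableAt ℂ (fun w => jacobiTheta (Complex.I * Complex.exp (2 * w))) w :=
    h1.comp w (f := fun w => Complex.I * Complex.exp (2 * w)) (by fun_prop)
  exact ((by fun_prop : DifferentiableAt ℂ (fun w => Complex.exp (w / 2)) w).mul
    (h2.sub_const 1)).differentiableWithinAt

theorem differentiableOn_thetaA : DifferentiableOn ℂ thetaA thetaStrip :=
  differentiableOn_thetaB.sub (by fun_prop)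

/-- In the variable `τ = i e^(2w)` the modular map `τ ↦ -1/τ` is `w ↦ -w`; in the strip `|Im 2w| <
π/2`, so the principal square root of `e^(2w)` is `e^w`. -/
theorem jacobiTheta_I_mul_exp_neg {w : ℂ} (hw : w ∈ thetaStrip) :
    jacobiTheta (Complex.I * Complex.exp (2 * -w)) =
      Complex.exp w * jacobiTheta (Complex.I * Complex.exp (2 * w)) := by
  have h := jacobiTheta_S_smul ⟨Complex.I * Complex.exp (2 * w), im_I_mul_exp_pos hw⟩
  have hw' := abs_lt.mp (show |w.im| < Real.pi / 4 from hw)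
  have e1 : (-Complex.I * (Complex.I * Complex.exp (2 * w))) ^ (1 / 2 : ℂ) = Complex.exp w := by
    have : -Complex.I * (Complex.I * Complex.exp (2 * w)) = Complex.exp (2 * w) := by
      rw [← mul_assoc, neg_mul, Complex.I_mul_I]
      ring
    rw [this, Complex.cpow_def_of_ne_zero (Complex.exp_ne_zero _), Complex.log_exp]
    · congr 1
      ring
    · simp
      linarith
    · simp
      linarith
  have e2 : ((ModularGroup.S • (⟨Complex.I * Complex.exp (2 * w), im_I_mul_exp_pos hw⟩ :
      UpperHalfPlane) : UpperHalfPlane) : ℂ) = Complex.I * Complex.exp (2 * -w) := by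
    rw [UpperHalfPlane.modular_S_smul]
    simp [Complex.exp_neg, mul_comm]
  rw [e2] at h
  rw [h]
  congr 1

theorem thetaA_neg {w : ℂ} (hw : w ∈ thetaStrip) : thetaA (-w) = thetaA w := by
  have e : Complex.exp (w / 2) = Complex.exp (-w / 2) * Complex.exp w := by
    rw [← Complex.exp_add]
    ring_nf
  have e2 : Complex.exp (w / 2) * Complex.exp (-w / 2) = 1 := by
    rw [← Complex.exp_add]
    ring_nf
    simp
  rw [thetaA, thetaA, thetaB, thetaB, jacobiTheta_I_mul_exp_neg hw, neg_neg, e]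
  ring

/-- The operator `d²/dw² - 1/4` kills `e^(-w/2)`. Hence `thetaPhi` inherits its decay on the right
from `thetaB` and its evenness from `thetaA`. -/
theorem thetaPhi_eq {w : ℂ} (hw : w ∈ thetaStrip) :
    thetaPhi w = deriv (deriv thetaA) w - thetaA w / 4 := by
  have hE : ∀ z : ℂ, HasDerivAt (fun z : ℂ => Complex.exp (-z / 2))
      (-(1 / 2) * Complex.exp (-z / 2)) z := by
    intro z
    have := (((hasDerivAt_id z).neg).div_const 2).cexp
    refine this.congr_deriv ?_
    simp
    ring
  have h1 : ∀ z ∈ thetaStrip, deriv thetaA z = deriv thetaB z + 1 / 2 * Complex.exp (-z / 2) := by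
    intro z hz
    have hB := (differentiableOn_thetaB.differentiableAt (isOpen_thetaStrip.mem_nhds hz)).hasDerivAt
    rw [show thetaA = fun z => thetaB z - Complex.exp (-z / 2) from rfl, (hB.fun_sub (hE z)).deriv]
    ring
  have h2 : deriv (deriv thetaA) w = deriv (deriv thetaB) w - 1 / 4 * Complex.exp (-w / 2) := by
    have hB := ((differentiableOn_thetaB.deriv isOpen_thetaStrip).differentiableAt
      (isOpen_thetaStrip.mem_nhds hw)).hasDerivAt
    have he : deriv thetaA =ᶠ[𝓝 w] fun z => deriv thetaB z + 1 / 2 * Complex.exp (-z / 2) :=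
      eventually_of_mem (isOpen_thetaStrip.mem_nhds hw) h1
    rw [he.deriv_eq, (hB.fun_add ((hE w).const_mul (1 / 2))).deriv]
    ring
  rw [h2, thetaPhi, thetaA]
  ring

theorem thetaPhi_neg {w : ℂ} (hw : w ∈ thetaStrip) : thetaPhi (-w) = thetaPhi w := by
  have h1 : ∀ z ∈ thetaStrip, deriv thetaA (-z) = -deriv thetaA z := by
    intro z hz
    have he : (fun z => thetaA (-z)) =ᶠ[𝓝 z] thetaA :=
      eventually_of_mem (isOpen_thetaStrip.mem_nhds hz) fun _ => thetaA_neg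
    rw [← he.deriv_eq, deriv_comp_neg, neg_neg]
  have h2 : deriv (deriv thetaA) (-w) = deriv (deriv thetaA) w := by
    have he : (fun z => deriv thetaA (-z)) =ᶠ[𝓝 w] fun z => -deriv thetaA z :=
      eventually_of_mem (isOpen_thetaStrip.mem_nhds hw) h1
    have := he.deriv_eq
    rwa [deriv_comp_neg, deriv.fun_neg, neg_inj] at this
  rw [thetaPhi_eq hw, thetaPhi_eq (neg_mem_thetaStrip hw), h2, thetaA_neg hw]

theorem differentiableOn_thetaPhi : DifferentiableOn ℂ thetaPhi thetaStrip :=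
  ((differentiableOn_thetaB.deriv isOpen_thetaStrip).deriv isOpen_thetaStrip).sub
    (differentiableOn_thetaB.div_const 4)

/-- Super-Gaussian decay to the right of `x₀` in every closed substrip. -/
def RightDecay (x₀ : ℝ) (f : ℂ → ℂ) : Prop :=
  ∀ α < Real.pi / 4, ∀ M > 0, ∃ C, ∀ w : ℂ, |w.im| ≤ α → x₀ ≤ w.re →
    ‖f w‖ ≤ C * Real.exp (-M * w.re ^ 2)

theorem exp_neg_mul_exp_le {κ M : ℝ} (hκ : 0 < κ) (hM : 0 < M) {x : ℝ} (hx : -1 ≤ x) :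
    Real.exp (-κ * Real.exp (2 * x)) ≤
      Real.exp (4 * M ^ 2 / κ + M) * Real.exp (-M * x ^ 2) := by
  rw [← Real.exp_add]
  refine Real.exp_le_exp.mpr ?_
  rcases le_total x 0 with h | h
  · have h1 : 0 ≤ κ * Real.exp (2 * x) := by positivity
    have h2 : 0 ≤ 4 * M ^ 2 / κ := by positivity
    have h3 : x ^ 2 ≤ 1 := by nlinarith
    have h4 := mul_le_mul_of_nonneg_left h3 hM.le
    linarith
  · have h1 : x ^ 4 / 16 ≤ Real.exp (2 * x) := by
      have h2 : x / 2 ≤ Real.exp (x / 2) := by linarith [Real.add_one_le_exp (x / 2)]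
      calc x ^ 4 / 16 = (x / 2) ^ 4 := by ring
        _ ≤ Real.exp (x / 2) ^ 4 := by gcongr
        _ = Real.exp (2 * x) := by
          rw [← Real.exp_nat_mul]
          ring_nf
    have h3 : 0 ≤ (κ * x ^ 2 - 8 * M) ^ 2 / (16 * κ) := by positivity
    have h4 : (κ * x ^ 2 - 8 * M) ^ 2 / (16 * κ) = κ * (x ^ 4 / 16) - M * x ^ 2 +
        4 * M ^ 2 / κ := by
      field_simp
      ring
    have h5 := mul_le_mul_of_nonneg_left h1 hκ.le
    linarith

theorem norm_thetaB_le {α : ℝ} (hα0 : 0 ≤ α) (hα : α < Real.pi / 4) : ∃ C κ : ℝ, 0 < C ∧ 0 < κ ∧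
    ∀ w : ℂ, |w.im| ≤ α → -1 ≤ w.re →
      ‖thetaB w‖ ≤ C * Real.exp (w.re / 2) * Real.exp (-κ * Real.exp (2 * w.re)) := by
  have hcos : 0 < Real.cos (2 * α) := Real.cos_pos_of_mem_Ioo ⟨by linarith, by linarith⟩
  have hpi := Real.pi_pos
  set κ := Real.pi * Real.cos (2 * α) with hκ
  have hκ0 : 0 < κ := by positivity
  have hden : 0 < 1 - Real.exp (-κ * Real.exp (-2)) := by
    have : Real.exp (-κ * Real.exp (-2)) < 1 := by
      rw [Real.exp_lt_one_iff]
      have : 0 < κ * Real.exp (-2) := by positivity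
      linarith
    linarith
  refine ⟨2 / (1 - Real.exp (-κ * Real.exp (-2))), κ, by positivity, hκ0, fun w hw hre => ?_⟩
  have hws : w ∈ thetaStrip := lt_of_le_of_lt hw hα
  have hcosw : Real.cos (2 * α) ≤ Real.cos (2 * w.im) := by
    rw [← Real.cos_abs (2 * w.im)]
    refine Real.cos_le_cos_of_nonneg_of_le_pi (abs_nonneg _) (by linarith) ?_
    rw [abs_mul, abs_two]
    linarith
  have h1 := norm_jacobiTheta_sub_one_le (im_I_mul_exp_pos hws)
  rw [im_I_mul_exp] at h1
  have h2 : -Real.pi * (Real.exp (2 * w.re) * Real.cos (2 * w.im)) ≤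
      -κ * Real.exp (2 * w.re) := by
    have := mul_le_mul_of_nonneg_left hcosw
      (by positivity : 0 ≤ Real.pi * Real.exp (2 * w.re))
    rw [hκ]
    linarith
  have h3 : -κ * Real.exp (2 * w.re) ≤ -κ * Real.exp (-2) := by
    have : Real.exp (-2) ≤ Real.exp (2 * w.re) := Real.exp_le_exp.mpr (by linarith)
    nlinarith
  have h4 : Real.exp (-Real.pi * (Real.exp (2 * w.re) * Real.cos (2 * w.im))) ≤
      Real.exp (-κ * Real.exp (2 * w.re)) := Real.exp_le_exp.mpr h2
  have h5 : Real.exp (-κ * Real.exp (2 * w.re)) ≤ Real.exp (-κ * Real.exp (-2)) :=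
    Real.exp_le_exp.mpr h3
  have h6 : ‖Complex.exp (w / 2)‖ = Real.exp (w.re / 2) := by
    rw [Complex.norm_exp]
    simp
  rw [thetaB, norm_mul, h6, mul_comm _ (Real.exp (w.re / 2)), mul_assoc]
  refine mul_le_mul_of_nonneg_left (h1.trans ?_) (Real.exp_pos _).le
  refine mul_le_mul ?_ h4 (Real.exp_pos _).le (by positivity)
  exact div_le_div_of_nonneg_left zero_le_two hden (by linarith)

/-- Starting at `-1` leaves room for two derivatives, each of which costs `1/2` in Cauchy's
estimate, so that `thetaPhi` is controlled on `Re w ≥ 0`. -/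
theorem rightDecay_thetaB : RightDecay (-1) thetaB := by
  intro α hα M hM
  rcases lt_or_ge α 0 with h0 | hα0
  · exact ⟨0, fun w hw => absurd (abs_nonneg w.im) (by linarith)⟩
  obtain ⟨C, κ, hC, hκ, h⟩ := norm_thetaB_le hα0 hα
  refine ⟨C * Real.exp (1 / 4) * Real.exp (4 * (M + 1) ^ 2 / κ + (M + 1)), fun w hw hre => ?_⟩
  refine (h w hw hre).trans ?_
  have h1 := exp_neg_mul_exp_le hκ (by linarith : 0 < M + 1) hre
  have h2 : Real.exp (w.re / 2) * Real.exp (-(M + 1) * w.re ^ 2) ≤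
      Real.exp (1 / 4) * Real.exp (-M * w.re ^ 2) := by
    rw [← Real.exp_add, ← Real.exp_add]
    refine Real.exp_le_exp.mpr ?_
    nlinarith [sq_nonneg (w.re - 1 / 4)]
  calc C * Real.exp (w.re / 2) * Real.exp (-κ * Real.exp (2 * w.re))
      ≤ C * Real.exp (w.re / 2) * (Real.exp (4 * (M + 1) ^ 2 / κ + (M + 1)) *
        Real.exp (-(M + 1) * w.re ^ 2)) := by gcongr
    _ = C * Real.exp (4 * (M + 1) ^ 2 / κ + (M + 1)) *
        (Real.exp (w.re / 2) * Real.exp (-(M + 1) * w.re ^ 2)) := by ring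
    _ ≤ C * Real.exp (4 * (M + 1) ^ 2 / κ + (M + 1)) *
        (Real.exp (1 / 4) * Real.exp (-M * w.re ^ 2)) := by gcongr
    _ = _ := by ring

theorem norm_deriv_le_of_closedBall {f : ℂ → ℂ} (hf : DifferentiableOn ℂ f thetaStrip) {α : ℝ}
    (hα : α < Real.pi / 4) {w : ℂ} (hw : |w.im| ≤ α) {K : ℝ}
    (hK : ∀ z : ℂ, |z.im| ≤ (α + Real.pi / 4) / 2 → |z.re - w.re| ≤ 1 / 2 → ‖f z‖ ≤ K) :
    ‖deriv f w‖ ≤ K / min ((Real.pi / 4 - α) / 2) (1 / 2) := by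
  set r := min ((Real.pi / 4 - α) / 2) (1 / 2) with hr
  have hr0 : 0 < r := lt_min (by linarith) (by norm_num)
  have hb : ∀ z ∈ closedBall w r, |z.im| ≤ (α + Real.pi / 4) / 2 ∧ |z.re - w.re| ≤ 1 / 2 := by
    intro z hz
    rw [mem_closedBall, dist_eq_norm] at hz
    have h1 := (Complex.abs_im_le_norm (z - w)).trans hz
    have h2 := (Complex.abs_re_le_norm (z - w)).trans hz
    rw [Complex.sub_im] at h1
    rw [Complex.sub_re] at h2
    have h3 := abs_sub_abs_le_abs_sub z.im w.im
    exact ⟨by linarith [min_le_left ((Real.pi / 4 - α) / 2) (1 / 2)], h2.trans (min_le_right _ _)⟩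
  refine Complex.norm_deriv_le_of_forall_mem_sphere_norm_le hr0 ?_ fun z hz =>
    hK z (hb z (sphere_subset_closedBall hz)).1 (hb z (sphere_subset_closedBall hz)).2
  refine DifferentiableOn.diffContOnCl (hf.mono ?_)
  rw [closure_ball _ hr0.ne']
  intro z hz
  exact lt_of_le_of_lt (hb z hz).1 (by linarith)

theorem RightDecay.deriv {x₀ : ℝ} {f : ℂ → ℂ} (hf : DifferentiableOn ℂ f thetaStrip)
    (h : RightDecay x₀ f) : RightDecay (x₀ + 1 / 2) (deriv f) := by
  intro α hα M hM
  obtain ⟨C, hC⟩ := h ((α + Real.pi / 4) / 2) (by linarith) (2 * M) (by positivity)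
  refine ⟨|C| * Real.exp (M / 2) / min ((Real.pi / 4 - α) / 2) (1 / 2), fun w hw hre => ?_⟩
  rw [div_mul_eq_mul_div]
  refine norm_deriv_le_of_closedBall hf hα hw fun z hz1 hz2 => ?_
  have hz3 := abs_le.mp hz2
  refine (hC z hz1 (by linarith)).trans ?_
  rw [mul_assoc, ← Real.exp_add]
  refine mul_le_mul (le_abs_self C) (Real.exp_le_exp.mpr ?_) (Real.exp_pos _).le (abs_nonneg _)
  have h1 : (z.re - w.re) ^ 2 ≤ 1 / 4 := by nlinarith
  have h2 : w.re ^ 2 ≤ 2 * z.re ^ 2 + 1 / 2 := by nlinarith [sq_nonneg (2 * z.re - w.re)]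
  have h3 := mul_le_mul_of_nonneg_left h2 hM.le
  linarith

/-- The right half comes from `thetaB` and its second derivative, the left half from evenness. -/
theorem norm_thetaPhi_le {α : ℝ} (hα : α < Real.pi / 4) {M : ℝ} (hM : 0 < M) :
    ∃ C, ∀ w : ℂ, |w.im| ≤ α → ‖thetaPhi w‖ ≤ C * Real.exp (-M * w.re ^ 2) := by
  obtain ⟨C₁, h₁⟩ := rightDecay_thetaB α hα M hM
  obtain ⟨C₂, h₂⟩ := ((rightDecay_thetaB.deriv differentiableOn_thetaB).deriv
    (differentiableOn_thetaB.deriv isOpen_thetaStrip)) α hα M hM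
  have hr : ∀ w : ℂ, |w.im| ≤ α → 0 ≤ w.re →
      ‖thetaPhi w‖ ≤ (C₂ + C₁ / 4) * Real.exp (-M * w.re ^ 2) := by
    intro w hw hre
    have h1 := h₁ w hw (by linarith)
    have h2 := h₂ w hw (by linarith)
    have h3 := norm_sub_le (_root_.deriv (_root_.deriv thetaB) w) (thetaB w / 4)
    rw [norm_div, Complex.norm_ofNat] at h3
    rw [thetaPhi]
    linarith
  refine ⟨C₂ + C₁ / 4, fun w hw => ?_⟩
  rcases le_total 0 w.re with h | h
  · exact hr w hw h
  · have := hr (-w) (by simpa using hw) (by simpa using h)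
    rwa [thetaPhi_neg (lt_of_le_of_lt hw hα), Complex.neg_re, neg_sq] at this

theorem norm_thetaA_le {α : ℝ} (hα : α < Real.pi / 4) :
    ∃ C, ∀ w : ℂ, |w.im| ≤ α → ‖thetaA w‖ ≤ C * Real.exp (-|w.re| / 2) := by
  obtain ⟨C, h⟩ := rightDecay_thetaB α hα 1 one_pos
  have hr : ∀ w : ℂ, |w.im| ≤ α → 0 ≤ w.re →
      ‖thetaA w‖ ≤ (|C| * Real.exp 1 + 1) * Real.exp (-|w.re| / 2) := by
    intro w hw hre
    have h1 := h w hw (by linarith)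
    have h2 : ‖Complex.exp (-w / 2)‖ = Real.exp (-|w.re| / 2) := by
      rw [Complex.norm_exp, abs_of_nonneg hre]
      simp
    have h3 : Real.exp (-1 * w.re ^ 2) ≤ Real.exp 1 * Real.exp (-|w.re| / 2) := by
      rw [← Real.exp_add, abs_of_nonneg hre]
      refine Real.exp_le_exp.mpr ?_
      nlinarith [sq_nonneg (w.re - 1)]
    have h4 : C * Real.exp (-1 * w.re ^ 2) ≤ |C| * (Real.exp 1 * Real.exp (-|w.re| / 2)) :=
      mul_le_mul (le_abs_self C) h3 (Real.exp_pos _).le (abs_nonneg _)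
    have h5 := norm_sub_le (thetaB w) (Complex.exp (-w / 2))
    rw [thetaA]
    linarith
  refine ⟨|C| * Real.exp 1 + 1, fun w hw => ?_⟩
  rcases le_total 0 w.re with h | h
  · exact hr w hw h
  · have := hr (-w) (by simpa using hw) (by simpa using h)
    rwa [thetaA_neg (lt_of_le_of_lt hw hα), Complex.neg_re, abs_neg] at this

theorem norm_deriv_thetaA_le {α : ℝ} (hα : α < Real.pi / 4) :
    ∃ C, ∀ w : ℂ, |w.im| ≤ α → ‖deriv thetaA w‖ ≤ C * Real.exp (-|w.re| / 2) := by
  obtain ⟨C, hC⟩ := norm_thetaA_le (α := (α + Real.pi / 4) / 2) (by linarith)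
  refine ⟨|C| * Real.exp (1 / 4) / min ((Real.pi / 4 - α) / 2) (1 / 2), fun w hw => ?_⟩
  rw [div_mul_eq_mul_div]
  refine norm_deriv_le_of_closedBall differentiableOn_thetaA hα hw fun z hz1 hz2 => ?_
  refine (hC z hz1).trans ?_
  rw [mul_assoc, ← Real.exp_add]
  refine mul_le_mul (le_abs_self C) (Real.exp_le_exp.mpr ?_) (Real.exp_pos _).le (abs_nonneg _)
  have := abs_sub_abs_le_abs_sub w.re z.re
  rw [abs_sub_comm] at this
  linarith

/-- The terms of the series for `thetaB`, with `m = π (n + 1)²`. -/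
def thetaTerm (m : ℝ) (w : ℂ) : ℂ := 2 * Complex.exp (w / 2 - m * Complex.exp (2 * w))

theorem hasSum_thetaTerm {w : ℂ} (hw : w ∈ thetaStrip) :
    HasSum (fun n : ℕ => thetaTerm (Real.pi * (n + 1) ^ 2) w) (thetaB w) := by
  have h := (hasSum_nat_jacobiTheta (im_I_mul_exp_pos hw)).mul_left (2 * Complex.exp (w / 2))
  have e1 : thetaB w = 2 * Complex.exp (w / 2) *
      ((jacobiTheta (Complex.I * Complex.exp (2 * w)) - 1) / 2) := by
    rw [thetaB]
    ring
  rw [e1]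
  refine h.congr_fun fun n => ?_
  rw [thetaTerm, mul_assoc, ← Complex.exp_add]
  congr 2
  push_cast
  linear_combination -((Real.pi : ℂ) * (n + 1) ^ 2 * Complex.exp (2 * w)) * Complex.I_mul_I

theorem hasDerivAt_thetaTerm (m : ℝ) (w : ℂ) :
    HasDerivAt (thetaTerm m) ((1 / 2 - 2 * m * Complex.exp (2 * w)) * thetaTerm m w) w := by
  have h1 : HasDerivAt (fun w : ℂ => Complex.exp (2 * w)) (2 * Complex.exp (2 * w)) w := by
    refine ((hasDerivAt_id w).const_mul 2).cexp.congr_deriv ?_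
    simp [mul_comm]
  have h2 := ((((hasDerivAt_id w).div_const 2).fun_sub (h1.const_mul (m : ℂ))).cexp).const_mul 2
  refine h2.congr_deriv ?_
  simp only [thetaTerm, id]
  ring

theorem deriv_deriv_thetaTerm (m : ℝ) (w : ℂ) :
    deriv (deriv (thetaTerm m)) w = ((1 / 2 - 2 * m * Complex.exp (2 * w)) ^ 2 -
      4 * m * Complex.exp (2 * w)) * thetaTerm m w := by
  have h0 : deriv (thetaTerm m) =
      fun w => (1 / 2 - 2 * m * Complex.exp (2 * w)) * thetaTerm m w :=
    funext fun w => (hasDerivAt_thetaTerm m w).deriv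
  have h1 : HasDerivAt (fun w : ℂ => 1 / 2 - 2 * m * Complex.exp (2 * w))
      (-(4 * m * Complex.exp (2 * w))) w := by
    refine ((((hasDerivAt_id w).const_mul 2).cexp.const_mul (2 * (m : ℂ))).const_sub
      (1 / 2)).congr_deriv ?_
    simp
    ring
  rw [h0, (h1.fun_mul (hasDerivAt_thetaTerm m w)).deriv]
  ring

/-- On a disc of radius `1/8` one has `cos(2 Im w) ≥ 1/2`, so the series has a geometric majorant;
this justifies differentiating it twice term by term. -/
theorem tendstoLocallyUniformlyOn_thetaTerm (u : ℝ) :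
    TendstoLocallyUniformlyOn
      (fun (s : Finset ℕ) w => ∑ n ∈ s, thetaTerm (Real.pi * (n + 1) ^ 2) w)
      thetaB atTop (ball (u : ℂ) (1 / 8)) := by
  have hpi := Real.pi_gt_three
  set c := Real.pi * (Real.exp (2 * (u - 1)) * (1 / 2)) with hc
  have hc0 : 0 < c := by positivity
  have hsub : ∀ w ∈ ball (u : ℂ) (1 / 8), |w.im| < 1 / 8 ∧ |w.re - u| < 1 / 8 := by
    intro w hw
    rw [mem_ball, dist_eq_norm] at hw
    have h1 := (Complex.abs_im_le_norm (w - u)).trans_lt hw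
    have h2 := (Complex.abs_re_le_norm (w - u)).trans_lt hw
    exact ⟨by simpa using h1, by simpa using h2⟩
  have hsum : Summable fun n : ℕ =>
      2 * Real.exp ((u + 1) / 2) * Real.exp (-c * (n + 1)) := by
    refine Summable.mul_left _ ?_
    have : ∀ n : ℕ, Real.exp (-c * (n + 1)) = Real.exp (-c) * Real.exp (-c) ^ n := fun n => by
      rw [← Real.exp_nat_mul, ← Real.exp_add]
      ring_nf
    simp_rw [this]
    exact (summable_geometric_of_lt_one (Real.exp_pos _).le
      (Real.exp_lt_one_iff.mpr (by linarith))).mul_left _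
  have hbd : ∀ (n : ℕ) (w : ℂ), w ∈ ball (u : ℂ) (1 / 8) →
      ‖thetaTerm (Real.pi * (n + 1) ^ 2) w‖ ≤
        2 * Real.exp ((u + 1) / 2) * Real.exp (-c * (n + 1)) := by
    intro n w hw
    obtain ⟨h1, h2⟩ := hsub w hw
    have h2' := abs_lt.mp h2
    have hcos : 1 / 2 ≤ Real.cos (2 * w.im) := by
      have h3 := Real.one_sub_sq_div_two_le_cos (x := 2 * w.im)
      have h4 := abs_lt.mp h1
      nlinarith
    have hre : (w / 2 - ((Real.pi * (n + 1) ^ 2 : ℝ) : ℂ) * Complex.exp (2 * w)).re =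
        w.re / 2 - Real.pi * (n + 1) ^ 2 * (Real.exp (2 * w.re) * Real.cos (2 * w.im)) := by
      rw [Complex.sub_re, Complex.re_ofReal_mul, Complex.exp_re]
      simp
    rw [thetaTerm, norm_mul, Complex.norm_ofNat, Complex.norm_exp, hre, mul_assoc 2, ← Real.exp_add]
    refine mul_le_mul_of_nonneg_left (Real.exp_le_exp.mpr ?_) zero_le_two
    have h5 : Real.exp (2 * (u - 1)) * (1 / 2) ≤ Real.exp (2 * w.re) * Real.cos (2 * w.im) := by
      gcongr
      linarith
    have h6 : (n : ℝ) + 1 ≤ (n + 1) ^ 2 := by nlinarith [(Nat.cast_nonneg n : (0 : ℝ) ≤ n)]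
    have h7 : c * (n + 1) ≤
        Real.pi * (n + 1) ^ 2 * (Real.exp (2 * w.re) * Real.cos (2 * w.im)) := by
      calc c * (n + 1) = Real.pi * (n + 1) * (Real.exp (2 * (u - 1)) * (1 / 2)) := by rw [hc]; ring
        _ ≤ _ := by gcongr
    linarith
  refine (tendstoUniformlyOn_tsum hsum hbd).tendstoLocallyUniformlyOn.congr_right fun w hw => ?_
  exact (hasSum_thetaTerm (show |w.im| < Real.pi / 4 by linarith [(hsub w hw).1])).tsum_eq

/-- The terms of the series for `thetaPhi` on the real axis. -/
def phiTerm (m u : ℝ) : ℝ :=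
  2 * ((2 * m * Real.exp (2 * u)) ^ 2 - 3 * (2 * m * Real.exp (2 * u))) *
    Real.exp (u / 2 - m * Real.exp (2 * u))

theorem hasSum_phiTerm (u : ℝ) :
    HasSum (fun n : ℕ => (phiTerm (Real.pi * (n + 1) ^ 2) u : ℂ)) (thetaPhi u) := by
  have hu : (u : ℂ) ∈ ball (u : ℂ) (1 / 8) := mem_ball_self (by norm_num)
  have hd : ∀ s : Finset ℕ, Differentiable ℂ
      fun w => ∑ n ∈ s, thetaTerm (Real.pi * (n + 1) ^ 2) w := fun s =>
    Differentiable.fun_sum fun n _ w => (hasDerivAt_thetaTerm _ w).differentiableAt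
  have h1 := ((tendstoLocallyUniformlyOn_thetaTerm u).deriv
    (Eventually.of_forall fun s => (hd s).differentiableOn) isOpen_ball).deriv
    (Eventually.of_forall fun s => (hd s).deriv.differentiableOn) isOpen_ball
  have h2 : HasSum (fun n : ℕ => deriv (deriv (thetaTerm (Real.pi * (n + 1) ^ 2))) u)
      (deriv (deriv thetaB) u) := by
    rw [HasSum]
    refine (h1.tendsto_at hu).congr fun s => ?_
    have hT : ∀ m, Differentiable ℂ (thetaTerm m) := fun m w =>
      (hasDerivAt_thetaTerm m w).differentiableAt
    have e1 : deriv (fun w => ∑ n ∈ s, thetaTerm (Real.pi * (n + 1) ^ 2) w) =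
        fun w => ∑ n ∈ s, deriv (thetaTerm (Real.pi * (n + 1) ^ 2)) w :=
      funext fun w => deriv_fun_sum fun n _ => hT _ w
    simp only [Function.comp_apply, e1]
    exact deriv_fun_sum fun n _ => (hT _).deriv _
  have h3 := h2.sub ((hasSum_thetaTerm (ofReal_mem_thetaStrip u)).div_const 4)
  refine h3.congr_fun fun n => ?_
  rw [deriv_deriv_thetaTerm, phiTerm, thetaTerm]
  push_cast
  ring

/-- Riemann's kernel on the real axis. -/
def phi (u : ℝ) : ℝ := (thetaPhi u).re

theorem hasSum_phi (u : ℝ) : HasSum (fun n : ℕ => phiTerm (Real.pi * (n + 1) ^ 2) u) (phi u) := by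
  simpa only [phi, Complex.ofReal_re] using Complex.hasSum_re (hasSum_phiTerm u)

theorem ofReal_phi (u : ℝ) : (phi u : ℂ) = thetaPhi u :=
  (Complex.hasSum_ofReal.mpr (hasSum_phi u)).unique (hasSum_phiTerm u)

theorem phi_neg (u : ℝ) : phi (-u) = phi u := by
  rw [phi, Complex.ofReal_neg, thetaPhi_neg (ofReal_mem_thetaStrip u), phi]

/-- The sign is that of `x(x - 3)` with `x = 2m e^(2u)`. For negative `u` terms may be negative, and
positivity of `phi` there comes from evenness. -/
theorem phiTerm_pos {m u : ℝ} (hm : 3 < m) (hu : 0 ≤ u) : 0 < phiTerm m u := by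
  have h1 : 1 ≤ Real.exp (2 * u) := Real.one_le_exp (by linarith)
  have h2 : 3 < 2 * m * Real.exp (2 * u) := by nlinarith
  have h3 : 0 < (2 * m * Real.exp (2 * u)) ^ 2 - 3 * (2 * m * Real.exp (2 * u)) := by nlinarith
  rw [phiTerm]
  positivity

theorem phi_pos (u : ℝ) : 0 < phi u := by
  wlog hu : 0 ≤ u
  · rw [← phi_neg]
    exact this (-u) (by linarith)
  have h : ∀ n : ℕ, 0 < phiTerm (Real.pi * (n + 1) ^ 2) u := fun n => by
    refine phiTerm_pos ?_ hu
    have h1 := Real.pi_gt_three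
    have h2 : (1 : ℝ) ≤ (n + 1) ^ 2 := by nlinarith [(Nat.cast_nonneg n : (0 : ℝ) ≤ n)]
    nlinarith
  rw [← (hasSum_phi u).tsum_eq]
  exact (hasSum_phi u).summable.tsum_pos (fun n => (h n).le) 0 (h 0)

theorem continuous_phi : Continuous phi := by
  have h : Continuous fun u : ℝ => thetaPhi u := by
    rw [← continuousOn_univ]
    exact differentiableOn_thetaPhi.continuousOn.comp Complex.continuous_ofReal.continuousOn
      fun u _ => ofReal_mem_thetaStrip u
  exact Complex.continuous_re.comp h

theorem gaussKernel_phi : GaussKernel phi where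
  cont := continuous_phi
  pos := phi_pos
  even := phi_neg
  int lam := by
    have hc := continuous_phi
    have hM : 0 < |lam| + 1 := by positivity
    obtain ⟨C, hC⟩ := norm_thetaPhi_le (α := 0) (by linarith [Real.pi_pos]) hM
    refine ((integrable_exp_neg_mul_sq one_pos).const_mul C).mono'
      (by fun_prop : Continuous _).aestronglyMeasurable (Eventually.of_forall fun u => ?_)
    have h1 := hC u (by simp)
    rw [← ofReal_phi, Complex.norm_real, Complex.ofReal_re] at h1
    rw [norm_mul, Real.norm_of_nonneg (Real.exp_pos _).le]
    have hC0 : 0 ≤ C := by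
      have := (norm_nonneg _).trans h1
      exact nonneg_of_mul_nonneg_left this (Real.exp_pos _)
    calc ‖phi u‖ * Real.exp (lam * u ^ 2)
        ≤ C * Real.exp (-(|lam| + 1) * u ^ 2) * Real.exp (lam * u ^ 2) := by gcongr
      _ = C * Real.exp (-(|lam| + 1) * u ^ 2 + lam * u ^ 2) := by rw [mul_assoc, ← Real.exp_add]
      _ ≤ C * Real.exp (-1 * u ^ 2) := by
        gcongr
        nlinarith [le_abs_self lam, sq_nonneg u]

/-! ### The xi-function as the Fourier transform of Riemann's kernel. -/

theorem integrable_exp_neg_mul_abs {c : ℝ} (hc : 0 < c) :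
    Integrable fun u : ℝ => Real.exp (-c * |u|) := by
  have h1 : IntegrableOn (fun u : ℝ => Real.exp (-c * |u|)) (Set.Ioi 0) :=
    (integrableOn_exp_mul_Ioi (neg_lt_zero.mpr hc) 0).congr_fun
      (fun u (hu : 0 < u) => by rw [abs_of_pos hu]) measurableSet_Ioi
  have h2 : IntegrableOn (fun u : ℝ => Real.exp (-c * |u|)) (Set.Iic 0) :=
    (integrableOn_exp_mul_Iic hc 0).congr_fun
      (fun u (hu : u ≤ 0) => by rw [abs_of_nonpos hu]; ring_nf) measurableSet_Iic
  rw [← integrableOn_univ, ← Set.Iic_union_Ioi (a := (0 : ℝ))]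
  exact h2.union h1

theorem continuous_comp_thetaStrip {F : ℂ → ℂ} (hF : DifferentiableOn ℂ F thetaStrip) {α : ℝ}
    (hα : |α| < Real.pi / 4) : Continuous fun u : ℝ => F (u + α * Complex.I) := by
  rw [← continuousOn_univ]
  refine hF.continuousOn.comp (by fun_prop) fun u _ => ?_
  simpa [thetaStrip] using hα

/-- Shifting a horizontal line of integration inside the strip. -/
theorem integral_shift_eq {F : ℂ → ℂ} (hF : DifferentiableOn ℂ F thetaStrip) {α c C : ℝ}
    (hα : |α| < Real.pi / 4) (hc : 0 < c)
    (hb : ∀ w : ℂ, |w.im| ≤ |α| → ‖F w‖ ≤ C * Real.exp (-c * |w.re|)) :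
    ∫ u : ℝ, F (u + α * Complex.I) = ∫ u : ℝ, F u := by
  have hint : ∀ β : ℝ, |β| ≤ |α| → Integrable fun u : ℝ => F (u + β * Complex.I) := by
    intro β hβ
    refine ((integrable_exp_neg_mul_abs hc).const_mul C).mono'
      (continuous_comp_thetaStrip hF (hβ.trans_lt hα)).aestronglyMeasurable
      (Eventually.of_forall fun u => ?_)
    simpa using hb (u + β * Complex.I) (by simpa using hβ)
  have i0 : Integrable fun u : ℝ => F u := by simpa using hint 0 (by simp)
  have hrect : ∀ T : ℝ, (∫ u in -T..T, F u) - (∫ u in -T..T, F (u + α * Complex.I)) =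
      Complex.I • (∫ y in (0 : ℝ)..α, F ((-T : ℝ) + y * Complex.I)) -
        Complex.I • (∫ y in (0 : ℝ)..α, F (T + y * Complex.I)) := by
    intro T
    have h := Complex.integral_boundary_rect_eq_zero_of_differentiableOn F (-T : ℝ)
      (T + α * Complex.I) (hF.mono fun w hw => ?_)
    · simp only [Complex.ofReal_re, Complex.ofReal_im, Complex.add_re, Complex.mul_re,
        Complex.I_re, mul_zero, Complex.I_im, mul_one, sub_self, add_zero, Complex.add_im,
        Complex.mul_im, zero_add, Complex.ofReal_zero, zero_mul] at h
      linear_combination h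
    · have h1 := hw.2
      simp only [Complex.ofReal_im, Complex.add_im, Complex.mul_im, Complex.ofReal_re,
        Complex.I_im, mul_one, Complex.I_re, mul_zero, add_zero, zero_add, Set.mem_preimage] at h1
      have h2 := Set.abs_sub_left_of_mem_uIcc h1
      rw [sub_zero, sub_zero] at h2
      exact h2.trans_lt hα
  have hside : ∀ s : ℝ → ℝ, (∀ T, |s T| = |T|) → Tendsto (fun T : ℝ =>
      Complex.I • (∫ y in (0 : ℝ)..α, F (s T + y * Complex.I))) atTop (𝓝 0) := by
    intro s hs
    have hlim : Tendsto (fun T : ℝ => C * Real.exp (-c * |T|) * |α - 0|) atTop (𝓝 0) := by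
      have h1 : Tendsto (fun T : ℝ => -c * |T|) atTop atBot :=
        tendsto_abs_atTop_atTop.const_mul_atTop_of_neg (neg_lt_zero.mpr hc)
      simpa using ((Real.tendsto_exp_atBot.comp h1).const_mul C).mul_const |α - 0|
    refine squeeze_zero_norm (fun T => ?_) hlim
    rw [norm_smul, Complex.norm_I, one_mul]
    refine intervalIntegral.norm_integral_le_of_norm_le_const fun y hy => ?_
    have h2 := Set.abs_sub_left_of_mem_uIcc (Set.uIoc_subset_uIcc hy)
    rw [sub_zero, sub_zero] at h2
    have := hb (s T + y * Complex.I) (by simpa using h2)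
    simpa [hs] using this
  have hL := (intervalIntegral_tendsto_integral i0 tendsto_neg_atTop_atBot tendsto_id).sub
    (intervalIntegral_tendsto_integral (hint α le_rfl) tendsto_neg_atTop_atBot tendsto_id)
  have hR := (hside (fun T => -T) (fun T => abs_neg T)).sub (hside (fun T => T) (fun T => rfl))
  have := tendsto_nhds_unique (hL.congr fun T => hrect T) hR
  rw [sub_zero] at this
  exact (sub_eq_zero.mp this).symm

/-- Two integrations by parts in a two-sided Laplace transform. -/
theorem integral_deriv_deriv_mul_exp {f f' f'' : ℝ → ℂ} (hf : ∀ u, HasDerivAt f (f' u) u)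
    (hf' : ∀ u, HasDerivAt f' (f'' u) u) {z : ℂ}
    (i0 : Integrable fun u : ℝ => f u * Complex.exp (z * u))
    (i1 : Integrable fun u : ℝ => f' u * Complex.exp (z * u))
    (i2 : Integrable fun u : ℝ => f'' u * Complex.exp (z * u)) :
    ∫ u : ℝ, f'' u * Complex.exp (z * u) = z ^ 2 * ∫ u : ℝ, f u * Complex.exp (z * u) := by
  have key : ∀ {g g' : ℝ → ℂ}, (∀ u, HasDerivAt g (g' u) u) →
      Integrable (fun u : ℝ => g u * Complex.exp (z * u)) →
      Integrable (fun u : ℝ => g' u * Complex.exp (z * u)) →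
      ∫ u : ℝ, g' u * Complex.exp (z * u) = -z * ∫ u : ℝ, g u * Complex.exp (z * u) := by
    intro g g' hg j0 j1
    have hE : ∀ u : ℝ, HasDerivAt (fun u : ℝ => Complex.exp (z * u)) (z * Complex.exp (z * u)) u := by
      intro u
      have h1 : HasDerivAt (fun w : ℂ => Complex.exp (z * w)) (z * Complex.exp (z * u)) (u : ℂ) := by
        refine ((hasDerivAt_id (u : ℂ)).const_mul z).cexp.congr_deriv ?_
        simp [mul_comm]
      exact h1.comp_ofReal
    have h := integral_eq_zero_of_hasDerivAt_of_integrable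
      (f := fun u : ℝ => g u * Complex.exp (z * u))
      (f' := fun u : ℝ => g' u * Complex.exp (z * u) + z * (g u * Complex.exp (z * u)))
      (fun u => ((hg u).mul (hE u)).congr_deriv (by ring)) (j1.add (j0.const_mul z)) j0
    rw [integral_add j1 (j0.const_mul z), integral_const_mul] at h
    linear_combination h
  rw [key hf' i1 i2, key hf i0 i1]
  ring

theorem hasDerivAt_comp_ofReal_thetaStrip {F : ℂ → ℂ} (hF : DifferentiableOn ℂ F thetaStrip)
    (u : ℝ) : HasDerivAt (fun u : ℝ => F u) (deriv F u) u :=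
  ((hF.differentiableAt (isOpen_thetaStrip.mem_nhds (ofReal_mem_thetaStrip u))).hasDerivAt).comp_ofReal

theorem evenKernel_exp (u : ℝ) : (HurwitzZeta.evenKernel 0 (Real.exp (2 * u)) : ℂ) =
    jacobiTheta (Complex.I * Complex.exp (2 * u)) := by
  have h := HurwitzZeta.evenKernel_def 0 (Real.exp (2 * u))
  rw [QuotientAddGroup.mk_zero] at h
  rw [h, jacobiTheta_eq_jacobiTheta₂]
  simp

/-- This is the Mellin integral of `θ - 1` at `s/2` under `x = e^(2u)`; the Jacobian's factor `2`
cancels the `1/2` in the definition of the completed zeta function. -/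
theorem integral_thetaB {s : ℂ} (hs : 1 < s.re) :
    ∫ u : ℝ, thetaB u * Complex.exp ((s - 1 / 2) * u) = completedRiemannZeta s := by
  have h := ((HurwitzZeta.hurwitzEvenFEPair 0).hasMellin (s := s / 2) (by
    simp only [HurwitzZeta.hurwitzEvenFEPair, Complex.div_ofNat_re]
    linarith)).2
  have hΛ : completedRiemannZeta s = (HurwitzZeta.hurwitzEvenFEPair 0).Λ (s / 2) / 2 := rfl
  have himg : (fun u : ℝ => Real.exp (2 * u)) '' Set.univ = Set.Ioi 0 := by
    rw [Set.image_univ, ← Real.range_exp]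
    refine Set.Subset.antisymm ?_ ?_
    · rintro _ ⟨u, rfl⟩
      exact ⟨2 * u, rfl⟩
    · rintro _ ⟨u, rfl⟩
      exact ⟨u / 2, by simp only; ring_nf⟩
  have hder : ∀ u ∈ Set.univ, HasDerivWithinAt (fun u : ℝ => Real.exp (2 * u))
      (2 * Real.exp (2 * u)) Set.univ u := fun u _ => by
    refine (((hasDerivAt_id u).const_mul 2).exp.congr_deriv ?_).hasDerivWithinAt
    simp [mul_comm]
  have hinj : Set.InjOn (fun u : ℝ => Real.exp (2 * u)) Set.univ := fun a _ b _ hab => by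
    simpa using hab
  rw [mellin, ← himg, integral_image_eq_integral_abs_deriv_smul MeasurableSet.univ hder hinj,
    setIntegral_univ] at h
  rw [hΛ, ← h, ← integral_div]
  refine integral_congr_ae (Eventually.of_forall fun u => ?_)
  have e1 : ((Real.exp (2 * u) : ℝ) : ℂ) ^ (s / 2 - 1) = Complex.exp (2 * u * (s / 2 - 1)) := by
    rw [Complex.cpow_def_of_ne_zero (by exact_mod_cast (Real.exp_pos _).ne'),
      ← Complex.ofReal_log (Real.exp_pos _).le, Real.log_exp]
    push_cast
    rfl
  have e2 : (HurwitzZeta.hurwitzEvenFEPair 0).f (Real.exp (2 * u)) =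
      jacobiTheta (Complex.I * Complex.exp (2 * u)) := evenKernel_exp u
  have e3 : (HurwitzZeta.hurwitzEvenFEPair 0).f₀ = 1 := by simp [HurwitzZeta.hurwitzEvenFEPair]
  have e4 : Complex.exp (2 * u) * Complex.exp (2 * u * (s / 2 - 1)) =
      Complex.exp (u / 2) * Complex.exp ((s - 1 / 2) * u) := by
    rw [← Complex.exp_add, ← Complex.exp_add]
    ring_nf
  simp only
  rw [e1, e2, e3, abs_of_pos (by positivity), thetaB, smul_eq_mul, Complex.real_smul]
  push_cast
  linear_combination -(jacobiTheta (Complex.I * Complex.exp (2 * u)) - 1) * e4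

theorem integrable_mul_exp_of_right_decay {g : ℝ → ℂ} (hg : Continuous g)
    (hr : ∃ C, ∀ u : ℝ, 0 ≤ u → ‖g u‖ ≤ C * Real.exp (-1 * u ^ 2))
    (hl : ∃ C, ∀ u : ℝ, u ≤ 0 → ‖g u‖ ≤ C * Real.exp (-u / 2)) {z : ℂ} (hz : 1 / 2 < z.re) :
    Integrable fun u : ℝ => g u * Complex.exp (z * u) := by
  obtain ⟨C₁, h₁⟩ := hr
  obtain ⟨C₂, h₂⟩ := hl
  set c := z.re - 1 / 2 with hc
  have hc0 : 0 < c := by linarith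
  have hC₁ : 0 ≤ C₁ := by
    have := (norm_nonneg _).trans (h₁ 0 le_rfl)
    simpa using this
  have hC₂ : 0 ≤ C₂ := by
    have := (norm_nonneg _).trans (h₂ 0 le_rfl)
    simpa using this
  refine ((integrable_exp_neg_mul_abs hc0).const_mul (C₁ * Real.exp (z.re ^ 2) + C₂)).mono'
    (by fun_prop : Continuous _).aestronglyMeasurable (Eventually.of_forall fun u => ?_)
  have hn : ‖Complex.exp (z * u)‖ = Real.exp (z.re * u) := by
    rw [Complex.norm_exp]
    simp
  rw [norm_mul, hn]
  rcases le_total 0 u with hu | hu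
  · calc ‖g u‖ * Real.exp (z.re * u) ≤ C₁ * Real.exp (-1 * u ^ 2) * Real.exp (z.re * u) := by
          gcongr
          exact h₁ u hu
      _ = C₁ * Real.exp (-1 * u ^ 2 + z.re * u) := by rw [mul_assoc, ← Real.exp_add]
      _ ≤ C₁ * Real.exp (z.re ^ 2 + -c * |u|) := by
          refine mul_le_mul_of_nonneg_left (Real.exp_le_exp.mpr ?_) hC₁
          rw [abs_of_nonneg hu, hc]
          nlinarith [sq_nonneg (z.re - u), mul_nonneg hu (by linarith : 0 ≤ z.re)]
      _ = C₁ * Real.exp (z.re ^ 2) * Real.exp (-c * |u|) := by rw [Real.exp_add, mul_assoc]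
      _ ≤ _ := by
          gcongr
          linarith
  · calc ‖g u‖ * Real.exp (z.re * u) ≤ C₂ * Real.exp (-u / 2) * Real.exp (z.re * u) := by
          gcongr
          exact h₂ u hu
      _ = C₂ * Real.exp (-c * |u|) := by
          rw [mul_assoc, ← Real.exp_add, abs_of_nonpos hu, hc]
          ring_nf
      _ ≤ _ := by
          gcongr
          exact le_add_of_nonneg_left (by positivity)

theorem two_mul_xi_eq {s : ℂ} (h0 : s ≠ 0) (h1 : s ≠ 1) :
    2 * xi s = s * (s - 1) * completedRiemannZeta s := by
  have h2 : (1 : ℂ) - s ≠ 0 := sub_ne_zero.mpr (Ne.symm h1)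
  rw [completedRiemannZeta_eq, xi]
  field_simp
  ring

theorem differentiable_xi : Differentiable ℂ xi := by
  have := differentiable_completedZeta₀
  unfold xi
  fun_prop

theorem xi_one_sub (s : ℂ) : xi (1 - s) = xi s := by
  rw [xi, xi, completedRiemannZeta₀_one_sub]
  ring

theorem continuous_ofReal_thetaStrip {F : ℂ → ℂ} (hF : DifferentiableOn ℂ F thetaStrip) :
    Continuous fun u : ℝ => F u := by
  simpa using continuous_comp_thetaStrip hF (α := 0) (by simp [Real.pi_pos])

theorem integrable_thetaB_mul_exp {z : ℂ} (hz : 1 / 2 < z.re) :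
    Integrable fun u : ℝ => thetaB u * Complex.exp (z * u) := by
  have hpi := Real.pi_pos
  obtain ⟨C, hC⟩ := rightDecay_thetaB 0 (by linarith) 1 one_pos
  obtain ⟨C', hC'⟩ := norm_thetaA_le (α := 0) (by linarith)
  refine integrable_mul_exp_of_right_decay (continuous_ofReal_thetaStrip differentiableOn_thetaB)
    ⟨C, fun u hu => ?_⟩ ⟨|C'| + 1, fun u hu => ?_⟩ hz
  · simpa using hC u (by simp) (by simp; linarith)
  · have h1 : ‖thetaA u‖ ≤ C' * Real.exp (-|u| / 2) := by simpa using hC' u (by simp)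
    have h2 : ‖Complex.exp (-(u : ℂ) / 2)‖ = Real.exp (-u / 2) := by
      rw [Complex.norm_exp]
      simp
    have h3 : Real.exp (-|u| / 2) ≤ Real.exp (-u / 2) :=
      Real.exp_le_exp.mpr (by linarith [le_abs_self u])
    have h4 := norm_add_le (thetaA u) (Complex.exp (-(u : ℂ) / 2))
    rw [show thetaA u + Complex.exp (-(u : ℂ) / 2) = thetaB u by rw [thetaA]; ring] at h4
    have h5 : C' * Real.exp (-|u| / 2) ≤ |C'| * Real.exp (-u / 2) :=
      mul_le_mul (le_abs_self _) h3 (Real.exp_pos _).le (abs_nonneg _)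
    linarith

theorem deriv_thetaA_add {w : ℂ} (hw : w ∈ thetaStrip) :
    deriv thetaB w = deriv thetaA w - 1 / 2 * Complex.exp (-w / 2) := by
  have hA := (differentiableOn_thetaA.differentiableAt (isOpen_thetaStrip.mem_nhds hw)).hasDerivAt
  have hE : HasDerivAt (fun z : ℂ => Complex.exp (-z / 2))
      (-(1 / 2) * Complex.exp (-w / 2)) w := by
    refine (((hasDerivAt_id w).neg).div_const 2).cexp.congr_deriv ?_
    simp
    ring
  have e : thetaB = fun z => thetaA z + Complex.exp (-z / 2) := by
    ext z
    rw [thetaA]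
    ring
  conv_lhs => rw [e]
  rw [(hA.fun_add hE).deriv]
  ring

theorem integrable_deriv_thetaB_mul_exp {z : ℂ} (hz : 1 / 2 < z.re) :
    Integrable fun u : ℝ => deriv thetaB u * Complex.exp (z * u) := by
  have hpi := Real.pi_pos
  obtain ⟨C, hC⟩ := rightDecay_thetaB.deriv differentiableOn_thetaB 0 (by linarith) 1 one_pos
  obtain ⟨C', hC'⟩ := norm_deriv_thetaA_le (α := 0) (by linarith)
  refine integrable_mul_exp_of_right_decay
    (continuous_ofReal_thetaStrip (differentiableOn_thetaB.deriv isOpen_thetaStrip))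
    ⟨C, fun u hu => ?_⟩ ⟨|C'| + 1, fun u hu => ?_⟩ hz
  · simpa using hC u (by simp) (by simp; linarith)
  · have h1 : ‖deriv thetaA u‖ ≤ C' * Real.exp (-|u| / 2) := by simpa using hC' u (by simp)
    have h2 : ‖1 / 2 * Complex.exp (-(u : ℂ) / 2)‖ = 1 / 2 * Real.exp (-u / 2) := by
      rw [norm_mul, Complex.norm_exp]
      simp
    have h3 : Real.exp (-|u| / 2) ≤ Real.exp (-u / 2) :=
      Real.exp_le_exp.mpr (by linarith [le_abs_self u])
    rw [deriv_thetaA_add (ofReal_mem_thetaStrip u)]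
    have h4 := norm_sub_le (deriv thetaA u) (1 / 2 * Complex.exp (-(u : ℂ) / 2))
    have h5 : C' * Real.exp (-|u| / 2) ≤ |C'| * Real.exp (-u / 2) :=
      mul_le_mul (le_abs_self _) h3 (Real.exp_pos _).le (abs_nonneg _)
    have h6 := Real.exp_pos (-u / 2)
    linarith

theorem fourierC_phi_eq (z : ℂ) :
    fourierC phi z = ∫ u : ℝ, thetaPhi u * Complex.exp (Complex.I * z * u) := by
  simp_rw [fourierC, ofReal_phi]

theorem integrable_thetaPhi_mul_exp (z : ℂ) :
    Integrable fun u : ℝ => thetaPhi u * Complex.exp (z * u) := by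
  have h := gaussKernel_phi.integrable_of_le continuous_phi (lam := 0)
    (fun u => by simp [abs_of_pos (phi_pos u)]) (-Complex.I * z)
  refine h.congr (Eventually.of_forall fun u => ?_)
  simp only [ofReal_phi]
  rw [← mul_assoc, mul_neg, Complex.I_mul_I, neg_neg, one_mul]

/-- The Fourier transform of Riemann's kernel. -/
theorem fourierC_phi (z : ℂ) : fourierC phi z = 2 * xi (1 / 2 + Complex.I * z) := by
  have hd1 : Differentiable ℂ (fourierC phi) :=
    gaussKernel_phi.differentiable_fourierC continuous_phi (lam := 0)
      fun u => by simp [abs_of_pos (phi_pos u)]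
  have hd2 : Differentiable ℂ fun z => 2 * xi (1 / 2 + Complex.I * z) := by
    have := differentiable_xi
    fun_prop
  -- This half-plane is `Re s > 1` for `s = 1/2 + iz`, where the theta integral converges. Two
  -- integrations by parts give the factor `(s - 1/2)² - 1/4 = s(s - 1)`, and both sides are entire.
  have hopen : IsOpen {z : ℂ | z.im < -(1 / 2)} := isOpen_lt Complex.continuous_im continuous_const
  have heq : ∀ z : ℂ, z.im < -(1 / 2) → fourierC phi z = 2 * xi (1 / 2 + Complex.I * z) := by
    intro z hz
    have hre : (Complex.I * z).re = -z.im := by simp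
    have hsre : (1 / 2 + Complex.I * z).re = 1 / 2 - z.im := by simp; ring
    have hz' : 1 / 2 < (Complex.I * z).re := by rw [hre]; linarith
    have h0 : (1 / 2 + Complex.I * z) ≠ 0 := fun h => by
      have := congrArg Complex.re h
      rw [hsre, Complex.zero_re] at this
      linarith
    have h1 : (1 / 2 + Complex.I * z) ≠ 1 := fun h => by
      have := congrArg Complex.re h
      rw [hsre, Complex.one_re] at this
      linarith
    have i0 := integrable_thetaB_mul_exp hz'
    have i2 : Integrable fun u : ℝ => deriv (deriv thetaB) u * Complex.exp (Complex.I * z * u) := by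
      refine ((integrable_thetaPhi_mul_exp (Complex.I * z)).add (i0.div_const 4)).congr
        (Eventually.of_forall fun u => ?_)
      simp only [thetaPhi, Pi.add_apply]
      ring
    have hparts := integral_deriv_deriv_mul_exp
      (hasDerivAt_comp_ofReal_thetaStrip differentiableOn_thetaB)
      (hasDerivAt_comp_ofReal_thetaStrip (differentiableOn_thetaB.deriv isOpen_thetaStrip))
      i0 (integrable_deriv_thetaB_mul_exp hz') i2
    have hB := integral_thetaB (s := 1 / 2 + Complex.I * z) (by rw [hsre]; linarith)
    rw [add_sub_cancel_left] at hB
    have hsub : fourierC phi z = (∫ u : ℝ, deriv (deriv thetaB) u * Complex.exp (Complex.I * z * u)) -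
        (∫ u : ℝ, thetaB u * Complex.exp (Complex.I * z * u)) / 4 := by
      rw [fourierC_phi_eq, ← integral_div, ← integral_sub i2 (i0.div_const 4)]
      refine integral_congr_ae (Eventually.of_forall fun u => ?_)
      simp only [thetaPhi]
      ring
    rw [hsub, hparts, hB, two_mul_xi_eq h0 h1]
    ring
  have := AnalyticOnNhd.eq_of_eventuallyEq (f := fourierC phi)
    (g := fun z => 2 * xi (1 / 2 + Complex.I * z)) (z₀ := -Complex.I)
    (fun z _ => hd1.analyticAt z) (fun z _ => hd2.analyticAt z)
    (eventually_of_mem (hopen.mem_nhds (by simp; norm_num)) heq)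
  exact congrFun this z

/-- Moving the line of integration to height `±1/2`, with the sign of `t`, gains `e^(-|t|/2)`; this
is possible because `1/2 < π/4`. It makes `ξ` integrable on every vertical line, as Mellin inversion
requires. -/
theorem norm_fourierC_phi_le (σ : ℝ) : ∃ C, ∀ t : ℝ,
    ‖fourierC phi (t + σ * Complex.I)‖ ≤ C * Real.exp (-(1 / 2) * |t|) := by
  have hα : (1 / 2 : ℝ) < Real.pi / 4 := by linarith [Real.pi_gt_three]
  obtain ⟨C, hC⟩ := norm_thetaPhi_le hα one_pos
  have hC0 : 0 ≤ C := by simpa using (norm_nonneg _).trans (hC 0 (by simp))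
  set K := C * Real.exp ((|σ| + 1) ^ 2 / 4) with hK
  have hb : ∀ (t : ℝ) (w : ℂ), |w.im| ≤ 1 / 2 →
      ‖thetaPhi w * Complex.exp (Complex.I * (t + σ * Complex.I) * w)‖ ≤
        K * Real.exp (-t * w.im) * Real.exp (-1 * |w.re|) := by
    intro t w hw
    have h1 : ‖Complex.exp (Complex.I * (t + σ * Complex.I) * w)‖ =
        Real.exp (-t * w.im) * Real.exp (-σ * w.re) := by
      rw [Complex.norm_exp, ← Real.exp_add]
      congr 1
      simp
      ring
    rw [norm_mul, h1]
    calc ‖thetaPhi w‖ * (Real.exp (-t * w.im) * Real.exp (-σ * w.re))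
        ≤ C * Real.exp (-1 * w.re ^ 2) * (Real.exp (-t * w.im) * Real.exp (-σ * w.re)) := by
          gcongr
          exact hC w hw
      _ = C * Real.exp (-t * w.im) * Real.exp (-1 * w.re ^ 2 + -σ * w.re) := by
          rw [Real.exp_add]
          ring
      _ ≤ C * Real.exp (-t * w.im) * Real.exp ((|σ| + 1) ^ 2 / 4 + -1 * |w.re|) := by
          refine mul_le_mul_of_nonneg_left (Real.exp_le_exp.mpr ?_) (by positivity)
          have h2 : -σ * w.re ≤ |σ| * |w.re| := by
            rw [← abs_mul]
            exact (neg_mul σ w.re ▸ neg_le_abs _)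
          nlinarith [sq_nonneg (|w.re| - (|σ| + 1) / 2), sq_abs w.re]
      _ = _ := by
          rw [Real.exp_add, hK]
          ring
  refine ⟨∫ u : ℝ, K * Real.exp (-1 * |u|), fun t => ?_⟩
  obtain ⟨α, hαabs, hαt⟩ : ∃ α : ℝ, |α| ≤ 1 / 2 ∧ -t * α = -(1 / 2) * |t| := by
    rcases le_total 0 t with h | h
    · exact ⟨1 / 2, by norm_num, by rw [abs_of_nonneg h]; ring⟩
    · exact ⟨-(1 / 2), by norm_num, by rw [abs_of_nonpos h]; ring⟩
  have hF : DifferentiableOn ℂ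
      (fun w => thetaPhi w * Complex.exp (Complex.I * (t + σ * Complex.I) * w)) thetaStrip :=
    differentiableOn_thetaPhi.mul (by fun_prop)
  have hshift := integral_shift_eq hF (α := α) (C := K * Real.exp (|t| * (1 / 2)))
    (hαabs.trans_lt hα) one_pos (fun w hw => by
      refine (hb t w (hw.trans hαabs)).trans ?_
      refine mul_le_mul_of_nonneg_right (mul_le_mul_of_nonneg_left (Real.exp_le_exp.mpr ?_)
        (by positivity)) (Real.exp_pos _).le
      calc -t * w.im ≤ |t| * |w.im| := by
            rw [← abs_mul]
            exact (neg_mul t w.im ▸ neg_le_abs _)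
        _ ≤ |t| * (1 / 2) := by
            gcongr
            exact hw.trans hαabs)
  rw [fourierC_phi_eq, ← hshift, ← integral_mul_const]
  refine norm_integral_le_of_norm_le
    (((integrable_exp_neg_mul_abs one_pos).const_mul K).mul_const _)
    (Eventually.of_forall fun u => ?_)
  have h1 := hb t (u + α * Complex.I) (by simpa using hαabs)
  have e1 : (u + α * Complex.I : ℂ).im = α := by simp
  have e2 : (u + α * Complex.I : ℂ).re = u := by simp
  rw [e1, e2, hαt] at h1
  linarith

/-! ### The theta function near the cusps. -/

theorem hasSum_jacobiTheta {τ : ℂ} (hτ : 0 < τ.im) :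
    HasSum (fun n : ℤ => Complex.exp (Real.pi * Complex.I * (n : ℂ) ^ 2 * τ)) (jacobiTheta τ) := by
  have := hasSum_jacobiTheta₂_term 0 hτ
  rw [← jacobiTheta_eq_jacobiTheta₂] at this
  simpa [jacobiTheta₂_term] using this

/-- The shift by `1` inserts the sign `(-1)^n`; adding the unsigned series leaves twice the terms
with even `n`. -/
theorem jacobiTheta_one_add {τ : ℂ} (hτ : 0 < τ.im) :
    jacobiTheta (1 + τ) = 2 * jacobiTheta (4 * τ) - jacobiTheta τ := by
  have hinj : Function.Injective fun n : ℤ => 2 * n := fun a b h => by simpa using h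
  have h1 : HasSum (fun n : ℤ => Complex.exp (Real.pi * Complex.I * (n : ℂ) ^ 2 * (1 + τ)) +
      Complex.exp (Real.pi * Complex.I * (n : ℂ) ^ 2 * τ)) (2 * jacobiTheta (4 * τ)) := by
    rw [← hinj.hasSum_iff]
    · refine ((hasSum_jacobiTheta (τ := 4 * τ) (by simpa using hτ)).mul_left 2).congr_fun fun n => ?_
      have e1 : Real.pi * Complex.I * ((2 * n : ℤ) : ℂ) ^ 2 * (1 + τ) =
          Real.pi * Complex.I * (n : ℂ) ^ 2 * (4 * τ) +
            ((2 * n ^ 2 : ℤ) : ℂ) * (2 * Real.pi * Complex.I) := by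
        push_cast
        ring
      have e2 : Real.pi * Complex.I * ((2 * n : ℤ) : ℂ) ^ 2 * τ =
          Real.pi * Complex.I * (n : ℂ) ^ 2 * (4 * τ) := by
        push_cast
        ring
      simp only [Function.comp_apply]
      rw [e1, e2, Complex.exp_add, Complex.exp_int_mul_two_pi_mul_I]
      ring
    · intro n hn
      obtain ⟨m, rfl⟩ : ∃ m, n = 2 * m + 1 := by
        rcases Int.even_or_odd' n with ⟨m, h | h⟩
        · exact absurd ⟨m, h.symm⟩ hn
        · exact ⟨m, h⟩
      have e1 : Real.pi * Complex.I * ((2 * m + 1 : ℤ) : ℂ) ^ 2 * (1 + τ) =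
          Real.pi * Complex.I * ((2 * m + 1 : ℤ) : ℂ) ^ 2 * τ +
            (((2 * m ^ 2 + 2 * m : ℤ) : ℂ) * (2 * Real.pi * Complex.I) + Real.pi * Complex.I) := by
        push_cast
        ring
      rw [e1, Complex.exp_add, Complex.exp_add, Complex.exp_int_mul_two_pi_mul_I,
        Complex.exp_pi_mul_I]
      ring
  have h2 := (hasSum_jacobiTheta (τ := 1 + τ) (by simpa using hτ)).add (hasSum_jacobiTheta hτ)
  rw [← h2.unique h1]
  ring

theorem jacobiTheta_I_div {δ : ℂ} (hδ : 0 < δ.re) :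
    jacobiTheta (Complex.I / δ) = δ ^ (1 / 2 : ℂ) * jacobiTheta (Complex.I * δ) := by
  have him : 0 < (Complex.I * δ).im := by simpa using hδ
  have hδ0 : δ ≠ 0 := by
    rintro rfl
    simp at hδ
  have h := jacobiTheta_S_smul ⟨Complex.I * δ, him⟩
  have e1 : -Complex.I * (Complex.I * δ) = δ := by
    linear_combination -δ * Complex.I_mul_I
  have e2 : ((ModularGroup.S • (⟨Complex.I * δ, him⟩ : UpperHalfPlane) : UpperHalfPlane) : ℂ) =
      Complex.I / δ := by
    rw [UpperHalfPlane.modular_S_smul]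
    simp [div_eq_mul_inv, mul_comm]
  rw [e2] at h
  rw [h]
  congr 2

/-- In this sector `Im(i/δ) ≥ 1/(2|δ|)`. The true error is exponentially small; `1 + x ≤ e^x`
already gives the linear bound needed. -/
theorem norm_jacobiTheta_I_div_sub_one_le {δ : ℂ} (hδ : 0 < δ.re) (hδ' : ‖δ‖ ≤ 2 * δ.re) :
    ‖jacobiTheta (Complex.I / δ) - 1‖ ≤ 4 * ‖δ‖ / Real.pi := by
  have hpi := Real.pi_pos
  have hn : 0 < ‖δ‖ := hδ.trans_le (Complex.re_le_norm δ)
  have him : (Complex.I / δ).im = δ.re / ‖δ‖ ^ 2 := by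
    rw [Complex.div_im, ← Complex.normSq_eq_norm_sq]
    simp
  have hy : 1 / (2 * ‖δ‖) ≤ δ.re / ‖δ‖ ^ 2 := by
    rw [div_le_div_iff₀ (by positivity) (by positivity)]
    nlinarith
  set y := δ.re / ‖δ‖ ^ 2 with hydef
  have hy0 : 0 < y := by positivity
  have h := norm_jacobiTheta_sub_one_le (τ := Complex.I / δ) (by rw [him]; exact hy0)
  rw [him] at h
  have h1 : Real.pi * y + 1 ≤ Real.exp (Real.pi * y) := Real.add_one_le_exp _
  have h2 : Real.exp (-Real.pi * y) = (Real.exp (Real.pi * y))⁻¹ := by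
    rw [← Real.exp_neg]
    ring_nf
  have hx : 0 < Real.pi * y := by positivity
  calc ‖jacobiTheta (Complex.I / δ) - 1‖ ≤ _ := h
    _ = 2 / (Real.exp (Real.pi * y) - 1) := by
      rw [h2]
      have : Real.exp (Real.pi * y) - 1 ≠ 0 := by linarith
      field_simp
    _ ≤ 2 / (Real.pi * (1 / (2 * ‖δ‖))) := by
      gcongr
      have := mul_le_mul_of_nonneg_left hy hpi.le
      linarith
    _ = 4 * ‖δ‖ / Real.pi := by
      field_simp
      norm_num

theorem norm_cpow_half_sq (δ : ℂ) : ‖δ ^ (1 / 2 : ℂ)‖ ^ 2 = ‖δ‖ := by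
  rw [← norm_pow, ← Complex.cpow_nat_mul]
  norm_num

/-- In `2θ(4iδ) - θ(iδ)` the singular parts cancel, since `2(4δ)^(-1/2) = δ^(-1/2)`; what remains is
`δ^(-1/2) O(|δ|)`. -/
theorem norm_jacobiTheta_one_add_le {δ : ℂ} (hδ : 0 < δ.re) (hδ' : ‖δ‖ ≤ 2 * δ.re)
    (hδ2 : ‖δ‖ ≤ 4) : ‖jacobiTheta (1 + Complex.I * δ)‖ ≤ 40 / Real.pi := by
  have hpi := Real.pi_pos
  have h4 : 0 < (4 * δ).re := by simpa using hδ
  have him : 0 < (Complex.I * δ).im := by simpa using hδ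
  set ρ := ‖δ ^ (1 / 2 : ℂ)‖ with hρ
  have hρ2 : ρ ^ 2 = ‖δ‖ := norm_cpow_half_sq δ
  have hn : 0 < ‖δ‖ := hδ.trans_le (Complex.re_le_norm δ)
  have hρ0 : 0 < ρ := lt_of_le_of_ne (norm_nonneg _) fun h => by
    rw [← h] at hρ2
    simp at hρ2
    exact hn.ne hρ2
  have hmul : (4 * δ) ^ (1 / 2 : ℂ) = 2 * δ ^ (1 / 2 : ℂ) := by
    have hδ0 : δ ≠ 0 := norm_pos_iff.mp hn
    have hlog : Complex.log (4 * δ) = 2 * (Real.log 2 : ℝ) + Complex.log δ := by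
      have h := Complex.log_ofReal_mul (show (0 : ℝ) < 4 by norm_num) hδ0
      rw [show (4 : ℝ) = 2 ^ 2 by norm_num, Real.log_pow] at h
      push_cast at h
      norm_num at h ⊢
      exact h
    rw [Complex.cpow_def_of_ne_zero (by simpa using hδ0), Complex.cpow_def_of_ne_zero hδ0, hlog,
      show (2 * (Real.log 2 : ℝ) + Complex.log δ) * (1 / 2) =
        ((Real.log 2 : ℝ) : ℂ) + Complex.log δ * (1 / 2) by ring, Complex.exp_add,
      ← Complex.ofReal_exp, Real.exp_log two_pos]
    norm_num
  have h1 := jacobiTheta_I_div hδ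
  have h2 := jacobiTheta_I_div h4
  have h3 : δ ^ (1 / 2 : ℂ) * jacobiTheta (1 + Complex.I * δ) =
      (jacobiTheta (Complex.I / (4 * δ)) - 1) - (jacobiTheta (Complex.I / δ) - 1) := by
    rw [jacobiTheta_one_add him, h1, h2, hmul]
    ring_nf
  have h5 := norm_jacobiTheta_I_div_sub_one_le hδ hδ'
  have h6 := norm_jacobiTheta_I_div_sub_one_le h4 (by simp; linarith)
  have h7 := norm_sub_le (jacobiTheta (Complex.I / (4 * δ)) - 1) (jacobiTheta (Complex.I / δ) - 1)
  rw [← h3, norm_mul, ← hρ] at h7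
  rw [norm_mul, Complex.norm_ofNat] at h6
  have h8 : ρ * ‖jacobiTheta (1 + Complex.I * δ)‖ ≤ ρ * (20 * ρ / Real.pi) := by
    calc _ ≤ 4 * (4 * ‖δ‖) / Real.pi + 4 * ‖δ‖ / Real.pi := by linarith
      _ = _ := by
        rw [← hρ2]
        ring
  have hρ4 : ρ ≤ 2 := by nlinarith
  calc _ ≤ 20 * ρ / Real.pi := le_of_mul_le_mul_left h8 hρ0
    _ ≤ 40 / Real.pi := by
      gcongr
      linarith

theorem le_norm_jacobiTheta_I_mul {δ : ℂ} (hδ : 0 < δ.re) (hδ' : ‖δ‖ ≤ 2 * δ.re)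
    (hδ2 : ‖δ‖ ≤ 1 / 4) : 1 / 2 ≤ ‖δ ^ (1 / 2 : ℂ)‖ * ‖jacobiTheta (Complex.I * δ)‖ := by
  have h1 := norm_jacobiTheta_I_div_sub_one_le hδ hδ'
  rw [← norm_mul, ← jacobiTheta_I_div hδ]
  have h2 : 4 * ‖δ‖ / Real.pi ≤ 1 / 2 := by
    rw [div_le_iff₀ Real.pi_pos]
    linarith [Real.pi_gt_three]
  have h3 := norm_sub_norm_le (1 : ℂ) (1 - jacobiTheta (Complex.I / δ))
  rw [norm_one, sub_sub_cancel, norm_sub_rev] at h3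
  linarith

/-- The parameter `exp (2 i α) - i`. -/
theorem exp_sub_I_props {α : ℝ} (h0 : 0 ≤ α) (hα : α < Real.pi / 4) :
    0 < (Complex.exp (2 * (α * Complex.I)) - Complex.I).re ∧
    ‖Complex.exp (2 * (α * Complex.I)) - Complex.I‖ ≤
      2 * (Complex.exp (2 * (α * Complex.I)) - Complex.I).re ∧
    ‖Complex.exp (2 * (α * Complex.I)) - Complex.I‖ ≤ 2 := by
  have e : (2 * (α * Complex.I) : ℂ) = ((2 * α : ℝ) : ℂ) * Complex.I := by push_cast; ring
  have hre : (Complex.exp (2 * (α * Complex.I)) - Complex.I).re = Real.cos (2 * α) := by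
    rw [e, Complex.sub_re, Complex.exp_ofReal_mul_I_re]
    simp
  have him : (Complex.exp (2 * (α * Complex.I)) - Complex.I).im = Real.sin (2 * α) - 1 := by
    rw [e, Complex.sub_im, Complex.exp_ofReal_mul_I_im]
    simp
  have hcos : 0 < Real.cos (2 * α) := Real.cos_pos_of_mem_Ioo ⟨by linarith, by linarith⟩
  have hsin : 0 ≤ Real.sin (2 * α) := Real.sin_nonneg_of_nonneg_of_le_pi (by linarith) (by linarith)
  have h1 := Real.sin_sq_add_cos_sq (2 * α)
  have h2 := Real.cos_le_one (2 * α)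
  have h3 := Real.sin_le_one (2 * α)
  have h4 := Complex.norm_le_abs_re_add_abs_im (Complex.exp (2 * (α * Complex.I)) - Complex.I)
  rw [hre, him, abs_of_pos hcos, abs_of_nonpos (by linarith)] at h4
  have h5 : 1 - Real.sin (2 * α) ≤ Real.cos (2 * α) := by nlinarith
  rw [hre]
  exact ⟨hcos, by linarith, by linarith⟩

/-- On the imaginary axis `τ = i e^(2iα)` tends to `-1`, equivalent to `1` by the period `2`. -/
theorem norm_thetaA_mul_I_le {α : ℝ} (h0 : 0 ≤ α) (hα : α < Real.pi / 4) :
    ‖thetaA (α * Complex.I)‖ ≤ 40 / Real.pi + 2 := by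
  obtain ⟨h1, h2, h3⟩ := exp_sub_I_props h0 hα
  set δ := Complex.exp (2 * (α * Complex.I)) - Complex.I with hδ
  have e1 : jacobiTheta (Complex.I * Complex.exp (2 * (α * Complex.I))) =
      jacobiTheta (1 + Complex.I * δ) := by
    rw [← jacobiTheta_two_add]
    congr 1
    rw [hδ]
    linear_combination Complex.I_mul_I
  have h4 := norm_jacobiTheta_one_add_le h1 h2 (by linarith)
  have n1 : ‖Complex.exp (α * Complex.I / 2)‖ = 1 := by
    rw [Complex.norm_exp]
    simp
  have n2 : ‖Complex.exp (-(α * Complex.I) / 2)‖ = 1 := by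
    rw [Complex.norm_exp]
    simp
  rw [thetaA, thetaB, e1]
  refine (norm_sub_le _ _).trans ?_
  rw [norm_mul, n1, n2, one_mul]
  have := norm_sub_le (jacobiTheta (1 + Complex.I * δ)) 1
  rw [norm_one] at this
  linarith

/-- The theta kernel is unbounded near the boundary point of the strip above `log 2 / 2`. -/
theorem not_bounded_thetaA (K : ℝ) : ∃ α : ℝ, 0 ≤ α ∧ α < Real.pi / 4 ∧
    K < ‖thetaA ((Real.log 2 / 2 : ℝ) + α * Complex.I)‖ := by
  set u : ℝ := Real.log 2 / 2 with hu
  have hlim : Tendsto (fun α : ℝ => ‖2 * (Complex.exp (2 * (α * Complex.I)) - Complex.I)‖)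
      (𝓝[<] (Real.pi / 4)) (𝓝 0) := by
    have hc : Continuous fun α : ℝ => ‖2 * (Complex.exp (2 * (α * Complex.I)) - Complex.I)‖ := by
      fun_prop
    have h := hc.tendsto (Real.pi / 4)
    have e : (2 * (((Real.pi / 4 : ℝ) : ℂ) * Complex.I)) = Real.pi / 2 * Complex.I := by
      push_cast
      ring
    rw [e, Complex.exp_pi_div_two_mul_I, sub_self, mul_zero, norm_zero] at h
    exact h.mono_left nhdsWithin_le_nhds
  set L : ℝ := |K| + 10 with hL
  have hL0 : 0 < L := by positivity
  obtain ⟨α, ⟨hα1, hα2⟩, hα0, hαpi⟩ := ((hlim.eventually (gt_mem_nhds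
    (show (0 : ℝ) < 1 / 4 by norm_num))).and (hlim.eventually (gt_mem_nhds
    (show (0 : ℝ) < 1 / (4 * L ^ 2) by positivity)))).and
    (Ioo_mem_nhdsLT (show (0 : ℝ) < Real.pi / 4 by positivity)) |>.exists
  obtain ⟨h1, h2, h3⟩ := exp_sub_I_props hα0.le hαpi
  set δ := 2 * (Complex.exp (2 * (α * Complex.I)) - Complex.I) with hδ
  refine ⟨α, hα0.le, hαpi, ?_⟩
  have h4 := le_norm_jacobiTheta_I_mul (δ := δ) (by rw [hδ]; simpa using h1)
    (by
      rw [hδ, norm_mul, Complex.norm_ofNat, Complex.mul_re]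
      simp only [Complex.re_ofNat, Complex.im_ofNat, zero_mul, sub_zero]
      linarith) hα1.le
  have e0 : Complex.exp (2 * (u + α * Complex.I)) = 2 * Complex.exp (2 * (α * Complex.I)) := by
    rw [mul_add, Complex.exp_add]
    congr 1
    rw [hu, ← Complex.ofReal_ofNat, ← Complex.ofReal_mul, ← Complex.ofReal_exp,
      mul_div_cancel₀ _ two_ne_zero, Real.exp_log two_pos]
  -- Here `τ` tends to `-2`, which the period `2` moves to the cusp `0`, where `θ(iδ)` grows like
  -- `δ^(-1/2)`.
  have e1 : jacobiTheta (Complex.I * Complex.exp (2 * (u + α * Complex.I))) =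
      jacobiTheta (Complex.I * δ) := by
    rw [e0, ← jacobiTheta_two_add]
    congr 1
    rw [hδ]
    linear_combination 2 * Complex.I_mul_I
  set ρ := ‖δ ^ (1 / 2 : ℂ)‖ with hρ
  have hρ2 : ρ ^ 2 = ‖δ‖ := norm_cpow_half_sq δ
  have hρ0 : 0 ≤ ρ := norm_nonneg _
  have hρL : ρ < 1 / (2 * L) := by
    refine lt_of_pow_lt_pow_left₀ 2 (by positivity) ?_
    rw [hρ2]
    refine hα2.trans_le (le_of_eq ?_)
    field_simp
    norm_num
  have hθ : L < ‖jacobiTheta (Complex.I * δ)‖ := by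
    by_contra! hcon
    have h5 : ρ * ‖jacobiTheta (Complex.I * δ)‖ ≤ ρ * L := by gcongr
    have h6 : ρ * L < 1 / (2 * L) * L := by gcongr
    have h7 : 1 / (2 * L) * L = 1 / 2 := by field_simp
    linarith
  have hu0 : 0 ≤ u := by
    have := Real.log_nonneg (one_le_two)
    rw [hu]
    positivity
  have hu1 : u ≤ 1 := by
    rw [hu]
    linarith [Real.log_two_lt_d9]
  have n1 : ‖Complex.exp ((u + α * Complex.I) / 2)‖ = Real.exp (u / 2) := by
    rw [Complex.norm_exp]
    simp
  have n2 : ‖Complex.exp (-(u + α * Complex.I) / 2)‖ ≤ 1 := by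
    rw [Complex.norm_exp, Real.exp_le_one_iff]
    simp
    linarith
  have n3 : 1 ≤ Real.exp (u / 2) := Real.one_le_exp (by linarith)
  rw [thetaA, thetaB, e1]
  have h5 := norm_sub_norm_le (Complex.exp ((u + α * Complex.I) / 2) *
    (jacobiTheta (Complex.I * δ) - 1)) (Complex.exp (-(u + α * Complex.I) / 2))
  rw [norm_mul, n1] at h5
  have h6 := norm_sub_norm_le (jacobiTheta (Complex.I * δ)) 1
  rw [norm_one] at h6
  have h7 : ‖jacobiTheta (Complex.I * δ) - 1‖ ≤
      Real.exp (u / 2) * ‖jacobiTheta (Complex.I * δ) - 1‖ :=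
    le_mul_of_one_le_left (norm_nonneg _) n3
  linarith [le_abs_self K]

/-! ### Hardy's theorem. -/

section

open scoped FourierTransform

/-- The Fourier transform of `thetaA` on the real line. -/
def thetaHat (t : ℝ) : ℂ := ∫ u : ℝ, thetaA u * Complex.exp (Complex.I * t * u)

theorem norm_exp_I_mul_mul (t u : ℝ) : ‖Complex.exp (Complex.I * t * u)‖ = 1 := by
  rw [Complex.norm_exp]
  simp

theorem integrable_mul_exp_I {g : ℝ → ℂ} (hg : Continuous g) {C c : ℝ} (hc : 0 < c)
    (hb : ∀ u, ‖g u‖ ≤ C * Real.exp (-c * |u|)) (t : ℝ) :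
    Integrable fun u : ℝ => g u * Complex.exp (Complex.I * t * u) := by
  refine ((integrable_exp_neg_mul_abs hc).const_mul C).mono'
    (by fun_prop : Continuous _).aestronglyMeasurable (Eventually.of_forall fun u => ?_)
  rw [norm_mul, norm_exp_I_mul_mul, mul_one]
  exact hb u

theorem norm_thetaA_shift_le {α : ℝ} (hα : |α| < Real.pi / 4) : ∃ C, ∀ w : ℂ, |w.im| ≤ |α| →
    ‖thetaA w‖ ≤ C * Real.exp (-(1 / 2) * |w.re|) := by
  obtain ⟨C, hC⟩ := norm_thetaA_le hα
  refine ⟨C, fun w hw => (hC w hw).trans (le_of_eq ?_)⟩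
  ring_nf

/-- Unlike `thetaB`, `thetaA` decays at both ends, so the integrations by parts work on the real
axis itself. The factor `t² + 1/4` has no real zeros. -/
theorem fourierC_phi_eq_thetaHat (t : ℝ) :
    fourierC phi t = -((t : ℂ) ^ 2 + 1 / 4) * thetaHat t := by
  have hpi := Real.pi_pos
  obtain ⟨C, hC⟩ := norm_thetaA_le (α := 0) (by linarith)
  obtain ⟨C', hC'⟩ := norm_deriv_thetaA_le (α := 0) (by linarith)
  have i0 := integrable_mul_exp_I (continuous_ofReal_thetaStrip differentiableOn_thetaA)
    (C := C) one_half_pos (fun u => by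
      refine (hC u (by simp)).trans (le_of_eq ?_)
      rw [Complex.ofReal_re]
      ring_nf) t
  have i1 := integrable_mul_exp_I
    (continuous_ofReal_thetaStrip (differentiableOn_thetaA.deriv isOpen_thetaStrip))
    (C := C') one_half_pos (fun u => by
      refine (hC' u (by simp)).trans (le_of_eq ?_)
      rw [Complex.ofReal_re]
      ring_nf) t
  have i2 : Integrable fun u : ℝ => deriv (deriv thetaA) u * Complex.exp (Complex.I * t * u) := by
    refine ((integrable_thetaPhi_mul_exp (Complex.I * t)).add (i0.div_const 4)).congr
      (Eventually.of_forall fun u => ?_)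
    simp only [thetaPhi_eq (ofReal_mem_thetaStrip u), Pi.add_apply]
    ring
  have hparts := integral_deriv_deriv_mul_exp
    (hasDerivAt_comp_ofReal_thetaStrip differentiableOn_thetaA)
    (hasDerivAt_comp_ofReal_thetaStrip (differentiableOn_thetaA.deriv isOpen_thetaStrip)) i0 i1 i2
  have hsub : fourierC phi t = (∫ u : ℝ, deriv (deriv thetaA) u * Complex.exp (Complex.I * t * u)) -
      (∫ u : ℝ, thetaA u * Complex.exp (Complex.I * t * u)) / 4 := by
    rw [fourierC_phi_eq, ← integral_div, ← integral_sub i2 (i0.div_const 4)]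
    refine integral_congr_ae (Eventually.of_forall fun u => ?_)
    simp only [thetaPhi_eq (ofReal_mem_thetaStrip u)]
    ring
  rw [hsub, hparts, thetaHat, mul_pow, Complex.I_sq]
  ring

theorem ofReal_sq_add_quarter_ne_zero (t : ℝ) : (t : ℂ) ^ 2 + 1 / 4 ≠ 0 := by
  have h : (t : ℂ) ^ 2 + 1 / 4 = ((t ^ 2 + 1 / 4 : ℝ) : ℂ) := by push_cast; ring
  rw [h]
  exact Complex.ofReal_ne_zero.mpr (by positivity)

theorem thetaHat_eq (t : ℝ) : thetaHat t = -fourierC phi t / ((t : ℂ) ^ 2 + 1 / 4) := by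
  rw [fourierC_phi_eq_thetaHat, eq_div_iff (ofReal_sq_add_quarter_ne_zero t)]
  ring

theorem continuous_thetaHat : Continuous thetaHat := by
  have h1 : Continuous (fourierC phi) := (gaussKernel_phi.differentiable_fourierC continuous_phi
    (lam := 0) fun u => by simp [abs_of_pos (phi_pos u)]).continuous
  have h2 : thetaHat = fun t : ℝ => -fourierC phi t / ((t : ℂ) ^ 2 + 1 / 4) := funext thetaHat_eq
  rw [h2]
  refine Continuous.div (by fun_prop) (by fun_prop) ofReal_sq_add_quarter_ne_zero

theorem ofReal_re_thetaHat (t : ℝ) : ((thetaHat t).re : ℂ) = thetaHat t := by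
  refine Complex.conj_eq_iff_re.mp ?_
  rw [thetaHat_eq, map_div₀, map_neg, ← gaussKernel_phi.fourierC_conj, Complex.conj_ofReal]
  simp [Complex.conj_ofNat]

theorem integral_thetaA_shift {α : ℝ} (hα : |α| < Real.pi / 4) (t : ℝ) :
    ∫ u : ℝ, thetaA (u + α * Complex.I) * Complex.exp (Complex.I * t * u) =
      Real.exp (α * t) * thetaHat t := by
  obtain ⟨C, hC⟩ := norm_thetaA_shift_le hα
  have hF : DifferentiableOn ℂ (fun w => thetaA w * Complex.exp (Complex.I * t * w)) thetaStrip :=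
    differentiableOn_thetaA.mul (by fun_prop)
  have h := integral_shift_eq hF (C := C * Real.exp (|t| * |α|)) hα one_half_pos (fun w hw => by
    have hn : ‖Complex.exp (Complex.I * t * w)‖ ≤ Real.exp (|t| * |α|) := by
      rw [Complex.norm_exp]
      refine Real.exp_le_exp.mpr ?_
      calc (Complex.I * t * w).re = -t * w.im := by simp
        _ ≤ |t| * |w.im| := by
          rw [← abs_mul]
          exact (neg_mul t w.im ▸ neg_le_abs _)
        _ ≤ |t| * |α| := by gcongr
    rw [norm_mul]
    refine (mul_le_mul (hC w hw) hn (norm_nonneg _) ((norm_nonneg _).trans (hC w hw))).trans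
      (le_of_eq (by ring)))
  rw [thetaHat, ← h, ← integral_const_mul]
  refine integral_congr_ae (Eventually.of_forall fun u => ?_)
  have e : Complex.exp (Complex.I * t * u) =
      Complex.exp (α * t) * Complex.exp (Complex.I * t * (u + α * Complex.I)) := by
    rw [← Complex.exp_add]
    congr 1
    linear_combination -(t * α : ℂ) * Complex.I_mul_I
  simp only
  rw [e]
  push_cast
  ring

theorem exp_mul_norm_thetaHat_le {α : ℝ} (hα : |α| < Real.pi / 4) :
    ∃ C, ∀ t : ℝ, Real.exp (α * t) * ‖thetaHat t‖ ≤ C := by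
  obtain ⟨C, hC⟩ := norm_thetaA_shift_le hα
  refine ⟨∫ u : ℝ, C * Real.exp (-(1 / 2) * |u|), fun t => ?_⟩
  have h := congrArg norm (integral_thetaA_shift hα t)
  rw [norm_mul, Complex.norm_real, Real.norm_of_nonneg (Real.exp_pos _).le] at h
  rw [← h]
  refine norm_integral_le_of_norm_le ((integrable_exp_neg_mul_abs one_half_pos).const_mul C)
    (Eventually.of_forall fun u => ?_)
  rw [norm_mul, norm_exp_I_mul_mul, mul_one]
  simpa using hC (u + α * Complex.I) (by simp)

/-- Shifting to heights `±β` with `|α| < β < π/4` bounds `e^(β|t|) ‖thetaHat t‖`, leaving the decay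
`e^(-(β - |α|)|t|)`. -/
theorem integrable_exp_mul_thetaHat {α : ℝ} (hα : |α| < Real.pi / 4) :
    Integrable fun t : ℝ => (Real.exp (α * t) : ℂ) * thetaHat t := by
  have hpi := Real.pi_pos
  set β := (|α| + Real.pi / 4) / 2 with hβ
  have hβ0 : 0 < β := by positivity
  have hβpi : |β| < Real.pi / 4 := by rw [abs_of_pos hβ0]; linarith
  have hαβ : 0 < β - |α| := by linarith
  obtain ⟨C₁, h₁⟩ := exp_mul_norm_thetaHat_le hβpi
  obtain ⟨C₂, h₂⟩ := exp_mul_norm_thetaHat_le (α := -β) (by rwa [abs_neg])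
  refine ((integrable_exp_neg_mul_abs hαβ).const_mul (max C₁ C₂)).mono' ?_
    (Eventually.of_forall fun t => ?_)
  · have := continuous_thetaHat
    exact (by fun_prop : Continuous _).aestronglyMeasurable
  · rw [norm_mul, Complex.norm_real, Real.norm_of_nonneg (Real.exp_pos _).le]
    have h3 : Real.exp (β * |t|) * ‖thetaHat t‖ ≤ max C₁ C₂ := by
      rcases le_total 0 t with h | h
      · rw [abs_of_nonneg h]
        exact (h₁ t).trans (le_max_left _ _)
      · rw [abs_of_nonpos h, mul_neg, ← neg_mul]
        exact (h₂ t).trans (le_max_right _ _)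
    have h4 : Real.exp (α * t) ≤ Real.exp (-(β - |α|) * |t|) * Real.exp (β * |t|) := by
      rw [← Real.exp_add]
      refine Real.exp_le_exp.mpr ?_
      have := le_abs_self (α * t)
      rw [abs_mul] at this
      linarith
    calc Real.exp (α * t) * ‖thetaHat t‖
        ≤ Real.exp (-(β - |α|) * |t|) * Real.exp (β * |t|) * ‖thetaHat t‖ := by gcongr
      _ = Real.exp (-(β - |α|) * |t|) * (Real.exp (β * |t|) * ‖thetaHat t‖) := by ring
      _ ≤ Real.exp (-(β - |α|) * |t|) * max C₁ C₂ := by gcongr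
      _ = _ := by ring

theorem thetaA_shift_eq_integral {α : ℝ} (hα : |α| < Real.pi / 4) (u : ℝ) :
    thetaA (u + α * Complex.I) = ((2 * Real.pi)⁻¹ : ℝ) •
      ∫ t : ℝ, Complex.exp (-Complex.I * t * u) * (Real.exp (α * t) * thetaHat t) := by
  have hpi := Real.pi_pos
  set g : ℝ → ℂ := fun u => thetaA (u + α * Complex.I) with hg
  have hgc : Continuous g := continuous_comp_thetaStrip differentiableOn_thetaA hα
  obtain ⟨C, hC⟩ := norm_thetaA_shift_le hα
  have hgi : Integrable g := by
    refine ((integrable_exp_neg_mul_abs one_half_pos).const_mul C).mono'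
      hgc.aestronglyMeasurable (Eventually.of_forall fun u => ?_)
    simpa [hg] using hC (u + α * Complex.I) (by simp)
  have hF : 𝓕 g = fun ξ : ℝ => (Real.exp (α * (-2 * Real.pi * ξ)) : ℂ) *
      thetaHat (-2 * Real.pi * ξ) := by
    ext ξ
    rw [← integral_thetaA_shift hα, Real.fourier_real_eq_integral_exp_smul]
    refine integral_congr_ae (Eventually.of_forall fun u => ?_)
    simp only [smul_eq_mul, hg]
    rw [mul_comm]
    congr 2
    push_cast
    ring
  have hFi : Integrable (𝓕 g) := by
    rw [hF]
    exact (integrable_exp_mul_thetaHat hα).comp_mul_left' (by simp [hpi.ne'])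
  have hinv := congrFun (hgc.fourierInv_fourier_eq hgi hFi) u
  have hcomp := Measure.integral_comp_mul_left
    (fun t : ℝ => Complex.exp (-Complex.I * t * u) * (Real.exp (α * t) * thetaHat t))
    (-2 * Real.pi)
  have habs : |(-2 * Real.pi)⁻¹| = (2 * Real.pi)⁻¹ := by
    rw [abs_inv, abs_mul, abs_neg, abs_two, abs_of_pos hpi]
  rw [habs] at hcomp
  rw [← hcomp]
  change g u = _
  rw [← hinv, Real.fourierInv_eq', hF]
  refine integral_congr_ae (Eventually.of_forall fun ξ => ?_)
  simp only [smul_eq_mul]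
  congr 2
  simp
  ring

/-- A positivity argument in the manner of Landau: with eventually constant sign, the integral of
`e^(αt) |thetaHat t|` is, up to a bounded error, the absolute value of the signed integral, that is,
of `2π thetaA (iα)`, which is bounded. That would bound `thetaA` in the upper half of the strip,
contrary to `not_bounded_thetaA`. -/
theorem thetaHat_zeros_infinite : {t : ℝ | thetaHat t = 0}.Infinite := by
  intro hfin
  have hpi := Real.pi_gt_three
  obtain ⟨T, hT⟩ := hfin.bddAbove
  set T₀ := max T 0 + 1 with hT₀
  have hT₀0 : 0 < T₀ := by positivity
  have hne : ∀ t ∈ Set.Ici T₀, (thetaHat t).re ≠ 0 := by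
    intro t ht h
    have h1 : thetaHat t = 0 := by rw [← ofReal_re_thetaHat, h, Complex.ofReal_zero]
    have h2 := hT h1
    have h3 : T₀ ≤ t := ht
    linarith [le_max_left T 0]
  have hcont : Continuous fun t => (thetaHat t).re := Complex.continuous_re.comp continuous_thetaHat
  obtain ⟨s, hs1, hs⟩ : ∃ s : ℝ, |s| = 1 ∧ ∀ t ∈ Set.Ici T₀, ‖thetaHat t‖ = s * (thetaHat t).re := by
    have hnorm : ∀ t, ‖thetaHat t‖ = |(thetaHat t).re| := fun t => by
      conv_lhs => rw [← ofReal_re_thetaHat, Complex.norm_real, Real.norm_eq_abs]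
    rcases lt_or_gt_of_ne (hne T₀ Set.self_mem_Ici) with h | h
    · refine ⟨-1, by simp, fun t ht => ?_⟩
      rw [hnorm, neg_one_mul, abs_of_nonpos]
      by_contra! hcon
      obtain ⟨x, hx, hx0⟩ := isPreconnected_Ici.intermediate_value (f := fun t => (thetaHat t).re)
        Set.self_mem_Ici ht hcont.continuousOn ⟨h.le, hcon.le⟩
      exact hne x hx hx0
    · refine ⟨1, by simp, fun t ht => ?_⟩
      rw [hnorm, one_mul, abs_of_nonneg]
      by_contra! hcon
      obtain ⟨x, hx, hx0⟩ := isPreconnected_Ici.intermediate_value (f := fun t => (thetaHat t).re)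
        ht Set.self_mem_Ici hcont.continuousOn ⟨hcon.le, h.le⟩
      exact hne x hx hx0
  set J := ∫ t : ℝ, ‖thetaHat t‖ with hJ
  have hi0 : Integrable fun t : ℝ => ‖thetaHat t‖ := by
    simpa using (integrable_exp_mul_thetaHat (α := 0) (by simp; linarith)).norm
  have hbound : ∀ α : ℝ, 0 ≤ α → α < Real.pi / 4 → ∀ u : ℝ,
      ‖thetaA (u + α * Complex.I)‖ ≤
        (2 * Real.pi)⁻¹ * (2 * Real.pi * (40 / Real.pi + 2) + 2 * Real.exp T₀ * J) := by
    intro α hα0 hα u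
    have hα' : |α| < Real.pi / 4 := by rwa [abs_of_nonneg hα0]
    have hi := integrable_exp_mul_thetaHat hα'
    have hire : Integrable fun t : ℝ => Real.exp (α * t) * (thetaHat t).re := by
      refine hi.re.congr (Eventually.of_forall fun t => ?_)
      simp [-Complex.ofReal_exp]
    have hinorm : Integrable fun t : ℝ => Real.exp (α * t) * ‖thetaHat t‖ := by
      refine hi.norm.congr (Eventually.of_forall fun t => ?_)
      simp only [norm_mul, Complex.norm_real, Real.norm_of_nonneg (Real.exp_pos _).le]
    have h0 := thetaA_shift_eq_integral hα' 0
    simp only [Complex.ofReal_zero, mul_zero, Complex.exp_zero, one_mul, zero_add] at h0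
    have h0' : ∫ t : ℝ, Real.exp (α * t) * (thetaHat t).re ≤ 2 * Real.pi * (40 / Real.pi + 2) ∧
        -(2 * Real.pi * (40 / Real.pi + 2)) ≤ ∫ t : ℝ, Real.exp (α * t) * (thetaHat t).re := by
      have e : ∫ t : ℝ, (Real.exp (α * t) : ℂ) * thetaHat t =
          ((∫ t : ℝ, Real.exp (α * t) * (thetaHat t).re : ℝ) : ℂ) := by
        rw [← integral_complex_ofReal]
        refine integral_congr_ae (Eventually.of_forall fun t => ?_)
        simp only
        rw [Complex.ofReal_mul, ofReal_re_thetaHat]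
      have h1 := norm_thetaA_mul_I_le hα0 hα
      rw [h0, e, norm_smul, Complex.norm_real, Real.norm_of_nonneg (by positivity),
        inv_mul_le_iff₀ (by positivity), Real.norm_eq_abs] at h1
      exact ⟨(le_abs_self _).trans h1, neg_le_of_abs_le h1⟩
    -- Beyond `T₀` the sign `s` makes the first term an equality; before it, `α ≤ 1` and `T₀ > 0`
    -- give `e^(αt) ≤ e^(T₀)`, and the second term pays for the possibly wrong sign.
    have hpt : ∀ t : ℝ, Real.exp (α * t) * ‖thetaHat t‖ ≤
        s * (Real.exp (α * t) * (thetaHat t).re) + 2 * Real.exp T₀ * ‖thetaHat t‖ := by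
      intro t
      rcases le_total T₀ t with h | h
      · rw [hs t h]
        have : 0 ≤ 2 * Real.exp T₀ * (s * (thetaHat t).re) := by
          rw [← hs t h]
          positivity
        linarith
      · have h1 : Real.exp (α * t) ≤ Real.exp T₀ := by
          refine Real.exp_le_exp.mpr ?_
          have hα1 : α ≤ 1 := by linarith [Real.pi_lt_four]
          nlinarith
        have h2 : -(Real.exp (α * t) * ‖thetaHat t‖) ≤ s * (Real.exp (α * t) * (thetaHat t).re) := by
          refine neg_le_of_abs_le ?_
          rw [abs_mul, hs1, one_mul, abs_mul, abs_of_pos (Real.exp_pos _)]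
          gcongr
          exact Complex.abs_re_le_norm _
        have h3 := mul_le_mul_of_nonneg_right h1 (norm_nonneg (thetaHat t))
        linarith
    have hN : ∫ t : ℝ, Real.exp (α * t) * ‖thetaHat t‖ ≤
        2 * Real.pi * (40 / Real.pi + 2) + 2 * Real.exp T₀ * J := by
      calc _ ≤ ∫ t : ℝ, (s * (Real.exp (α * t) * (thetaHat t).re) +
            2 * Real.exp T₀ * ‖thetaHat t‖) :=
            integral_mono hinorm ((hire.const_mul s).add (hi0.const_mul _)) hpt
        _ = s * (∫ t : ℝ, Real.exp (α * t) * (thetaHat t).re) + 2 * Real.exp T₀ * J := by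
            rw [integral_add (hire.const_mul s) (hi0.const_mul _), integral_const_mul,
              integral_const_mul]
        _ ≤ _ := by
            refine add_le_add_left ((le_abs_self _).trans ?_) _
            rw [abs_mul, hs1, one_mul]
            exact abs_le.mpr ⟨h0'.2, h0'.1⟩
    rw [thetaA_shift_eq_integral hα', norm_smul, Real.norm_of_nonneg (by positivity)]
    refine mul_le_mul_of_nonneg_left (le_trans ?_ hN) (by positivity)
    refine norm_integral_le_of_norm_le hinorm (Eventually.of_forall fun t => ?_)
    have hn : ‖Complex.exp (-Complex.I * t * u)‖ = 1 := by
      rw [Complex.norm_exp]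
      simp
    rw [norm_mul, norm_mul, hn, one_mul, Complex.norm_real,
      Real.norm_of_nonneg (Real.exp_pos _).le]
  obtain ⟨α, hα0, hα, hK⟩ := not_bounded_thetaA
    ((2 * Real.pi)⁻¹ * (2 * Real.pi * (40 / Real.pi + 2) + 2 * Real.exp T₀ * J))
  exact absurd (hbound α hα0 hα _) (not_le.mpr hK)

/-- **Hardy's theorem**: infinitely many zeros of the zeta function lie on the critical line. -/
theorem fourierC_phi_zeros_infinite : {t : ℝ | fourierC phi t = 0}.Infinite := by
  refine thetaHat_zeros_infinite.mono fun t (ht : thetaHat t = 0) => ?_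
  change fourierC phi t = 0
  rw [fourierC_phi_eq_thetaHat, ht, mul_zero]

end

/-! ### Convolution powers of the kernel. -/

theorem bddAbove_range_norm_phi : BddAbove (Set.range fun u => ‖phi u‖) := by
  have hpi := Real.pi_pos
  obtain ⟨C, hC⟩ := norm_thetaPhi_le (α := 0) (by linarith) one_pos
  have hC0 : 0 ≤ C := by
    have h := (norm_nonneg _).trans (hC 0 (by simp))
    exact nonneg_of_mul_nonneg_left h (Real.exp_pos _)
  refine ⟨C, ?_⟩
  rintro _ ⟨u, rfl⟩
  have h := hC u (by simp)
  rw [← ofReal_phi, Complex.norm_real] at h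
  refine h.trans (mul_le_of_le_one_right hC0 (Real.exp_le_one_iff.mpr ?_))
  have := Real.exp_pos |(u : ℂ).re|
  nlinarith [abs_nonneg (u : ℂ).re]

namespace GaussKernel

variable {Φ Ψ : ℝ → ℝ}

theorem integrable (h : GaussKernel Φ) : Integrable Φ := by
  simpa using h.int 0

theorem integrable_mul_comp_sub (hΨ : GaussKernel Ψ) (hΦ : GaussKernel Φ)
    (hb : BddAbove (Set.range fun u => ‖Φ u‖)) (u : ℝ) :
    Integrable fun t => Ψ t * Φ (u - t) := by
  obtain ⟨C, hC⟩ := hb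
  have h1 := hΨ.cont
  have h2 := hΦ.cont
  exact hΨ.integrable.mul_bdd (by fun_prop : Continuous _).aestronglyMeasurable
    (Eventually.of_forall fun t => hC ⟨u - t, rfl⟩)

theorem convolution (hΨ : GaussKernel Ψ) (hΦ : GaussKernel Φ)
    (hb : BddAbove (Set.range fun u => ‖Φ u‖)) :
    GaussKernel fun u => ∫ t, Ψ t * Φ (u - t) where
  cont := hb.continuous_convolution_right_of_integrable (ContinuousLinearMap.mul ℝ ℝ)
    hΨ.integrable hΦ.cont
  pos u := by
    have hpos : ∀ t, 0 < Ψ t * Φ (u - t) := fun t => mul_pos (hΨ.pos _) (hΦ.pos _)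
    rw [integral_pos_iff_support_of_nonneg (fun t => (hpos t).le)
      (integrable_mul_comp_sub hΨ hΦ hb u)]
    have : Function.support (fun t => Ψ t * Φ (u - t)) = Set.univ :=
      Set.eq_univ_of_forall fun t => (hpos t).ne'
    rw [this]
    simp
  even u := by
    rw [← integral_neg_eq_self]
    refine integral_congr_ae (Eventually.of_forall fun t => ?_)
    simp only
    rw [hΨ.even, ← hΦ.even]
    congr 2
    ring
  int lam := by
    -- Since `u² ≤ 2t² + 2(u - t)²`, the weight `exp(lam u²)` is absorbed by giving each factor the
    -- weight with parameter `2|lam|`.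
    have hi := (hΨ.int (2 * |lam|)).integrable_convolution (ContinuousLinearMap.mul ℝ ℝ)
      (hΦ.int (2 * |lam|))
    have he := (hΨ.int (2 * |lam|)).ae_convolution_exists (ContinuousLinearMap.mul ℝ ℝ)
      (hΦ.int (2 * |lam|))
    have hc : Continuous fun u => ∫ t, Ψ t * Φ (u - t) :=
      hb.continuous_convolution_right_of_integrable (ContinuousLinearMap.mul ℝ ℝ)
        hΨ.integrable hΦ.cont
    refine hi.mono' (by fun_prop : Continuous _).aestronglyMeasurable ?_
    filter_upwards [he] with u hu
    have hpos : ∀ t, 0 < Ψ t * Φ (u - t) := fun t => mul_pos (hΨ.pos _) (hΦ.pos _)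
    rw [Real.norm_of_nonneg (mul_nonneg (integral_nonneg fun t => (hpos t).le)
      (Real.exp_pos _).le), ← integral_mul_const]
    refine integral_mono_of_nonneg
      (Eventually.of_forall fun t => mul_nonneg (hpos t).le (Real.exp_pos _).le) hu
      (Eventually.of_forall fun t => ?_)
    simp only [ContinuousLinearMap.mul_apply']
    have h1 : Real.exp (lam * u ^ 2) ≤
        Real.exp (2 * |lam| * t ^ 2) * Real.exp (2 * |lam| * (u - t) ^ 2) := by
      rw [← Real.exp_add]
      refine Real.exp_le_exp.mpr ?_
      have h2 : lam * u ^ 2 ≤ |lam| * u ^ 2 :=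
        mul_le_mul_of_nonneg_right (le_abs_self _) (sq_nonneg _)
      have h3 : 0 ≤ |lam| * (2 * t - u) ^ 2 := by positivity
      nlinarith
    calc _ ≤ Ψ t * Φ (u - t) * (Real.exp (2 * |lam| * t ^ 2) *
          Real.exp (2 * |lam| * (u - t) ^ 2)) := mul_le_mul_of_nonneg_left h1 (hpos t).le
      _ = _ := by ring

theorem integrable_mul_cexp (h : GaussKernel Φ) (z : ℂ) :
    Integrable fun u : ℝ => (Φ u : ℂ) * Complex.exp (Complex.I * z * u) :=
  h.integrable_of_le h.cont (lam := 0) (fun u => by simp [abs_of_pos (h.pos u)]) z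

theorem fourierC_convolution (hΨ : GaussKernel Ψ) (hΦ : GaussKernel Φ) (z : ℂ) :
    fourierC (fun u => ∫ t, Ψ t * Φ (u - t)) z = fourierC Ψ z * fourierC Φ z := by
  have h := integral_convolution (ContinuousLinearMap.mul ℂ ℂ) (hΨ.integrable_mul_cexp z)
    (hΦ.integrable_mul_cexp z)
  rw [ContinuousLinearMap.mul_apply'] at h
  rw [fourierC, fourierC, fourierC, ← h]
  refine integral_congr_ae (Eventually.of_forall fun u => ?_)
  simp only [convolution_def, ContinuousLinearMap.mul_apply']
  rw [← integral_complex_ofReal, ← integral_mul_const]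
  refine integral_congr_ae (Eventually.of_forall fun t => ?_)
  have e : Complex.exp (Complex.I * z * u) =
      Complex.exp (Complex.I * z * t) * Complex.exp (Complex.I * z * (u - t : ℝ)) := by
    rw [← Complex.exp_add]
    congr 1
    push_cast
    ring
  simp only
  rw [e]
  push_cast
  ring

end GaussKernel

/-- The powers of `2 ξ` on vertical lines are Fourier transforms of convolution powers of `phi`. -/
theorem exists_gaussKernel_pow {k : ℕ} (hk : 1 ≤ k) : ∃ Φ : ℝ → ℝ, GaussKernel Φ ∧
    ∀ z, fourierC Φ z = (2 * xi (1 / 2 + Complex.I * z)) ^ k := by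
  induction k, hk using Nat.le_induction with
  | base => exact ⟨phi, gaussKernel_phi, fun z => by rw [fourierC_phi, pow_one]⟩
  | succ k _ ih =>
    obtain ⟨Ψ, hΨ, hz⟩ := ih
    refine ⟨_, hΨ.convolution gaussKernel_phi bddAbove_range_norm_phi, fun z => ?_⟩
    rw [hΨ.fourierC_convolution gaussKernel_phi, hz, fourierC_phi, pow_succ]

/-! Substituting `x = exp u` on the positive half-line. -/

theorem setIntegral_Ioi_eq_integral_exp {E : Type*} [NormedAddCommGroup E] [NormedSpace ℝ E]
    (g : ℝ → E) : ∫ x in Set.Ioi 0, g x = ∫ u, Real.exp u • g (Real.exp u) := by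
  have h := integral_image_eq_integral_abs_deriv_smul MeasurableSet.univ
    (fun u _ => (Real.hasDerivAt_exp u).hasDerivWithinAt) Real.exp_injective.injOn g
  simpa [Set.image_univ, Real.range_exp] using h

theorem integrableOn_Ioi_iff_integrable_exp {E : Type*} [NormedAddCommGroup E] [NormedSpace ℝ E]
    (g : ℝ → E) : IntegrableOn g (Set.Ioi 0) ↔
      Integrable fun u => Real.exp u • g (Real.exp u) := by
  have h := integrableOn_image_iff_integrableOn_abs_deriv_smul MeasurableSet.univ
    (fun u _ => (Real.hasDerivAt_exp u).hasDerivWithinAt) Real.exp_injective.injOn g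
  simpa [Set.image_univ, Real.range_exp] using h

/-! ### Mellin inversion and the density. -/

theorem norm_two_mul_xi_le (σ : ℝ) : ∃ C, ∀ t : ℝ,
    ‖2 * xi (σ + t * Complex.I)‖ ≤ C * Real.exp (-(1 / 2) * |t|) := by
  obtain ⟨C, hC⟩ := norm_fourierC_phi_le (1 / 2 - σ)
  refine ⟨C, fun t => ?_⟩
  have h := hC t
  rw [fourierC_phi] at h
  convert h using 4
  push_cast
  linear_combination (σ - 1 / 2 : ℂ) * Complex.I_mul_I

theorem integrable_two_mul_xi_pow {k : ℕ} (hk : 1 ≤ k) (σ : ℝ) :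
    Integrable fun t : ℝ => (2 * xi (σ + t * Complex.I)) ^ k := by
  obtain ⟨C, hC⟩ := norm_two_mul_xi_le σ
  have hcont : Continuous fun t : ℝ => (2 * xi (σ + t * Complex.I)) ^ k := by
    have := differentiable_xi.continuous
    fun_prop
  have hC0 : 0 ≤ C := nonneg_of_mul_nonneg_left ((norm_nonneg _).trans (hC 0)) (Real.exp_pos _)
  refine ((integrable_exp_neg_mul_abs one_half_pos).const_mul (C ^ k)).mono'
    hcont.aestronglyMeasurable (Eventually.of_forall fun t => ?_)
  rw [norm_pow]
  refine (pow_le_pow_left₀ (norm_nonneg _) (hC t) k).trans ?_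
  rw [mul_pow]
  refine mul_le_mul_of_nonneg_left ?_ (by positivity)
  refine pow_le_of_le_one (Real.exp_pos _).le (Real.exp_le_one_iff.mpr ?_) (by omega)
  nlinarith [abs_nonneg t]

section Mellin

variable {Φ : ℝ → ℝ}

theorem exp_smul_cpow_smul (s : ℂ) (u : ℝ) :
    Real.exp u • ((Real.exp u : ℂ) ^ (s - 1) •
      ((Real.exp (-Real.log (Real.exp u) / 2) * Φ (Real.log (Real.exp u)) : ℝ) : ℂ)) =
      (Φ u : ℂ) * Complex.exp (Complex.I * (-Complex.I * (s - 1 / 2)) * u) := by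
  rw [Real.log_exp, Complex.ofReal_exp, Complex.cpow_def_of_ne_zero (Complex.exp_ne_zero _),
    Complex.log_exp (by simp [Real.pi_pos]) (by simp [Real.pi_pos.le])]
  rw [Complex.real_smul, smul_eq_mul]
  push_cast
  have e : Complex.exp (Complex.I * (-Complex.I * (s - 1 / 2)) * u) =
      Complex.exp u * Complex.exp (u * (s - 1)) * Complex.exp (-u / 2) := by
    rw [← Complex.exp_add, ← Complex.exp_add]
    congr 1
    linear_combination -((s - 1 / 2) * u) * Complex.I_mul_I
  rw [e]
  ring

theorem mellin_eq_fourierC (Φ : ℝ → ℝ) (s : ℂ) :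
    mellin (fun x => ((Real.exp (-Real.log x / 2) * Φ (Real.log x) : ℝ) : ℂ)) s =
      fourierC Φ (-Complex.I * (s - 1 / 2)) := by
  rw [mellin, setIntegral_Ioi_eq_integral_exp, fourierC]
  exact integral_congr_ae (Eventually.of_forall fun u => exp_smul_cpow_smul s u)

theorem mellinConvergent_of_gaussKernel (h : GaussKernel Φ) (s : ℂ) :
    MellinConvergent (fun x => ((Real.exp (-Real.log x / 2) * Φ (Real.log x) : ℝ) : ℂ)) s := by
  rw [MellinConvergent, integrableOn_Ioi_iff_integrable_exp]
  exact (h.integrable_mul_cexp (-Complex.I * (s - 1 / 2))).congr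
    (Eventually.of_forall fun u => (exp_smul_cpow_smul s u).symm)

/-- The functional equation `ξ(1 - s) = ξ(s)` together with `s ↦ 1 - s` turns `x^(s-1)` on `Re s =
c` into `x^(-s)` on `Re s = 1 - c`. -/
theorem v_eq_mellinInv (c : ℝ) (k : ℕ) (x : ℝ) :
    v c k x = mellinInv (1 - c) (fun s => (2 * xi s) ^ k) x := by
  have hpi : (Real.pi : ℂ) ≠ 0 := Complex.ofReal_ne_zero.mpr Real.pi_ne_zero
  rw [v, mellinInv, integral_mul_const, ← integral_neg_eq_self, Complex.real_smul]
  have e : ∀ y : ℝ, (2 : ℂ) ^ k * xi (c + (-y : ℝ) * Complex.I) ^ k *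
      (x : ℂ) ^ ((c + (-y : ℝ) * Complex.I : ℂ) - 1) =
      (x : ℂ) ^ (-(((1 - c : ℝ) : ℂ) + y * Complex.I)) •
        (2 * xi (((1 - c : ℝ) : ℂ) + y * Complex.I)) ^ k := by
    intro y
    have h1 : ((1 - c : ℝ) : ℂ) + y * Complex.I = 1 - (c + (-y : ℝ) * Complex.I) := by
      push_cast
      ring
    rw [h1, xi_one_sub, mul_pow, neg_sub, smul_eq_mul]
    ring
  simp only [e]
  push_cast
  field_simp

/-- The Mellin transform of the right side is `(2ξ)^k` and converges for every `s`, so inversion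
works on any vertical line and the result does not depend on `c`. -/
theorem v_eq {c : ℝ} {k : ℕ} (hk : 1 ≤ k) (h : GaussKernel Φ)
    (hΦ : ∀ z, fourierC Φ z = (2 * xi (1 / 2 + Complex.I * z)) ^ k) {x : ℝ} (hx : 0 < x) :
    v c k x = ((Real.exp (-Real.log x / 2) * Φ (Real.log x) : ℝ) : ℂ) := by
  have hm : mellin (fun x => ((Real.exp (-Real.log x / 2) * Φ (Real.log x) : ℝ) : ℂ)) =
      fun s => (2 * xi s) ^ k := by
    ext s
    rw [mellin_eq_fourierC, hΦ]
    congr 3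
    linear_combination -(s - 1 / 2) * Complex.I_mul_I
  rw [v_eq_mellinInv c k x, ← hm]
  refine mellinInv_mellin_eq (1 - c) _ hx (mellinConvergent_of_gaussKernel h _) ?_ ?_
  · rw [hm]
    exact integrable_two_mul_xi_pow hk (1 - c)
  · have hl : ContinuousAt Real.log x := Real.continuousAt_log hx.ne'
    have hc : ContinuousAt (fun x => Φ (Real.log x)) x :=
      ContinuousAt.comp (f := Real.log) h.cont.continuousAt hl
    exact Complex.continuous_ofReal.continuousAt.comp
      ((Real.continuous_exp.continuousAt.comp (hl.neg.div_const 2)).mul hc)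

end Mellin

/-! ### The critical strip, and expectations under the law. -/

theorem xi_ne_zero_of_one_le_re {s : ℂ} (hs : 1 ≤ s.re) : xi s ≠ 0 := by
  by_cases h1 : s = 1
  · simp [h1, xi]
  have h0 : s ≠ 0 := by
    rintro rfl
    norm_num at hs
  have hΓ : Complex.Gammaℝ s ≠ 0 := Complex.Gammaℝ_ne_zero_of_re_pos (by linarith)
  have hζ := riemannZeta_ne_zero_of_one_le_re hs
  rw [riemannZeta_def_of_ne_zero h0] at hζ
  have hΛ : completedRiemannZeta s ≠ 0 := fun h => hζ (by rw [h, zero_div])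
  have h2 : 2 * xi s ≠ 0 := by
    rw [two_mul_xi_eq h0 h1]
    exact mul_ne_zero (mul_ne_zero h0 (sub_ne_zero.mpr h1)) hΛ
  exact right_ne_zero_of_mul h2

theorem re_mem_Ioo_of_xi_eq_zero {s : ℂ} (hs : xi s = 0) : s.re ∈ Set.Ioo 0 1 := by
  constructor
  · by_contra! h
    refine xi_ne_zero_of_one_le_re (s := 1 - s) ?_ (by rw [xi_one_sub, hs])
    simpa using h
  · by_contra! h
    exact xi_ne_zero_of_one_le_re h hs

theorem sq_im_le_of_xi_eq_zero {z : ℂ} (hz : xi (1 / 2 + Complex.I * z) = 0) :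
    z.im ^ 2 ≤ 1 / 4 := by
  obtain ⟨h1, h2⟩ := re_mem_Ioo_of_xi_eq_zero hz
  have e : (1 / 2 + Complex.I * z).re = 1 / 2 - z.im := by
    simp
    ring
  rw [e] at h1 h2
  nlinarith

section Law

variable {c : ℝ} {k : ℕ} {Φ : ℝ → ℝ}

theorem law_eq (hk : 1 ≤ k) (h : GaussKernel Φ)
    (hΦ : ∀ z, fourierC Φ z = (2 * xi (1 / 2 + Complex.I * z)) ^ k) :
    law c k = (volume.restrict (Set.Ioi 0)).withDensity fun x =>
      ENNReal.ofReal (x⁻¹ * (Real.exp (-Real.log x / 2) * Φ (Real.log x))) := by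
  refine withDensity_congr_ae ?_
  filter_upwards [ae_restrict_mem measurableSet_Ioi] with x hx
  rw [v_eq hk h hΦ hx, Complex.ofReal_re]

theorem measurable_density (h : GaussKernel Φ) :
    Measurable fun x => x⁻¹ * (Real.exp (-Real.log x / 2) * Φ (Real.log x)) := by
  have h1 : Measurable fun x => Φ (Real.log x) := h.cont.measurable.comp Real.measurable_log
  exact measurable_inv.mul
    ((Real.measurable_exp.comp (Real.measurable_log.neg.div_const 2)).mul h1)

theorem exp_smul_density (u : ℝ) :
    Real.exp u * ((Real.exp u)⁻¹ * (Real.exp (-Real.log (Real.exp u) / 2) *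
      Φ (Real.log (Real.exp u)))) = Φ u * Real.exp (-u / 2) := by
  rw [Real.log_exp, mul_inv_cancel_left₀ (Real.exp_ne_zero u), mul_comm]

theorem isProbabilityMeasure_law (hk : 1 ≤ k) (h : GaussKernel Φ)
    (hΦ : ∀ z, fourierC Φ z = (2 * xi (1 / 2 + Complex.I * z)) ^ k) :
    IsProbabilityMeasure (law c k) := by
  have hz : ∀ u : ℝ, (Φ u : ℂ) * Complex.exp (Complex.I * (Complex.I / 2) * u) =
      ((Φ u * Real.exp (-u / 2) : ℝ) : ℂ) := by
    intro u
    push_cast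
    congr 2
    linear_combination (u / 2 : ℂ) * Complex.I_mul_I
  have hi : Integrable fun u => Φ u * Real.exp (-u / 2) := by
    have := h.integrable_mul_cexp (Complex.I / 2)
    simp only [hz] at this
    exact this.re
  -- The total mass is the transform at `z = i/2`, that is at `s = 0`, where `2ξ(0) = 1`.
  have hmass : ∫ u, Φ u * Real.exp (-u / 2) = 1 := by
    have h1 := hΦ (Complex.I / 2)
    rw [fourierC] at h1
    simp only [hz] at h1
    rw [integral_complex_ofReal] at h1
    have h2 : 1 / 2 + Complex.I * (Complex.I / 2) = 0 := by
      linear_combination (1 / 2 : ℂ) * Complex.I_mul_I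
    rw [h2, xi] at h1
    simpa using h1
  have hion : IntegrableOn (fun x => x⁻¹ * (Real.exp (-Real.log x / 2) * Φ (Real.log x)))
      (Set.Ioi 0) := by
    rw [integrableOn_Ioi_iff_integrable_exp]
    simpa only [smul_eq_mul, exp_smul_density] using hi
  refine ⟨?_⟩
  rw [law_eq hk h hΦ, withDensity_apply _ MeasurableSet.univ, Measure.restrict_univ,
    ← ofReal_integral_eq_lintegral_ofReal hion, setIntegral_Ioi_eq_integral_exp]
  · simp only [smul_eq_mul, exp_smul_density]
    rw [hmass, ENNReal.ofReal_one]
  · filter_upwards [ae_restrict_mem measurableSet_Ioi] with x hx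
    have h1 : 0 < x := hx
    have h2 := h.pos (Real.log x)
    simp only [Pi.zero_apply]
    positivity

theorem measurable_weight_id (lam : ℝ) (t : ℂ) : Measurable (weight id lam t : ℝ → ℂ) := by
  unfold weight
  have h1 : Measurable fun x : ℝ => ((√(id x) : ℝ) : ℂ) :=
    Complex.measurable_ofReal.comp (Real.continuous_sqrt.measurable)
  have h2 : Measurable fun x : ℝ => ((Real.log (id x) : ℝ) : ℂ) :=
    Complex.measurable_ofReal.comp Real.measurable_log
  fun_prop

/-- Under `x = e^u` the Jacobian cancels `x⁻¹`, and the size-biasing factor `√x` cancels the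
`x^(-1/2)` in `v_k`, leaving the even kernel `Φ`. -/
theorem exp_smul_density_smul_weight (h : GaussKernel Φ) (lam : ℝ) (t : ℂ) (u : ℝ) :
    Real.exp u • (ENNReal.ofReal ((Real.exp u)⁻¹ * (Real.exp (-Real.log (Real.exp u) / 2) *
      Φ (Real.log (Real.exp u))))).toReal • weight id lam t (Real.exp u) =
      ((Φ u * Real.exp (lam * u ^ 2) : ℝ) : ℂ) * Complex.exp (Complex.I * t * u) := by
  have hp : 0 ≤ (Real.exp u)⁻¹ * (Real.exp (-Real.log (Real.exp u) / 2) *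
      Φ (Real.log (Real.exp u))) := by
    have := h.pos (Real.log (Real.exp u))
    positivity
  have hs : √(Real.exp u) = Real.exp (u / 2) := by
    rw [Real.sqrt_eq_rpow, ← Real.exp_mul]
    ring_nf
  rw [ENNReal.toReal_ofReal hp, smul_smul, exp_smul_density, weight, id, hs, Real.log_exp,
    Complex.real_smul, Complex.exp_add]
  have e : Complex.exp ((-u / 2 : ℂ)) * Complex.exp ((u / 2 : ℂ)) = 1 := by
    rw [← Complex.exp_add]
    ring_nf
    exact Complex.exp_zero
  push_cast
  linear_combination (Φ u * Complex.exp (lam * u ^ 2) * Complex.exp (Complex.I * t * u)) * e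

theorem integrable_weight_law (hk : 1 ≤ k) (h : GaussKernel Φ)
    (hΦ : ∀ z, fourierC Φ z = (2 * xi (1 / 2 + Complex.I * z)) ^ k) (lam : ℝ) (t : ℂ) :
    Integrable (weight id lam t) (law c k) := by
  rw [law_eq hk h hΦ, integrable_withDensity_iff_integrable_smul'
    (measurable_density h).ennreal_ofReal (Eventually.of_forall fun _ => ENNReal.ofReal_lt_top)]
  refine (integrableOn_Ioi_iff_integrable_exp _).mpr ?_
  simp only [exp_smul_density_smul_weight h]
  have hc := h.cont
  refine h.integrable_of_le (by fun_prop) (lam := lam) (fun u => ?_) t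
  rw [abs_of_pos (mul_pos (h.pos u) (Real.exp_pos _))]

theorem integral_weight_law (hk : 1 ≤ k) (h : GaussKernel Φ)
    (hΦ : ∀ z, fourierC Φ z = (2 * xi (1 / 2 + Complex.I * z)) ^ k) (lam : ℝ) (t : ℂ) :
    ∫ x, weight id lam t x ∂law c k = fourierC (fun u => Φ u * Real.exp (lam * u ^ 2)) t := by
  rw [law_eq hk h hΦ, integral_withDensity_eq_integral_toReal_smul
    (measurable_density h).ennreal_ofReal (Eventually.of_forall fun _ => ENNReal.ofReal_lt_top),
    setIntegral_Ioi_eq_integral_exp, fourierC]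
  exact integral_congr_ae (Eventually.of_forall (exp_smul_density_smul_weight h lam t))

end Law

end SizeBiased

end

theorem theorem3p1 (k : ℕ) (hk : 1 ≤ k) (c : ℝ) (hc0 : 0 < c) (hc1 : c < 1) :
    -- the density is real and positive and defines a probability distribution
    (∀ x : ℝ, 0 < x → (SizeBiased.v c k x).im = 0 ∧ 0 < (SizeBiased.v c k x).re) ∧
    IsProbabilityMeasure (SizeBiased.law c k) ∧
    -- every random variable with that distribution has the asserted properties
    ∀ {Ω : Type*} [MeasurableSpace Ω] (P : Measure Ω) (X : Ω → ℝ),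
      HasLaw X (SizeBiased.law c k) P →
        (∀ (lam : ℝ) (t : ℂ), Integrable (SizeBiased.weight X lam t) P) ∧
        (∀ lam : ℝ, 1 / 8 ≤ lam → ∀ t : ℂ,
          ∫ ω, SizeBiased.weight X lam t ω ∂P = 0 → t.im = 0) ∧
        {t : ℝ | ∫ ω, SizeBiased.weight X 0 (t : ℂ) ω ∂P = 0}.Infinite := by
  obtain ⟨Φ, h, hΦ⟩ := SizeBiased.exists_gaussKernel_pow hk
  refine ⟨fun x hx => ?_, SizeBiased.isProbabilityMeasure_law hk h hΦ, ?_⟩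
  · rw [SizeBiased.v_eq hk h hΦ hx]
    exact ⟨Complex.ofReal_im _, mul_pos (Real.exp_pos _) (h.pos _)⟩
  intro Ω _ P X hX
  have hint : ∀ (lam : ℝ) (t : ℂ), ∫ ω, SizeBiased.weight X lam t ω ∂P =
      SizeBiased.fourierC (fun u => Φ u * Real.exp (lam * u ^ 2)) t := by
    intro lam t
    rw [← SizeBiased.integral_weight_law (c := c) hk h hΦ,
      ← hX.integral_comp (SizeBiased.measurable_weight_id lam t).aestronglyMeasurable]
    rfl
  refine ⟨fun lam t => ?_, fun lam hlam t ht => ?_, ?_⟩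
  · have hi := SizeBiased.integrable_weight_law (c := c) hk h hΦ lam t
    rw [← hX.map_eq] at hi
    exact hi.comp_aemeasurable hX.aemeasurable
  · rw [hint] at ht
    -- The critical strip gives `D = 1/4`, and `D ≤ 2 * lam` is the threshold `1/8`.
    refine h.im_eq_zero (D := 1 / 4) (by norm_num) (fun z hz => ?_) (by linarith) (by linarith) ht
    rw [hΦ] at hz
    exact SizeBiased.sq_im_le_of_xi_eq_zero
      ((mul_eq_zero.mp (pow_eq_zero_iff (by omega) |>.mp hz)).resolve_left two_ne_zero)
  -- For `lam = 0` the expectation is the `k`-th power of the transform of `phi`, so Hardy's zeros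
  -- suffice for every `k`.
  · refine SizeBiased.fourierC_phi_zeros_infinite.mono fun t ht => ?_
    replace ht : SizeBiased.fourierC SizeBiased.phi t = 0 := ht
    change ∫ ω, SizeBiased.weight X 0 (t : ℂ) ω ∂P = 0
    rw [hint]
    have e : (fun u => Φ u * Real.exp (0 * u ^ 2)) = Φ := by
      ext u
      simp
    rw [e, hΦ, ← SizeBiased.fourierC_phi, ht, zero_pow (by omega)]
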